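/- Let $K$ be a field of characteristic $0$, $V$ a $K$-vector space, $\sigma$ a braiding on $V$ (an invertible endomorphism of $V\otimes V$ with $(\sigma\otimes\mathrm{id})(\mathrm{id}\otimes\sigma)(\sigma\otimes\mathrm{id})=(\mathrm{id}\otimes\sigma)(\sigma\otimes\mathrm{id})(\mathrm{id}\otimes\sigma)$). Let $T(V)=\bigoplus_{n\ge 0}V^{\otimes n}$, with unit $1\in V^{\otimes 0}=K$, counit $\varepsilon:T(V)\to V^{\otimes 0}=K$, projection $P_V:T(V)\to V$, and deconcatenation coproduct $\delta(v_1\cdots v_n)=\sum_{i=0}^n v_1\cdots v_i\,\underline\otimes\, v_{i+1}\cdots v_n$; write $T^c(V)=(T(V),\delta,\varepsilon)$. For $1\le k<n$ let $\sigma_k=\mathrm{id}^{\otimes(k-1)}\otimes\sigma\otimes\mathrm{id}^{\otimes(n-k-1)}$ on $V^{\otimes n}$, and let $\beta$ be the endomorphism of $T(V)\underline\otimes T(V)$ whose restriction $\beta_{ij}:V^{\otimes i}\underline\otimes V^{\otimes j}\to V^{\otimes j}\underline\otimes V^{\otimes i}$ is $\sigma_{i_1}\cdots\sigma_{i_l}$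 for a reduced expression $s_{i_1}\cdots s_{i_l}$ of the permutation $\chi_{ij}$ sending $a\mapsto a+j$ for $a\le i$ and $a\mapsto a-i$ for $i<a\le i+j$ (the flip if $i=0$ or $j=0$). Put $\Delta_\beta=(\mathrm{id}\otimes\beta\otimes\mathrm{id})(\delta\otimes\delta)$ on $T(V)\underline\otimes T(V)$, $\overline{\Delta_\beta}(x)=\Delta_\beta(x)-x\,\underline\otimes\,(1\underline\otimes 1)-(1\underline\otimes 1)\,\underline\otimes\, x$, $\overline{\Delta_\beta}^{(0)}=\mathrm{id}$, and $\overline{\Delta_\beta}^{(n)}=(\overline{\Delta_\beta}\otimes\mathrm{id}^{\otimes (n-1)})\overline{\Delta_\beta}^{(n-1)}$ for $n\ge1$. Let $M=\bigoplus M_{pq}$ with $M_{pq}:V^{\otimes p}\underline\otimes V^{\otimes q}\to V$ linear, $p,q\ge0$, and suppose that $(V,M,\sigma)$ is a quantum $B_\infty$-algebra, i.e. 1. $M_{00}=0$, $M_{10}=\mathrm{id}_V=M_{01}$, and $M_{n0}=0=M_{0n}$ for $n\ge2$; 2. for all $i,j,k\ge1$: $\beta_{1k}(M_{ij}\otimes\mathrm{id}_V^{\otimes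 k})=(\mathrm{id}_V^{\otimes k}\otimes M_{ij})\beta_{i+j,k}$ and $\beta_{i1}(\mathrm{id}_V^{\otimes i}\otimes M_{jk})=(M_{jk}\otimes\mathrm{id}_V^{\otimes i})\beta_{i,j+k}$; 3. for all $i,j,k\ge1$, on $V^{\otimes i}\otimes V^{\otimes j}\otimes V^{\otimes k}$: $$\sum_{r=1}^{i+j}M_{rk}\circ\big((M^{\otimes r}\circ\overline{\Delta_\beta}^{(r-1)})\otimes\mathrm{id}_V^{\otimes k}\big)=\sum_{l=1}^{j+k}M_{il}\circ\big(\mathrm{id}_V^{\otimes i}\otimes(M^{\otimes l}\circ\overline{\Delta_\beta}^{(l-1)})\big).$$ Then the map $\ast=\varepsilon\otimes\varepsilon+\sum_{n\ge1}M^{\otimes n}\circ\overline{\Delta_\beta}^{(n-1)}:T(V)\underline\otimes T(V)\to T(V)$ is well defined (on each element only finitely many terms are nonzero); it is the unique coalgebra map $f:(T^c(V)\underline\otimes T^c(V),\Delta_\beta,\varepsilon\otimes\varepsilon)\to T^c(V)$ with $P_V\circ f=M$; and $(T(V),\ast,\beta)$ is a YB algebra with unit $1$: the product $\ast$ is associative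 with two-sided unit $1$, $\beta$ is a braiding on $T(V)$, and, with $\beta_1=\beta\otimes\mathrm{id}$ and $\beta_2=\mathrm{id}\otimes\beta$, $$\beta(\ast\otimes\mathrm{id})=(\mathrm{id}\otimes\ast)\beta_1\beta_2,\qquad \beta(\mathrm{id}\otimes\ast)=(\ast\otimes\mathrm{id})\beta_2\beta_1,\qquad \beta(1\underline\otimes x)=x\underline\otimes 1,\quad \beta(x\underline\otimes1)=1\underline\otimes x .$$ -/

import Mathlib

open scoped TensorProduct DirectSum

noncomputable section

namespace QBInf

section Braided

variable {K A : Type*} [Field K] [AddCommGroup A] [Module K A]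

/-- `σ₁ = σ ⊗ id` on `A ⊗ A ⊗ A`. -/
def act₁ (σ : A ⊗[K] A →ₗ[K] A ⊗[K] A) : (A ⊗[K] A) ⊗[K] A →ₗ[K] (A ⊗[K] A) ⊗[K] A :=
  σ.rTensor A

/-- `σ₂ = id ⊗ σ` on `A ⊗ A ⊗ A`. -/
def act₂ (σ : A ⊗[K] A →ₗ[K] A ⊗[K] A) : (A ⊗[K] A) ⊗[K] A →ₗ[K] (A ⊗[K] A) ⊗[K] A :=
  (TensorProduct.assoc K A A A).symm.toLinearMap ∘ₗ σ.lTensor A ∘ₗ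
    (TensorProduct.assoc K A A A).toLinearMap

/-- A braiding: an invertible solution of the quantum Yang-Baxter equation. -/
structure IsBraiding (σ : A ⊗[K] A →ₗ[K] A ⊗[K] A) : Prop where
  bijective : Function.Bijective σ
  yang_baxter : act₁ σ ∘ₗ act₂ σ ∘ₗ act₁ σ = act₂ σ ∘ₗ act₁ σ ∘ₗ act₂ σ

/-- `(A, m, u, σ)` is a Yang-Baxter algebra: `(A, m)` is an associative algebra with unit `u`,
`σ` is a braiding on `A`, and `σ` is compatible with the product and the unit. -/
structure IsYBAlgebra (m : A ⊗[K] A →ₗ[K] A) (u : A) (σ : A ⊗[K] A →ₗ[K] A ⊗[K] A) : Prop where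
  mul_assoc : ∀ a b c : A, m (m (a ⊗ₜ b) ⊗ₜ c) = m (a ⊗ₜ m (b ⊗ₜ c))
  one_mul : ∀ a : A, m (u ⊗ₜ a) = a
  mul_one : ∀ a : A, m (a ⊗ₜ u) = a
  braiding : IsBraiding σ
  /-- `σ (m ⊗ id) = (id ⊗ m) σ₁ σ₂` -/
  braid_mul_left : σ ∘ₗ m.rTensor A =
    m.lTensor A ∘ₗ (TensorProduct.assoc K A A A).toLinearMap ∘ₗ act₁ σ ∘ₗ act₂ σ
  /-- `σ (id ⊗ m) = (m ⊗ id) σ₂ σ₁` -/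
  braid_mul_right : σ ∘ₗ m.lTensor A ∘ₗ (TensorProduct.assoc K A A A).toLinearMap =
    m.rTensor A ∘ₗ act₂ σ ∘ₗ act₁ σ
  braid_one_left : ∀ a : A, σ (u ⊗ₜ a) = a ⊗ₜ u
  braid_one_right : ∀ a : A, σ (a ⊗ₜ u) = u ⊗ₜ a

end Braided

section Powers

variable (K C : Type*) [Field K] [AddCommGroup C] [Module K C]

/-- The identification `C ≃ C^{⊗1}`. -/
def toPowOne : C ≃ₗ[K] ⨂[K]^1 C :=
  (PiTensorProduct.subsingletonEquiv (R := K) (s := fun _ : Fin 1 => C) 0).symm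

/-- The identification `C^{⊗n} ⊗ C ≃ C^{⊗(n+1)}`. -/
def snoc (n : ℕ) : (⨂[K]^n C) ⊗[K] C ≃ₗ[K] ⨂[K]^(n + 1) C :=
  TensorProduct.congr (LinearEquiv.refl K _) (toPowOne K C) ≪≫ₗ TensorPower.mulEquiv

variable {K C}

/-- The reduced coproduct `x ↦ Δ x - x ⊗ e - e ⊗ x`. -/
def reduced (Δ : C →ₗ[K] C ⊗[K] C) (e : C) : C →ₗ[K] C ⊗[K] C :=
  Δ - (TensorProduct.mk K C C).flip e - TensorProduct.mk K C C e

/-- The iterate `D^{(n)} : C → C^{⊗(n+1)}` of `D : C → C ⊗ C`, i.e. `D^{(0)} = id` and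
`D^{(n+1)} = (D ⊗ id^{⊗n}) ⋯ (D ⊗ id) D = (D^{(n)} ⊗ id) D`. -/
def iter (D : C →ₗ[K] C ⊗[K] C) : (n : ℕ) → C →ₗ[K] ⨂[K]^(n + 1) C
  | 0 => (toPowOne K C).toLinearMap
  | n + 1 => (snoc K C (n + 1)).toLinearMap ∘ₗ (iter D n).rTensor C ∘ₗ D

end Powers

section BraidAction

variable {K V : Type*} [Field K] [AddCommGroup V] [Module K V]

/-- `id^{⊗k} ⊗ σ ⊗ id^{⊗(n-k-2)}` on `V^{⊗n}`: the operator `σ` acting in the places `k` and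
`k + 1`, where places are counted from `0` (and the identity when `n < k + 2`). -/
def sigmaAt (σ : V ⊗[K] V →ₗ[K] V ⊗[K] V) : (n k : ℕ) → Module.End K (⨂[K]^n V)
  | 0, _ => LinearMap.id
  | 1, _ => LinearMap.id
  | n + 2, k =>
    if k = n then
      ((snoc K V n).rTensor V ≪≫ₗ snoc K V (n + 1)).toLinearMap ∘ₗ
        (TensorProduct.assoc K (⨂[K]^n V) V V).symm.toLinearMap ∘ₗ
        σ.lTensor (⨂[K]^n V) ∘ₗ
        (TensorProduct.assoc K (⨂[K]^n V) V V).toLinearMap ∘ₗ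
        ((snoc K V n).rTensor V ≪≫ₗ snoc K V (n + 1)).symm.toLinearMap
    else
      (snoc K V (n + 1)).toLinearMap ∘ₗ (sigmaAt σ (n + 1) k).rTensor V ∘ₗ
        (snoc K V (n + 1)).symm.toLinearMap

/-- The operator `σ_{i₁} ⋯ σ_{iₗ}` (a composition: the last letter acts first). -/
def wordAct (σ : V ⊗[K] V →ₗ[K] V ⊗[K] V) (n : ℕ) (w : List ℕ) : Module.End K (⨂[K]^n V) :=
  (w.map (sigmaAt σ n)).prod

end BraidAction

/-- A reduced word, in the simple transpositions `(k, k+1)` of `0, 1, 2, …`, of the permutation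
`χ_{ij}` which moves the first `i` letters past the following `j` letters:
the blocks `t, t+1, …, t+i-1` for `t = j-1, …, 1, 0`. -/
def chiWord (i j : ℕ) : List ℕ :=
  (List.range j).reverse.flatMap fun t => (List.range i).map fun s => t + s

/-- The length of `chiWord i j` is `i * j`, the number of inversions of `χ_{ij}`. -/
theorem length_chiWord (i j : ℕ) : (chiWord i j).length = i * j := by
  simp [chiWord, List.length_flatMap, mul_comm]

theorem swap_range_prod (j i a : ℕ) :
    (((List.range i).map fun s => Equiv.swap (j + s) (j + s + 1)).prod : Equiv.Perm ℕ) a =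
      if j ≤ a ∧ a < j + i then a + 1 else if a = j + i then j else a := by
  induction i generalizing a with
  | zero =>
    simp only [List.range_zero, List.map_nil, List.prod_nil, Equiv.Perm.one_apply]
    grind
  | succ i ih =>
    rw [List.range_succ, List.map_append, List.prod_append, Equiv.Perm.mul_apply, List.map_singleton,
      List.prod_singleton, ih, Equiv.swap_apply_def]
    grind

/-- The product of the transpositions in `chiWord i j` is `χ_{ij}`. -/
theorem prod_chiWord (i j a : ℕ) :
    (((chiWord i j).map fun k => Equiv.swap k (k + 1)).prod : Equiv.Perm ℕ) a =
      if a < i then a + j else if a < i + j then a - i else a := by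
  induction j generalizing a with
  | zero =>
    simp only [chiWord, List.range_zero, List.reverse_nil, List.flatMap_nil, List.map_nil,
      List.prod_nil, Equiv.Perm.one_apply]
    grind
  | succ j ih =>
    have h : chiWord i (j + 1) = (List.range i).map (fun s => j + s) ++ chiWord i j := by
      simp [chiWord, List.range_succ]
    rw [h, List.map_append, List.prod_append, Equiv.Perm.mul_apply, ih, List.map_map]
    refine (swap_range_prod j i _).trans ?_
    grind

section TensorSpace

variable (K V : Type*) [Field K] [AddCommGroup V] [Module K V]

/-- The tensor space `T(V) = ⨁ₙ V^{⊗n}`; its unit `1 ∈ V^{⊗0}` is `(1 : TV K V)`. -/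
abbrev TV : Type _ := ⨁ n : ℕ, ⨂[K]^n V

/-- The inclusion `V^{⊗n} ⊆ T(V)`. -/
abbrev incl (n : ℕ) : (⨂[K]^n V) →ₗ[K] TV K V :=
  DirectSum.lof K ℕ (fun n => ⨂[K]^n V) n

/-- The inclusion `V^{⊗p} ⊗ V^{⊗q} ⊆ T(V) ⊗ T(V)`. -/
abbrev incl₂ (p q : ℕ) : (⨂[K]^p V) ⊗[K] (⨂[K]^q V) →ₗ[K] TV K V ⊗[K] TV K V :=
  TensorProduct.map (incl K V p) (incl K V q)

/-- The counit `ε` of `T^c(V)`: the projection onto `V^{⊗0} = K`. -/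
def counit : TV K V →ₗ[K] K :=
  (TensorPower.algebraMap₀ (R := K) (M := V)).symm.toLinearMap ∘ₗ
    DirectSum.component K ℕ (fun n => ⨂[K]^n V) 0

/-- The projection `P_V : T(V) → V`. -/
def projV : TV K V →ₗ[K] V :=
  (toPowOne K V).symm.toLinearMap ∘ₗ DirectSum.component K ℕ (fun n => ⨂[K]^n V) 1

/-- The deconcatenation `δ`; on `V^{⊗n}` it is the sum over `i + j = n` of the canonical
identifications `V^{⊗n} = V^{⊗i} ⊗ V^{⊗j}`. -/
def deconc : TV K V →ₗ[K] TV K V ⊗[K] TV K V :=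
  DirectSum.toModule K ℕ _ fun n =>
    ∑ p : {p : ℕ × ℕ // p ∈ Finset.HasAntidiagonal.antidiagonal n},
      incl₂ K V p.1.1 p.1.2 ∘ₗ TensorPower.mulEquiv.symm.toLinearMap ∘ₗ
        (TensorPower.cast K V (Finset.HasAntidiagonal.mem_antidiagonal.1 p.2).symm).toLinearMap

/-- The counit `ε ⊗ ε` of `T^c(V) ⊗ T^c(V)`. -/
def counit₂ : TV K V ⊗[K] TV K V →ₗ[K] K :=
  LinearMap.mul' K K ∘ₗ TensorProduct.map (counit K V) (counit K V)

variable {K V}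

/-- The linear map on `T(V) ⊗ T(V)` given by its restrictions to the `V^{⊗p} ⊗ V^{⊗q}`. -/
def ofBidegrees {W : Type*} [AddCommMonoid W] [Module K W]
    (f : ∀ p q : ℕ, (⨂[K]^p V) ⊗[K] (⨂[K]^q V) →ₗ[K] W) : TV K V ⊗[K] TV K V →ₗ[K] W :=
  DirectSum.toModule K (ℕ × ℕ) W (fun pq => f pq.1 pq.2) ∘ₗ
    (TensorProduct.directSum K K (fun n : ℕ => ⨂[K]^n V) (fun n : ℕ => ⨂[K]^n V)).toLinearMap

/-- `β_{ij} = T_{χ_{ij}} : V^{⊗i} ⊗ V^{⊗j} → V^{⊗j} ⊗ V^{⊗i}`. The word of `χ_{ij}` is empty if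
`i = 0` or `j = 0`, so then `β_{ij}` is the flip. -/
def betaAt (σ : V ⊗[K] V →ₗ[K] V ⊗[K] V) (i j : ℕ) :
    (⨂[K]^i V) ⊗[K] (⨂[K]^j V) →ₗ[K] (⨂[K]^j V) ⊗[K] (⨂[K]^i V) :=
  TensorPower.mulEquiv.symm.toLinearMap ∘ₗ
    (TensorPower.cast K V (Nat.add_comm i j)).toLinearMap ∘ₗ
    wordAct σ (i + j) (chiWord i j) ∘ₗ TensorPower.mulEquiv.toLinearMap

/-- The braiding `β` of `T(V)`. -/
def beta (σ : V ⊗[K] V →ₗ[K] V ⊗[K] V) : TV K V ⊗[K] TV K V →ₗ[K] TV K V ⊗[K] TV K V :=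
  ofBidegrees fun i j => incl₂ K V j i ∘ₗ betaAt σ i j

/-- The coproduct `Δ_β = (id ⊗ β ⊗ id)(δ ⊗ δ)` of `T^c(V) ⊗ T^c(V)`. -/
def comulBeta (σ : V ⊗[K] V →ₗ[K] V ⊗[K] V) :
    TV K V ⊗[K] TV K V →ₗ[K] (TV K V ⊗[K] TV K V) ⊗[K] (TV K V ⊗[K] TV K V) :=
  (TensorProduct.assoc K (TV K V) (TV K V) (TV K V ⊗[K] TV K V)).symm.toLinearMap ∘ₗ
    (((TensorProduct.assoc K (TV K V) (TV K V) (TV K V)).toLinearMap ∘ₗ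
      (beta σ).rTensor (TV K V) ∘ₗ
      (TensorProduct.assoc K (TV K V) (TV K V) (TV K V)).symm.toLinearMap).lTensor (TV K V)) ∘ₗ
    (TensorProduct.assoc K (TV K V) (TV K V) (TV K V ⊗[K] TV K V)).toLinearMap ∘ₗ
    TensorProduct.map (deconc K V) (deconc K V)

/-- The map `M^{⊗(n+1)} ∘ \bar Δ_β^{(n)} : T(V) ⊗ T(V) → V^{⊗(n+1)}`, where the reduced coproduct
is taken with respect to the group-like element `1 ⊗ 1`. -/
def starPow (σ : V ⊗[K] V →ₗ[K] V ⊗[K] V)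
    (M : ∀ p q : ℕ, (⨂[K]^p V) ⊗[K] (⨂[K]^q V) →ₗ[K] V) (n : ℕ) :
    TV K V ⊗[K] TV K V →ₗ[K] ⨂[K]^(n + 1) V :=
  PiTensorProduct.map (fun _ : Fin (n + 1) => ofBidegrees M) ∘ₗ
    iter (reduced (comulBeta σ) ((1 : TV K V) ⊗ₜ[K] (1 : TV K V))) n

/-- `starPow` restricted to `V^{⊗p} ⊗ V^{⊗q}`. -/
def starPowAt (σ : V ⊗[K] V →ₗ[K] V ⊗[K] V)
    (M : ∀ p q : ℕ, (⨂[K]^p V) ⊗[K] (⨂[K]^q V) →ₗ[K] V) (n p q : ℕ) :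
    (⨂[K]^p V) ⊗[K] (⨂[K]^q V) →ₗ[K] ⨂[K]^(n + 1) V :=
  starPow σ M n ∘ₗ incl₂ K V p q

/-- The product `∗ = ε ⊗ ε + ∑_{n ≥ 1} M^{⊗n} ∘ \bar Δ_β^{(n-1)}` on `T(V)`.
On `V^{⊗p} ⊗ V^{⊗q}` only the terms with `n ≤ p + q` are written: the others vanish there. -/
def star (σ : V ⊗[K] V →ₗ[K] V ⊗[K] V)
    (M : ∀ p q : ℕ, (⨂[K]^p V) ⊗[K] (⨂[K]^q V) →ₗ[K] V) :
    TV K V ⊗[K] TV K V →ₗ[K] TV K V :=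
  (counit₂ K V).smulRight (1 : TV K V) +
    ofBidegrees fun p q => ∑ n ∈ Finset.range (p + q), incl K V (n + 1) ∘ₗ starPowAt σ M n p q

/-- `f : T^c(V) ⊗ T^c(V) → T^c(V)` is a coalgebra map for the coproducts `Δ_β` and `δ`. -/
structure IsCoalgMap (σ : V ⊗[K] V →ₗ[K] V ⊗[K] V) (f : TV K V ⊗[K] TV K V →ₗ[K] TV K V) :
    Prop where
  counit_comp : counit K V ∘ₗ f = counit₂ K V
  comul_comp : deconc K V ∘ₗ f = TensorProduct.map f f ∘ₗ comulBeta σ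

/-- `(V, M, σ)` is a quantum `B_∞`-algebra. -/
structure IsQuantumBInfty (σ : V ⊗[K] V →ₗ[K] V ⊗[K] V)
    (M : ∀ p q : ℕ, (⨂[K]^p V) ⊗[K] (⨂[K]^q V) →ₗ[K] V) : Prop where
  braiding : IsBraiding σ
  zero_zero : M 0 0 = 0
  one_zero : ∀ v : V, M 1 0 (toPowOne K V v ⊗ₜ TensorPower.algebraMap₀ (1 : K)) = v
  zero_one : ∀ v : V, M 0 1 (TensorPower.algebraMap₀ (1 : K) ⊗ₜ toPowOne K V v) = v
  left_zero : ∀ n : ℕ, 2 ≤ n → M n 0 = 0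
  right_zero : ∀ n : ℕ, 2 ≤ n → M 0 n = 0
  /-- `β_{1k} (M_{ij} ⊗ id) = (id ⊗ M_{ij}) β_{i+j,k}` -/
  yang_baxter_left : ∀ i j k : ℕ, 1 ≤ i → 1 ≤ j → 1 ≤ k →
    betaAt σ 1 k ∘ₗ ((toPowOne K V).toLinearMap ∘ₗ M i j).rTensor (⨂[K]^k V) =
      ((toPowOne K V).toLinearMap ∘ₗ M i j ∘ₗ
          TensorPower.mulEquiv.symm.toLinearMap).lTensor (⨂[K]^k V) ∘ₗ
        betaAt σ (i + j) k ∘ₗ TensorPower.mulEquiv.toLinearMap.rTensor (⨂[K]^k V)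
  /-- `β_{i1} (id ⊗ M_{jk}) = (M_{jk} ⊗ id) β_{i,j+k}` -/
  yang_baxter_right : ∀ i j k : ℕ, 1 ≤ i → 1 ≤ j → 1 ≤ k →
    betaAt σ i 1 ∘ₗ ((toPowOne K V).toLinearMap ∘ₗ M j k).lTensor (⨂[K]^i V) =
      ((toPowOne K V).toLinearMap ∘ₗ M j k ∘ₗ
          TensorPower.mulEquiv.symm.toLinearMap).rTensor (⨂[K]^i V) ∘ₗ
        betaAt σ i (j + k) ∘ₗ TensorPower.mulEquiv.toLinearMap.lTensor (⨂[K]^i V)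
  /-- The associativity condition; the summation index is shifted by one. -/
  associativity : ∀ i j k : ℕ, 1 ≤ i → 1 ≤ j → 1 ≤ k →
    ∑ r ∈ Finset.range (i + j), M (r + 1) k ∘ₗ (starPowAt σ M r i j).rTensor (⨂[K]^k V) =
      ∑ l ∈ Finset.range (j + k), M i (l + 1) ∘ₗ (starPowAt σ M l j k).lTensor (⨂[K]^i V) ∘ₗ
        (TensorProduct.assoc K (⨂[K]^i V) (⨂[K]^j V) (⨂[K]^k V)).toLinearMap

end TensorSpace

end QBInf

end

/-!
The product `∗` is the solution `s` of the fixed point equation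
`s = ε ⊗ ε + (concatenation) ∘ (s ⊗ M) ∘ Δ_β` (`MulRel.s_eq_of_iterate`): in the iterates
`M^{⊗n} ∘ \bar Δ_β^{(n-1)}` the reduced coproduct may be replaced by `Δ_β` because `M` kills
`1 ⊗ 1`, and the `n`-th iterate vanishes in total degree less than `n`. Since `M` kills degree zero
and `Δ_β` is graded, a linear equation `Z = y ∘ (Z ⊗ F) ∘ Γ` of this shape has only the solution
zero (`fixed_point_eq_zero`). Every assertion about `∗` is therefore proved by checking that both
sides solve the same equation:

* `∗` is a coalgebra map (`StarRel.d_s`), as `Δ_β` is coassociative, and it is the only one over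
  `M` (`StarRel.eq_of_coalg`), as a coalgebra map over `M` solves the same equation;
* `β` is natural with respect to `∗` (`StarRel.b_s`, `StarRel.b_ws`), as it is natural with respect
  to `M` and to `Δ_β`;
* `∗` is associative (`StarRel.s_s`), as `M ∘ (∗ ⊗ id) = M ∘ (id ⊗ ∗)` (`StarRel.m_s_s`), which is
  the associativity condition on `M`.

That `β` is a braiding of `T(V)` which is natural with respect to concatenation, deconcatenation and
counit (`BraidRel.b_c`, `BraidRel.d_b`, `BraidRel.yang_baxter_eq`) is shown by induction on the
strands, one letter at a time. The base cases (`braidRel`) are read off the words of the permutations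
`χ_{ij}` after multiplying everything out in the tensor algebra.

All these are identities between maps among the tensor powers of `T = T(V)`, and the associativity
isomorphisms are dealt with once and for all: there is a vector space `W ≠ 0` with `W ⊗ T ≃ W`
(`exists_strand`), so `W` also absorbs every tensor power of `T`, and `f : T^{⊗a} → T^{⊗b}` acts on
the last strands of `W` by an endomorphism `op W f`. The assignment `op` is injective and compatible
with composition, associators become the identity (`op_assoc`), `id ⊗ f` has the same image as `f`
(`op_lTensor`), and `f ⊗ id` is obtained from it by a ring endomorphism `w` (`op_rTensor`). Identities
of string diagrams become identities of words in a ring with an endomorphism `w`, in which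
operations on disjoint strands can be interchanged (`far`). There they are proved.
-/

noncomputable section

namespace QBInf

/-! ### Absorbing strands -/

section Strands

/-- An absorption of the module `A` into the module `W`: an isomorphism `W ⊗ A ≃ W`. -/
class Strand (K W A : Type*) [Field K] [AddCommGroup W] [Module K W] [AddCommMonoid A]
    [Module K A] where
  /-- The isomorphism `W ⊗ A ≃ W`. -/
  absorb : W ⊗[K] A ≃ₗ[K] W

open Strand TensorProduct

variable {K W A B C D : Type*} [Field K] [AddCommGroup W] [Module K W]
  [AddCommMonoid A] [Module K A] [AddCommMonoid B] [Module K B]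
  [AddCommMonoid C] [Module K C] [AddCommMonoid D] [Module K D]

instance : Strand K W K := ⟨TensorProduct.rid K W⟩

instance [Strand K W A] [Strand K W B] : Strand K W (A ⊗[K] B) :=
  ⟨(TensorProduct.assoc K W A B).symm ≪≫ₗ (absorb (K := K) (W := W) (A := A)).rTensor B ≪≫ₗ absorb⟩

variable (W) in
/-- The endomorphism of `W` by which `f : A → B` acts on the last strands. -/
def op [Strand K W A] [Strand K W B] (f : A →ₗ[K] B) : Module.End K W :=
  absorb.toLinearMap ∘ₗ f.lTensor W ∘ₗ absorb.symm.toLinearMap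

variable (K W A) in
/-- The endomorphism `x ⊗ id_A` of `W ≃ W ⊗ A`, as a ring endomorphism in `x`. -/
def wh [Strand K W A] : Module.End K W →+* Module.End K W where
  toFun x := absorb.toLinearMap ∘ₗ x.rTensor A ∘ₗ absorb.symm.toLinearMap
  map_one' := by ext x; simp [Module.End.one_eq_id]
  map_mul' x y := by ext t; simp [Module.End.mul_eq_comp, LinearMap.rTensor_comp]
  map_zero' := by ext t; simp
  map_add' x y := by ext t; simp [LinearMap.rTensor_add]

variable [Strand K W A] [Strand K W B] [Strand K W C] [Strand K W D]

theorem op_apply (f : A →ₗ[K] B) (x : W ⊗[K] A) : op W f (absorb x) = absorb (f.lTensor W x) := by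
  simp [op]

theorem wh_apply (x : Module.End K W) (y : W ⊗[K] A) :
    wh K W A x (absorb y) = absorb (x.rTensor A y) := by
  simp [wh]

theorem absorb_tmul (x : W) (a : A) (b : B) :
    absorb (K := K) (W := W) (A := A ⊗[K] B) (x ⊗ₜ (a ⊗ₜ b)) =
      absorb (K := K) (absorb (K := K) (x ⊗ₜ[K] a) ⊗ₜ b) := by
  simp [absorb]

theorem end_ext {x y : Module.End K W}
    (h : ∀ (t : W) (a : A), x (absorb (K := K) (t ⊗ₜ a)) = y (absorb (K := K) (t ⊗ₜ a))) :
    x = y := by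
  have : x ∘ₗ (absorb (K := K) (W := W) (A := A)).toLinearMap = y ∘ₗ absorb.toLinearMap :=
    TensorProduct.ext' h
  ext t
  simpa using LinearMap.congr_fun this (absorb.symm t)

theorem op_comp (g : B →ₗ[K] C) (f : A →ₗ[K] B) : op W (g ∘ₗ f) = op W g * op W f := by
  ext t; simp [op, LinearMap.lTensor_comp]

theorem op_id : op W (LinearMap.id : A →ₗ[K] A) = 1 := by
  ext t; simp [op]

theorem op_add (f g : A →ₗ[K] B) : op W (f + g) = op W f + op W g := by
  ext t; simp [op, LinearMap.lTensor_add]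

theorem op_zero : op W (0 : A →ₗ[K] B) = 0 := by
  ext t; simp [op]

theorem op_sum {ι : Type*} (s : Finset ι) (f : ι → A →ₗ[K] B) :
    op W (∑ i ∈ s, f i) = ∑ i ∈ s, op W (f i) := by
  classical
  induction s using Finset.induction_on with
  | empty => simp [op_zero]
  | insert a s ha ih => simp [Finset.sum_insert ha, op_add, ih]

/-- Strands to the left of `f` do not matter, as they are absorbed into `W`. -/
theorem op_lTensor (f : A →ₗ[K] B) : op W (f.lTensor C) = op W f := by
  refine end_ext (A := C ⊗[K] A) fun t a => ?_
  induction a using TensorProduct.induction_on with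
  | zero => simp
  | add x y hx hy => simp only [tmul_add, map_add, hx, hy]
  | tmul c a => rw [op_apply]; simp [op_apply, absorb_tmul]

theorem op_rTensor (f : A →ₗ[K] B) : op W (f.rTensor C) = wh K W C (op W f) := by
  refine end_ext (A := A ⊗[K] C) fun t a => ?_
  induction a using TensorProduct.induction_on with
  | zero => simp
  | add x y hx hy => simp only [tmul_add, map_add, hx, hy]
  | tmul c a => rw [op_apply]; simp [op_apply, absorb_tmul, wh_apply]

/-- Operations on disjoint strands can be interchanged. -/
theorem op_mul_wh (g : A →ₗ[K] B) (x : Module.End K W) :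
    op W g * wh K W A x = wh K W B x * op W g := by
  refine end_ext (A := A) fun t a => ?_
  simp [op_apply, wh_apply]

theorem op_map (f : A →ₗ[K] B) (g : C →ₗ[K] D) :
    op W (TensorProduct.map f g) = op W g * wh K W C (op W f) := by
  rw [← op_rTensor, ← op_lTensor (C := B) g, ← op_comp, LinearMap.lTensor_comp_rTensor]

theorem wh_unit (x : Module.End K W) : wh K W K x = x := by
  refine end_ext (A := K) fun t a => ?_
  rw [wh_apply]
  simp [absorb]

theorem wh_tensor (x : Module.End K W) :
    wh K W (A ⊗[K] B) x = wh K W B (wh K W A x) := by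
  refine end_ext (A := A ⊗[K] B) fun t a => ?_
  induction a using TensorProduct.induction_on with
  | zero => simp
  | add x y hx hy => simp only [tmul_add, map_add, hx, hy]
  | tmul c a => rw [wh_apply]; simp [absorb_tmul, wh_apply]

theorem op_assoc : op W (TensorProduct.assoc K A B C).toLinearMap = 1 := by
  refine end_ext (A := (A ⊗[K] B) ⊗[K] C) fun t a => ?_
  have : absorb.toLinearMap ∘ₗ TensorProduct.mk K W _ t ∘ₗ
      (TensorProduct.assoc K A B C).toLinearMap = absorb.toLinearMap ∘ₗ TensorProduct.mk K W _ t := by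
    ext a b c; simp [absorb_tmul]
  simpa [op_apply] using LinearMap.congr_fun this a

theorem op_assoc_symm : op W (TensorProduct.assoc K A B C).symm.toLinearMap = 1 := by
  have h := op_comp (W := W) (TensorProduct.assoc K A B C).toLinearMap
    (TensorProduct.assoc K A B C).symm.toLinearMap
  rw [op_assoc, one_mul, LinearEquiv.comp_coe, LinearEquiv.symm_trans_self,
    LinearEquiv.refl_toLinearMap, op_id] at h
  exact h.symm

theorem op_rid_symm : op W (TensorProduct.rid K A).symm.toLinearMap = 1 := by
  refine end_ext (A := A) fun t a => ?_
  simp [op_apply, absorb_tmul]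
  simp [absorb]

theorem op_lid_symm : op W (TensorProduct.lid K A).symm.toLinearMap = 1 := by
  refine end_ext (A := A) fun t a => ?_
  simp [op_apply, absorb_tmul]
  simp [absorb]

theorem op_rid : op W (TensorProduct.rid K A).toLinearMap = 1 := by
  have h := op_comp (W := W) (TensorProduct.rid K A).toLinearMap
    (TensorProduct.rid K A).symm.toLinearMap
  rw [op_rid_symm, mul_one, LinearEquiv.comp_coe, LinearEquiv.symm_trans_self,
    LinearEquiv.refl_toLinearMap, op_id] at h
  exact h.symm

theorem op_injective [Nontrivial W] : Function.Injective (op W : (A →ₗ[K] B) → Module.End K W) := by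
  intro f g h
  obtain ⟨t, ht⟩ := exists_ne (0 : W)
  ext a
  have h1 := LinearMap.congr_fun h (absorb (K := K) (t ⊗ₜ a))
  rw [op_apply, op_apply, absorb.injective.eq_iff, LinearMap.lTensor_tmul,
    LinearMap.lTensor_tmul] at h1
  -- Evaluating a functional with `φ t ≠ 0` on the first factor recovers `f a` from `t ⊗ f a`.
  obtain ⟨φ, hφ⟩ : ∃ φ : Module.Dual K W, φ t ≠ 0 := by
    by_contra! hφ
    exact ht ((Module.forall_dual_apply_eq_zero_iff K t).1 hφ)
  have h2 := congrArg (TensorProduct.lid K B ∘ φ.rTensor B) h1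
  simp only [Function.comp_apply, LinearMap.rTensor_tmul, TensorProduct.lid_tmul] at h2
  simpa only [smul_smul, inv_mul_cancel₀ hφ, one_smul] using congrArg ((φ t)⁻¹ • ·) h2

end Strands

/-- Every nonzero vector space is absorbed by a nonzero vector space: if `I` is a basis of `A`, take a
space with basis the sequences in `I`. -/
theorem exists_strand (K A : Type*) [Field K] [AddCommGroup A] [Module K A] [Nontrivial A] :
    ∃ (I : Set A) (_ : Nontrivial ((ℕ → I) →₀ K)), Nonempty (Strand K ((ℕ → I) →₀ K) A) := by
  let v := Module.Basis.ofVectorSpace K A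
  have : Nonempty (Module.Basis.ofVectorSpaceIndex K A) := v.index_nonempty
  refine ⟨Module.Basis.ofVectorSpaceIndex K A, inferInstance, ⟨⟨?_⟩⟩⟩
  refine TensorProduct.congr (LinearEquiv.refl K _) v.repr ≪≫ₗ
    finsuppTensorFinsupp' K _ _ ≪≫ₗ Finsupp.domLCongr ?_
  exact (Equiv.prodComm _ _).trans
    { toFun := fun f n => Nat.casesOn n f.1 f.2
      invFun := fun g => (g 0, fun n => g (n + 1))
      left_inv := fun f => rfl
      right_inv := fun g => by funext n; cases n <;> rfl }

/-! ### Words in the operations -/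

section Words

variable {R : Type*} [Ring R] {w : R →+* R}

/-- `sh w k y` is the operation `y` performed with `k` further strands to its right; `w` inserts
one strand. -/
def sh (w : R →+* R) (k : ℕ) : R →+* R := w ^ k

/-- `x` behaves like an operation with `a` inputs and `b` outputs on the last strands: it can be
interchanged with everything that happens on the earlier strands. The number `r` plays no role in
the definition; it ranks the letters `x` for the rewriting of words: units `0`, products `1`,
braidings and other letters with as many inputs as outputs `2`, coproducts `3`, counits `4`. -/
class Letter (w : R →+* R) (x : R) (a b r : outParam ℕ) : Prop where
  cross : ∀ y, x * sh w a y = sh w b y * x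

theorem sh_sh (k j : ℕ) (x : R) : sh w k (sh w j x) = sh w (k + j) x := by
  rw [sh, sh, sh, pow_add]; rfl

theorem far {x : R} {a b r : ℕ} [Letter w x a b r] {i j : ℕ} (h : i + a ≤ j) (y : R) :
    sh w i x * sh w j y = sh w (j - a + b) y * sh w i x := by
  obtain ⟨t, rfl⟩ := Nat.exists_eq_add_of_le h
  rw [show i + a + t - a + b = i + (b + t) by omega, Nat.add_assoc, ← sh_sh i, ← sh_sh i,
    ← sh_sh a, ← sh_sh b, ← map_mul, Letter.cross, map_mul]

/-- Disjoint letters are interchanged so that the left one has the smaller rank, and the deeper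
position if the ranks are equal. This is the case of the right letter being deeper. -/
theorem swap {x y : R} {a b r a' b' r' : ℕ} [Letter w x a b r] [Letter w y a' b' r'] {i j : ℕ}
    (h : i + a ≤ j) (_ : r' ≤ r) : sh w i x * sh w j y = sh w (j - a + b) y * sh w i x :=
  far h y

theorem swap_mul {x y : R} {a b r a' b' r' : ℕ} [Letter w x a b r] [Letter w y a' b' r'] {i j : ℕ}
    (h : i + a ≤ j) (_ : r' ≤ r) (z : R) :
    sh w i x * (sh w j y * z) = sh w (j - a + b) y * (sh w i x * z) := by
  rw [← mul_assoc, far h, mul_assoc]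

/-- As `swap`, but with the left letter being deeper. -/
theorem swap' {x y : R} {a b r a' b' r' : ℕ} [Letter w x a b r] [Letter w y a' b' r'] {i j : ℕ}
    (h : j + b' ≤ i) (_ : r' < r) : sh w i x * sh w j y = sh w j y * sh w (i - b' + a') x := by
  have := far (w := w) (x := y) (i := j) (j := i - b' + a') (by omega) x
  rw [this, show i - b' + a' - a' + b' = i by omega]

theorem swap_mul' {x y : R} {a b r a' b' r' : ℕ} [Letter w x a b r] [Letter w y a' b' r'] {i j : ℕ}
    (h : j + b' ≤ i) (hr : r' < r) (z : R) :
    sh w i x * (sh w j y * z) = sh w j y * (sh w (i - b' + a') x * z) := by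
  rw [← mul_assoc, swap' h hr, mul_assoc]

theorem reassoc {x y z : R} (h : x * y = z) (t : R) : x * (y * t) = z * t := by
  rw [← mul_assoc, h]

theorem reassoc₃ {x y y' z : R} (h : x * (y * y') = z) (t : R) : x * (y * (y' * t)) = z * t := by
  rw [← h]; simp only [mul_assoc]

theorem reassoc₄ {x y y' y'' z : R} (h : x * (y * (y' * y'')) = z) (t : R) :
    x * (y * (y' * (y'' * t))) = z * t := by
  rw [← h]; simp only [mul_assoc]

/-- The relations between the operations of a tensor coalgebra with concatenation product: unit `u`,
product `c`, counit `e`, deconcatenation `d`, and projections `q n` onto the degrees. In the names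
of such relations the letters stand in the order of composition, and a `w` marks the letter which is
performed with a further strand to its right. -/
structure TensorRel (w : R →+* R) (u c e d : R) (q : ℕ → R) : Prop where
  /-- The degrees of each strand span. -/
  faithful : ∀ (k : ℕ) (X : R), (∀ n, X * sh w k (q n) = 0) → X = 0
  c_c : sh w 0 c * sh w 0 c = sh w 0 c * sh w 1 c
  c_u : sh w 0 c * sh w 0 u = 1
  c_wu : sh w 0 c * sh w 1 u = 1
  e_u : sh w 0 e * sh w 0 u = 1
  q_zero : q 0 = sh w 0 u * sh w 0 e
  q_mul_self : ∀ i, sh w 0 (q i) * sh w 0 (q i) = sh w 0 (q i)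
  q_mul_ne : ∀ i j, i ≠ j → sh w 0 (q i) * sh w 0 (q j) = 0
  d_u : sh w 0 d * sh w 0 u = sh w 0 u * sh w 0 u
  d_q : ∀ n, sh w 0 d * sh w 0 (q n) = ∑ t ∈ Finset.HasAntidiagonal.antidiagonal n,
    sh w 1 (q t.1) * (sh w 0 (q t.2) * sh w 0 d)
  c_qq_d : ∀ i j, sh w 0 c * (sh w 1 (q i) * (sh w 0 (q j) * sh w 0 d)) = sh w 0 (q (i + j))
  qq_d_c_qq : ∀ i j, sh w 1 (q i) * (sh w 0 (q j) * (sh w 0 d * (sh w 0 c * (sh w 1 (q i) *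
    sh w 0 (q j))))) = sh w 1 (q i) * sh w 0 (q j)

variable {u c e d b m s : R} {q : ℕ → R} [Letter w u 0 1 0] [Letter w c 2 1 1] [Letter w e 1 0 4]
  [Letter w d 1 2 3] [∀ n, Letter w (q n) 1 1 2] [Letter w b 2 2 2] [Letter w m 2 1 1]
  [Letter w s 2 1 1]

theorem Letter.mul {x y : R} {i j k r r' r'' : ℕ} (hx : Letter w x j k r) (hy : Letter w y i j r') :
    Letter w (x * y) i k r'' :=
  ⟨fun z => by rw [mul_assoc, hy.cross, ← mul_assoc, hx.cross, mul_assoc]⟩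

/-- The product of an element with an element of degree one. -/
def snocOp (c : R) (q : ℕ → R) : R := c * q 1

omit [Letter w c 2 1 1] [∀ n, Letter w (q n) 1 1 2] in
theorem snocOp_def : sh w 0 (snocOp c q) = sh w 0 c * sh w 0 (q 1) := rfl

instance : Letter w (snocOp c q) 2 1 1 :=
  Letter.mul (j := 2) (r := 1) (r' := 2) inferInstance
    ⟨fun y => far (w := w) (x := q 1) (i := 0) (j := 2) (by norm_num) y⟩

set_option linter.unusedSectionVars false
set_option linter.unusedSimpArgs false

namespace TensorRel

variable (H : TensorRel w u c e d q)
include H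

theorem faithful' (k : ℕ) {X Y : R} (h : ∀ n, X * sh w k (q n) = Y * sh w k (q n)) : X = Y :=
  sub_eq_zero.1 (H.faithful k _ fun n => by rw [sub_mul, h, sub_self])

theorem q_mul_self' (i k : ℕ) : sh w k (q i) * sh w k (q i) = sh w k (q i) := by
  simpa only [map_mul, sh_sh, Nat.add_zero] using congrArg (sh w k) (H.q_mul_self i)

theorem q_c (i j : ℕ) : sh w 0 (q (i + j)) * (sh w 0 c * (sh w 1 (q i) * sh w 0 (q j))) =
    sh w 0 c * (sh w 1 (q i) * sh w 0 (q j)) := by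
  rw [← H.c_qq_d]
  simp only [mul_assoc]
  rw [H.qq_d_c_qq]

/-- Appending a letter raises the degree by one. -/
theorem q_snocOp (n : ℕ) : sh w 0 (q (n + 1)) * (sh w 0 (snocOp c q) * sh w 1 (q n)) =
    sh w 0 (snocOp c q) * sh w 1 (q n) := by
  have h : sh w 0 (snocOp c q) * sh w 1 (q n) = sh w 0 c * (sh w 1 (q n) * sh w 0 (q 1)) := by
    rw [snocOp_def, mul_assoc, far (by norm_num)]
  rw [h, H.q_c]

theorem snocOp_q_d (n : ℕ) :
    sh w 0 (snocOp c q) * (sh w 1 (q n) * sh w 0 d) = sh w 0 (q (n + 1)) := by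
  rw [snocOp_def, ← H.c_qq_d]
  simp (disch := norm_num) only [mul_assoc, swap, swap_mul, swap', swap_mul', Nat.reduceAdd,
    Nat.reduceSub]

/-- Induction on the strand at depth `k`: by linearity, its content is the unit or of the form
`x * v` with `v` of degree one. -/
theorem strand_induction (k : ℕ) {X Y : R} (h0 : X * sh w k u = Y * sh w k u)
    (hs : ∀ r, Letter w r 1 1 2 → X * sh w k r = Y * sh w k r →
      X * (sh w k (snocOp c q) * sh w (k + 1) r) = Y * (sh w k (snocOp c q) * sh w (k + 1) r)) :
    X = Y := by
  refine H.faithful' k fun n => ?_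
  induction n with
  | zero =>
    have h1 : sh w k (q 0) = sh w k u * sh w k e := by
      rw [H.q_zero]; exact map_mul (sh w k) _ _
    rw [h1, ← mul_assoc, h0, mul_assoc]
  | succ n ih =>
    have h1 : sh w k (snocOp c q) * sh w (k + 1) (q n) * sh w k d = sh w k (q (n + 1)) := by
      simpa only [map_mul, sh_sh, Nat.add_zero, mul_assoc] using
        congrArg (sh w k) (H.snocOp_q_d n)
    rw [← h1, ← mul_assoc, hs _ inferInstance ih, mul_assoc]

theorem q_one_u : sh w 0 (q 1) * sh w 0 u = 0 := by
  calc _ = sh w 0 (q 1) * (sh w 0 (q 0) * sh w 0 u) := by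
        rw [H.q_zero]; change _ = _ * (sh w 0 u * sh w 0 e * _); rw [mul_assoc, H.e_u, mul_one]
    _ = 0 := by rw [← mul_assoc, H.q_mul_ne 1 0 one_ne_zero, zero_mul]

theorem e_q {n : ℕ} (hn : n ≠ 0) : sh w 0 e * sh w 0 (q n) = 0 := by
  calc _ = sh w 0 e * (sh w 0 (q 0) * sh w 0 (q n)) := by
        rw [H.q_zero]; change _ = _ * (sh w 0 u * sh w 0 e * _)
        rw [← mul_assoc, ← mul_assoc, H.e_u, one_mul]
    _ = 0 := by rw [H.q_mul_ne 0 n hn.symm, mul_zero]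

theorem e_q_zero : sh w 0 e * sh w 0 (q 0) = sh w 0 e := by
  rw [H.q_zero]; change _ * (sh w 0 u * sh w 0 e) = _
  rw [← mul_assoc, H.e_u, one_mul]

theorem e_d : sh w 0 e * sh w 0 d = 1 := by
  refine H.faithful' 0 fun n => ?_
  rw [mul_assoc, H.d_q, Finset.mul_sum, one_mul, Finset.sum_eq_single (n, 0)]
  · have h1 := H.c_qq_d n 0
    have h2 : sh w 0 (q 0) = sh w 0 u * sh w 0 e := H.q_zero
    simp (disch := norm_num) only [h2, reassoc H.c_u, one_mul, Nat.add_zero, mul_assoc, swap,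
      swap_mul, swap', swap_mul', Nat.reduceAdd, Nat.reduceSub] at h1
    simp (disch := norm_num) only [mul_assoc, swap, swap_mul, swap', swap_mul', Nat.reduceAdd,
      Nat.reduceSub]
    rw [reassoc H.e_q_zero]
    exact h1
  · rintro ⟨i, j⟩ hij hne
    have hj : j ≠ 0 := by
      rintro rfl
      simp at hij hne; exact hne hij
    simp (disch := norm_num) only [mul_assoc, swap, swap_mul, swap', swap_mul', Nat.reduceAdd,
      Nat.reduceSub]
    rw [reassoc (H.e_q hj), zero_mul, mul_zero]
  · simp

theorem we_d : sh w 1 e * sh w 0 d = 1 := by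
  have hk : ∀ n, sh w 1 e * sh w 1 (q n) = sh w 1 (sh w 0 e * sh w 0 (q n)) := fun n =>
    (map_mul (sh w 1) _ _).symm
  refine H.faithful' 0 fun n => ?_
  rw [mul_assoc, H.d_q, Finset.mul_sum, one_mul, Finset.sum_eq_single (0, n)]
  · have h1 := H.c_qq_d 0 n
    have h2 : sh w 1 (q 0) = sh w 1 u * sh w 1 e := by rw [H.q_zero]; exact map_mul (sh w 1) _ _
    rw [h2, mul_assoc, reassoc H.c_wu, one_mul] at h1
    rw [reassoc (hk 0), H.e_q_zero, sh_sh]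
    simpa only [Nat.zero_add, Nat.add_zero] using h1
  · rintro ⟨i, j⟩ hij hne
    have hj : i ≠ 0 := by
      rintro rfl
      simp at hij hne; exact hne hij
    rw [reassoc (hk i), H.e_q hj, map_zero, zero_mul]
  · simp

theorem c_snocOp : sh w 0 c * sh w 0 (snocOp c q) = sh w 0 (snocOp c q) * sh w 1 c := by
  rw [snocOp_def]
  simp (disch := norm_num) only [reassoc H.c_c, mul_assoc, swap, swap_mul, swap', swap_mul',
    Nat.reduceAdd, Nat.reduceSub]

/-- The recursion for the deconcatenation: `δ(x v) = δ(x) v + x v ⊗ 1` for a letter `v`. In the order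
of strands used here the summand `x v ⊗ 1` inserts a unit on the last strand. -/
theorem d_snocOp : sh w 0 d * sh w 0 (snocOp c q) =
    sh w 0 (snocOp c q) * sh w 1 d + sh w 0 u * sh w 0 (snocOp c q) := by
  refine H.faithful' 1 fun n => ?_
  have hdq : sh w 1 d * sh w 1 (q n) = ∑ t ∈ Finset.HasAntidiagonal.antidiagonal n,
      sh w 2 (q t.1) * (sh w 1 (q t.2) * sh w 1 d) := by
    simpa only [map_mul, sh_sh, map_sum, Nat.reduceAdd, Nat.add_zero]
      using congrArg (sh w 1) (H.d_q n)
  rw [mul_assoc, ← H.q_snocOp, reassoc (H.d_q _), Finset.sum_mul,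
    Finset.Nat.sum_antidiagonal_succ', add_comm, add_mul, mul_assoc (sh w 0 (snocOp c q)), hdq,
    Finset.mul_sum]
  congr 1
  · refine Finset.sum_congr rfl fun t ht => ?_
    obtain ⟨i, j⟩ := t
    have hij : i + j = n := by simpa using ht
    have h1 : sh w 1 (q i) * (sh w 0 (q (j + 1)) * (sh w 0 (snocOp c q) * (sh w 1 (q j) * sh w 1 d))) =
        sh w 0 (snocOp c q) * (sh w 2 (q i) * (sh w 1 (q j) * sh w 1 d)) := by
      rw [← mul_assoc (sh w 0 (snocOp c q)), reassoc (H.q_snocOp j)]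
      simp (disch := norm_num) only [mul_assoc, swap, swap_mul, swap', swap_mul', Nat.reduceAdd,
        Nat.reduceSub]
    have h2 : sh w 0 c * (sh w 0 (snocOp c q) * (sh w 2 (q i) * (sh w 1 (q j) * sh w 1 d))) =
        sh w 0 (snocOp c q) * sh w 1 (q n) := by
      rw [reassoc H.c_snocOp, mul_assoc, ← hij]
      congr 1
      simpa only [map_mul, sh_sh, Nat.reduceAdd, Nat.add_zero]
        using congrArg (sh w 1) (H.c_qq_d i j)
    dsimp only
    rw [mul_assoc, mul_assoc, ← h2, ← h1]
    simpa only [mul_assoc] using congrArg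
      (· * (sh w 0 (snocOp c q) * (sh w 1 (q j) * sh w 1 d))) (H.qq_d_c_qq i (j + 1))
  · dsimp only
    have h2 : sh w 0 (q 0) = sh w 0 u * sh w 0 e := H.q_zero
    rw [h2]
    simp only [mul_assoc]
    rw [swap_mul' (by norm_num) (by norm_num), reassoc H.e_d, one_mul, H.q_snocOp]

theorem d_snocOp' (k : ℕ) : sh w k d * sh w k (snocOp c q) =
    sh w k (snocOp c q) * sh w (k + 1) d + sh w k u * sh w k (snocOp c q) := by
  simpa only [map_mul, map_add, sh_sh, Nat.add_zero] using congrArg (sh w k) H.d_snocOp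

theorem d_u' (k : ℕ) : sh w k d * sh w k u = sh w k u * sh w k u := by
  simpa only [map_mul, sh_sh, Nat.add_zero] using congrArg (sh w k) H.d_u

theorem d_d : sh w 0 d * sh w 0 d = sh w 1 d * sh w 0 d := by
  refine H.strand_induction 0 ?_ fun r hr ih => ?_
  · simp (disch := norm_num) only [H.d_u', reassoc (H.d_u' _), mul_assoc, swap, swap_mul, swap',
      swap_mul', Nat.reduceAdd, Nat.reduceSub]
  · have ih' : sh w 1 d * (sh w 1 d * sh w 1 r) = sh w 2 d * (sh w 1 d * sh w 1 r) := by
      simpa only [map_mul, sh_sh, Nat.reduceAdd, Nat.add_zero, mul_assoc]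
        using congrArg (sh w 1) ih
    simp (disch := norm_num) only [mul_add, add_mul, reassoc (H.d_snocOp' _), ih',
      reassoc (H.d_u' _), add_assoc, mul_assoc, swap, swap_mul, swap', swap_mul', Nat.reduceAdd,
      Nat.reduceSub]

end TensorRel

/-! ### Braidings of a tensor coalgebra -/

namespace TensorRel

variable (H : TensorRel w u c e d q)
include H

theorem c_u' (k : ℕ) : sh w k c * sh w k u = 1 := by
  simpa only [map_mul, map_one, sh_sh, Nat.add_zero] using congrArg (sh w k) H.c_u

theorem c_wu' (k : ℕ) : sh w k c * sh w (k + 1) u = 1 := by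
  simpa only [map_mul, map_one, sh_sh, Nat.add_zero] using congrArg (sh w k) H.c_wu

theorem e_u' (k : ℕ) : sh w k e * sh w k u = 1 := by
  simpa only [map_mul, map_one, sh_sh, Nat.add_zero] using congrArg (sh w k) H.e_u

theorem snocOp_mul (k : ℕ) (z : R) :
    sh w k (snocOp c q) * z = sh w k (snocOp c q) * (sh w k (q 1) * z) := by
  rw [snocOp, map_mul, mul_assoc, mul_assoc, reassoc (H.q_mul_self' 1 k)]

theorem c_snocOp' (k : ℕ) :
    sh w k c * sh w k (snocOp c q) = sh w k (snocOp c q) * sh w (k + 1) c := by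
  simpa only [map_mul, sh_sh, Nat.add_zero] using congrArg (sh w k) H.c_snocOp

end TensorRel

/-- The relations between a braiding `b` of a tensor coalgebra and its other operations. Naturality
with respect to concatenation and the Yang-Baxter equation are only required for letters, i.e. as far
as they can be read off the words which define the braiding. -/
structure BraidRel (w : R →+* R) (u c b : R) (q : ℕ → R) : Prop where
  b_wq : ∀ n, sh w 0 b * sh w 1 (q n) = sh w 0 (q n) * sh w 0 b
  b_q : ∀ n, sh w 0 b * sh w 0 (q n) = sh w 1 (q n) * sh w 0 b
  b_u : sh w 0 b * sh w 0 u = sh w 1 u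
  b_wu : sh w 0 b * sh w 1 u = sh w 0 u
  b_snocOp : sh w 0 b * sh w 0 (snocOp c q) = sh w 1 (snocOp c q) * (sh w 0 b * sh w 1 b)
  b_wsnocOp : sh w 1 (q 1) * (sh w 0 b * sh w 1 (snocOp c q)) =
    sh w 1 (q 1) * (sh w 0 (snocOp c q) * (sh w 1 b * sh w 0 b))
  yang_baxter : sh w 2 (q 1) * (sh w 1 (q 1) * (sh w 0 (q 1) * (sh w 0 b * (sh w 1 b * sh w 0 b)))) =
    sh w 2 (q 1) * (sh w 1 (q 1) * (sh w 0 (q 1) * (sh w 1 b * (sh w 0 b * sh w 1 b))))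

namespace BraidRel

variable (H : TensorRel w u c e d q) (B : BraidRel w u c b q)
include B

theorem b_wq' (n k : ℕ) : sh w k b * sh w (k + 1) (q n) = sh w k (q n) * sh w k b := by
  simpa only [map_mul, sh_sh, Nat.add_zero] using congrArg (sh w k) (B.b_wq n)

theorem b_q' (n k : ℕ) : sh w k b * sh w k (q n) = sh w (k + 1) (q n) * sh w k b := by
  simpa only [map_mul, sh_sh, Nat.add_zero] using congrArg (sh w k) (B.b_q n)

theorem q_b_mul (n k : ℕ) (z : R) :
    sh w (k + 1) (q n) * (sh w k b * z) = sh w k b * (sh w k (q n) * z) := by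
  rw [reassoc (B.b_q' n k), mul_assoc]

theorem b_u' (k : ℕ) : sh w k b * sh w k u = sh w (k + 1) u := by
  simpa only [map_mul, sh_sh, Nat.add_zero] using congrArg (sh w k) B.b_u

theorem b_wu' (k : ℕ) : sh w k b * sh w (k + 1) u = sh w k u := by
  simpa only [map_mul, sh_sh, Nat.add_zero] using congrArg (sh w k) B.b_wu

theorem b_snocOp' (k : ℕ) : sh w k b * sh w k (snocOp c q) =
    sh w (k + 1) (snocOp c q) * (sh w k b * sh w (k + 1) b) := by
  simpa only [map_mul, sh_sh, Nat.add_zero] using congrArg (sh w k) B.b_snocOp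

include H

/-- The braiding is natural with respect to the product, by induction on the second factor. -/
theorem b_c : sh w 0 b * sh w 0 c = sh w 1 c * (sh w 0 b * sh w 1 b) := by
  refine H.strand_induction 0 ?_ fun r hr ih => ?_
  · simp (disch := norm_num) only [H.c_u', B.b_u', mul_one, reassoc (B.b_u' _), reassoc (H.c_u' _),
      one_mul, mul_assoc, swap, swap_mul, swap', swap_mul', Nat.reduceAdd, Nat.reduceSub]
  · have ih' : sh w 1 b * (sh w 1 c * sh w 1 r) = sh w 2 c * (sh w 1 b * (sh w 2 b * sh w 1 r)) := by
      simpa only [map_mul, sh_sh, Nat.reduceAdd, mul_assoc] using congrArg (sh w 1) ih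
    simp (disch := norm_num) only [reassoc (H.c_snocOp' _), reassoc (B.b_snocOp' _), ih', mul_assoc,
      swap, swap_mul, swap', swap_mul', Nat.reduceAdd, Nat.reduceSub]

theorem b_c' (k : ℕ) : sh w k b * sh w k c = sh w (k + 1) c * (sh w k b * sh w (k + 1) b) := by
  simpa only [map_mul, sh_sh, Nat.add_zero] using congrArg (sh w k) (B.b_c H)

/-- The naturality `b_wc` when the strand which moves past the product has degree one. -/
theorem q_one_b_wc : sh w 1 (q 1) * (sh w 0 b * sh w 1 c) =
    sh w 1 (q 1) * (sh w 0 c * (sh w 1 b * sh w 0 b)) := by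
  refine H.strand_induction 1 ?_ fun r hr ih => ?_
  · simp (disch := norm_num) only [H.c_u', B.b_u', mul_one, reassoc (B.b_u' _), reassoc (H.c_u' _),
      reassoc (B.b_wu' _), B.b_wu', H.c_wu', one_mul, mul_assoc, swap, swap_mul, swap', swap_mul',
      Nat.reduceAdd, Nat.reduceSub]
  · have ih' : sh w 2 (q 1) * (sh w 1 b * (sh w 2 c * sh w 2 r)) =
        sh w 2 (q 1) * (sh w 1 c * (sh w 2 b * (sh w 1 b * sh w 2 r))) := by
      simpa only [map_mul, sh_sh, Nat.reduceAdd, mul_assoc] using congrArg (sh w 1) ih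
    have hf : ∀ z, sh w 2 (q 1) * (sh w 1 b * (sh w 0 b * (sh w 1 (snocOp c q) * z))) =
        sh w 2 (q 1) * (sh w 1 b * (sh w 0 (snocOp c q) * (sh w 1 b * (sh w 0 b * z)))) := by
      intro z
      rw [B.q_b_mul 1 1, B.q_b_mul 1 1, reassoc₃ B.b_wsnocOp]
      simp only [mul_assoc]
    calc _ = sh w 0 (snocOp c q) *
          ((sh w 2 (q 1) * (sh w 1 b * (sh w 2 c * sh w 2 r))) * sh w 0 b) := by
          simp (disch := norm_num) only [reassoc (H.c_snocOp' _), reassoc₃ B.b_wsnocOp, mul_assoc,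
            swap, swap_mul, swap', swap_mul', Nat.reduceAdd, Nat.reduceSub]
      _ = _ := by
          rw [ih']
          simp (disch := norm_num) only [reassoc (H.c_snocOp' _), hf, mul_assoc, swap, swap_mul,
            swap', swap_mul', Nat.reduceAdd, Nat.reduceSub]

/-- The braiding is natural with respect to the product on its other side. The induction is on the
strand which moves past the product; it uses the case `q_one_b_wc` of a letter. -/
theorem b_wc : sh w 0 b * sh w 1 c = sh w 0 c * (sh w 1 b * sh w 0 b) := by
  refine H.strand_induction 0 ?_ fun r hr ih => ?_
  · simp (disch := norm_num) only [B.b_u', reassoc (B.b_u' _), mul_assoc, swap, swap_mul, swap',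
      swap_mul', Nat.reduceAdd, Nat.reduceSub]
  · have ih' : sh w 1 b * (sh w 2 c * sh w 1 r) = sh w 1 c * (sh w 2 b * (sh w 1 b * sh w 1 r)) := by
      simpa only [map_mul, sh_sh, Nat.reduceAdd, mul_assoc] using congrArg (sh w 1) ih
    have hf : ∀ z, sh w 1 (snocOp c q) * (sh w 0 b * (sh w 1 c * z)) =
        sh w 1 (snocOp c q) * (sh w 0 c * (sh w 1 b * (sh w 0 b * z))) := by
      intro z
      rw [H.snocOp_mul, reassoc₃ (B.q_one_b_wc H)]
      simp only [mul_assoc]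
      rw [← H.snocOp_mul]
    calc _ = sh w 0 b * (sh w 0 (snocOp c q) * (sh w 2 c * sh w 1 r)) := by
          simp (disch := norm_num) only [mul_assoc, swap, swap_mul, swap', swap_mul', Nat.reduceAdd,
            Nat.reduceSub]
      _ = sh w 1 (snocOp c q) * (sh w 0 b * (sh w 1 b * (sh w 2 c * sh w 1 r))) := by
          rw [reassoc (B.b_snocOp' 0)]; simp only [mul_assoc]
      _ = _ := by
          rw [ih', hf]
          simp (disch := norm_num) only [reassoc (B.b_snocOp' _), mul_assoc, swap, swap_mul, swap',
            swap_mul', Nat.reduceAdd, Nat.reduceSub]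

theorem b_wc' (k : ℕ) :
    sh w k b * sh w (k + 1) c = sh w k c * (sh w (k + 1) b * sh w k b) := by
  simpa only [map_mul, sh_sh, Nat.add_zero] using congrArg (sh w k) (B.b_wc H)

theorem b_wsnocOp' (k : ℕ) : sh w k b * sh w (k + 1) (snocOp c q) =
    sh w k (snocOp c q) * (sh w (k + 1) b * sh w k b) := by
  have h : sh w 0 b * sh w 1 (snocOp c q) =
      sh w 0 (snocOp c q) * (sh w 1 b * sh w 0 b) := by
    have h1 : sh w 1 (snocOp c q) = sh w 1 c * sh w 1 (q 1) := map_mul _ _ _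
    rw [h1, snocOp_def, reassoc (B.b_wc' H 0)]
    simp (disch := norm_num) only [B.b_q', B.b_wq', mul_assoc, swap, swap_mul, swap', swap_mul',
      Nat.reduceAdd, Nat.reduceSub]
  simpa only [map_mul, sh_sh, Nat.add_zero] using congrArg (sh w k) h

/-- The Yang-Baxter equation when two of the three strands have degree one. -/
theorem yang_baxter₁ : sh w 2 (q 1) * (sh w 1 (q 1) * (sh w 0 b * (sh w 1 b * sh w 0 b))) =
    sh w 2 (q 1) * (sh w 1 (q 1) * (sh w 1 b * (sh w 0 b * sh w 1 b))) := by
  refine H.strand_induction 2 ?_ fun r hr ih => ?_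
  · simp (disch := norm_num) only [reassoc (B.b_wu' _), reassoc (B.b_u' _), B.b_wu', B.b_u',
      mul_assoc, swap, swap_mul, swap', swap_mul', Nat.reduceAdd, Nat.reduceSub]
  · have ih' : sh w 3 (q 1) * (sh w 2 (q 1) * (sh w 1 b * (sh w 2 b * (sh w 1 b * sh w 3 r)))) =
        sh w 3 (q 1) * (sh w 2 (q 1) * (sh w 2 b * (sh w 1 b * (sh w 2 b * sh w 3 r)))) := by
      simpa only [map_mul, sh_sh, Nat.reduceAdd, mul_assoc] using congrArg (sh w 1) ih
    have hq : ∀ z, sh w 0 (snocOp c q) * (sh w 3 (q 1) * (sh w 2 (q 1) *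
        (sh w 1 b * (sh w 2 b * z)))) = sh w 0 (snocOp c q) * (sh w 1 b * (sh w 2 b *
        (sh w 2 (q 1) * (sh w 1 (q 1) * (sh w 0 (q 1) * z))))) := by
      intro z
      have h1 : ∀ z, sh w 3 (q 1) * (sh w 1 b * z) = sh w 1 b * (sh w 3 (q 1) * z) := by
        intro z; simp (disch := norm_num) only [mul_assoc, swap, swap_mul, swap', swap_mul',
          Nat.reduceAdd, Nat.reduceSub]
      have h2 : ∀ z, sh w 1 (q 1) * (sh w 2 b * z) = sh w 2 b * (sh w 1 (q 1) * z) := by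
        intro z; simp (disch := norm_num) only [mul_assoc, swap, swap_mul, swap', swap_mul',
          Nat.reduceAdd, Nat.reduceSub]
      rw [B.q_b_mul 1 1, h2, h1, B.q_b_mul 1 2, H.snocOp_mul]
      simp (disch := norm_num) only [mul_assoc, swap, swap_mul, swap', swap_mul', Nat.reduceAdd,
        Nat.reduceSub]
    have hb : ∀ z, sh w 2 (q 1) * (sh w 1 (q 1) * (sh w 0 (q 1) *
        (sh w 0 b * (sh w 1 b * (sh w 0 b * z))))) = sh w 2 (q 1) * (sh w 1 (q 1) * (sh w 0 (q 1) *
        (sh w 1 b * (sh w 0 b * (sh w 1 b * z))))) := fun z => by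
      simpa only [mul_assoc] using congrArg (· * z) B.yang_baxter
    calc _ = sh w 0 (snocOp c q) * (sh w 3 (q 1) * (sh w 2 (q 1) * (sh w 1 b * (sh w 2 b *
          (sh w 0 b * (sh w 1 b * (sh w 0 b * sh w 3 r))))))) := by
          simp (disch := norm_num) only [reassoc (B.b_wsnocOp' H _), mul_assoc, swap, swap_mul,
            swap', swap_mul', Nat.reduceAdd, Nat.reduceSub]
      _ = sh w 0 (snocOp c q) * ((sh w 3 (q 1) * (sh w 2 (q 1) * (sh w 1 b * (sh w 2 b *
          (sh w 1 b * sh w 3 r)))))  * (sh w 0 b * sh w 1 b)) := by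
          rw [hq, hb, ← hq]
          simp (disch := norm_num) only [mul_assoc, swap, swap_mul, swap', swap_mul', Nat.reduceAdd,
            Nat.reduceSub]
      _ = _ := by
          rw [ih']
          simp (disch := norm_num) only [reassoc (B.b_wsnocOp' H _), mul_assoc, swap, swap_mul,
            swap', swap_mul', Nat.reduceAdd, Nat.reduceSub]

/-- The Yang-Baxter equation when one of the three strands has degree one. -/
theorem yang_baxter₂ : sh w 2 (q 1) * (sh w 0 b * (sh w 1 b * sh w 0 b)) =
    sh w 2 (q 1) * (sh w 1 b * (sh w 0 b * sh w 1 b)) := by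
  refine H.strand_induction 1 ?_ fun r hr ih => ?_
  · simp (disch := norm_num) only [reassoc (B.b_wu' _), reassoc (B.b_u' _), B.b_wu', B.b_u',
      mul_assoc, swap, swap_mul, swap', swap_mul', Nat.reduceAdd, Nat.reduceSub]
  · have ih' : sh w 3 (q 1) * (sh w 1 b * (sh w 2 b * (sh w 1 b * sh w 2 r))) =
        sh w 3 (q 1) * (sh w 2 b * (sh w 1 b * (sh w 2 b * sh w 2 r))) := by
      simpa only [map_mul, sh_sh, Nat.reduceAdd, mul_assoc] using congrArg (sh w 1) ih
    have hb : ∀ z, sh w 2 (q 1) * (sh w 1 (q 1) *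
        (sh w 0 b * (sh w 1 b * (sh w 0 b * z)))) = sh w 2 (q 1) * (sh w 1 (q 1) *
        (sh w 1 b * (sh w 0 b * (sh w 1 b * z)))) := fun z => by
      simpa only [mul_assoc] using congrArg (· * z) (B.yang_baxter₁ H)
    have hq : ∀ z, sh w 1 (snocOp c q) * (sh w 3 (q 1) * (sh w 2 b * z)) =
        sh w 1 (snocOp c q) * (sh w 2 b * (sh w 2 (q 1) * (sh w 1 (q 1) * z))) := by
      intro z
      rw [B.q_b_mul 1 2, H.snocOp_mul]
      simp (disch := norm_num) only [mul_assoc, swap, swap_mul, swap', swap_mul', Nat.reduceAdd,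
        Nat.reduceSub]
    calc _ = sh w 1 (snocOp c q) * (sh w 0 b * ((sh w 3 (q 1) *
          (sh w 1 b * (sh w 2 b * (sh w 1 b * sh w 2 r)))) * sh w 0 b)) := by
          simp (disch := norm_num) only [reassoc (B.b_wsnocOp' H _), reassoc (B.b_snocOp' _),
            mul_assoc, swap, swap_mul, swap', swap_mul', Nat.reduceAdd, Nat.reduceSub]
      _ = sh w 1 (snocOp c q) * (sh w 3 (q 1) * (sh w 2 b * (sh w 0 b * (sh w 1 b * (sh w 0 b *
          (sh w 2 b * sh w 2 r)))))) := by
          rw [ih']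
          simp (disch := norm_num) only [mul_assoc, swap, swap_mul, swap', swap_mul', Nat.reduceAdd,
            Nat.reduceSub]
      _ = _ := by
          rw [hq, hb, ← hq]
          simp (disch := norm_num) only [reassoc (B.b_wsnocOp' H _), reassoc (B.b_snocOp' _),
            mul_assoc, swap, swap_mul, swap', swap_mul', Nat.reduceAdd, Nat.reduceSub]

/-- The Yang-Baxter equation on the whole tensor space. -/
theorem yang_baxter_eq : sh w 0 b * (sh w 1 b * sh w 0 b) = sh w 1 b * (sh w 0 b * sh w 1 b) := by
  refine H.strand_induction 0 ?_ fun r hr ih => ?_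
  · simp (disch := norm_num) only [reassoc (B.b_wu' _), reassoc (B.b_u' _), B.b_wu', B.b_u',
      mul_assoc, swap, swap_mul, swap', swap_mul', Nat.reduceAdd, Nat.reduceSub]
  · have ih' : sh w 1 b * (sh w 2 b * (sh w 1 b * sh w 1 r)) =
        sh w 2 b * (sh w 1 b * (sh w 2 b * sh w 1 r)) := by
      simpa only [map_mul, sh_sh, Nat.reduceAdd, mul_assoc] using congrArg (sh w 1) ih
    have hb : ∀ z, sh w 2 (snocOp c q) * (sh w 0 b * (sh w 1 b * (sh w 0 b * z))) =
        sh w 2 (snocOp c q) * (sh w 1 b * (sh w 0 b * (sh w 1 b * z))) := fun z => by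
      rw [H.snocOp_mul, reassoc₄ (B.yang_baxter₂ H)]
      simp only [mul_assoc]
      rw [← H.snocOp_mul]
    calc _ = sh w 2 (snocOp c q) * (sh w 0 b * (sh w 1 b * (sh w 0 b *
          (sh w 2 b * (sh w 1 b * sh w 1 r))))) := by
          simp (disch := norm_num) only [reassoc (B.b_snocOp' _), mul_assoc, swap, swap_mul, swap',
            swap_mul', Nat.reduceAdd, Nat.reduceSub]
      _ = sh w 2 (snocOp c q) * (sh w 1 b * (sh w 0 b * (sh w 1 b * (sh w 2 b *
          (sh w 1 b * sh w 1 r))))) := hb _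
      _ = _ := by
          rw [ih']
          simp (disch := norm_num) only [reassoc (B.b_snocOp' _), mul_assoc, swap, swap_mul, swap',
            swap_mul', Nat.reduceAdd, Nat.reduceSub]

theorem yang_baxter_eq' (k : ℕ) : sh w k b * (sh w (k + 1) b * sh w k b) =
    sh w (k + 1) b * (sh w k b * sh w (k + 1) b) := by
  simpa only [map_mul, sh_sh, Nat.add_zero] using congrArg (sh w k) (B.yang_baxter_eq H)

/-- The braiding is natural with respect to the deconcatenation. -/
theorem d_b : sh w 0 d * sh w 0 b = sh w 1 b * (sh w 0 b * sh w 1 d) := by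
  refine H.strand_induction 1 ?_ fun r hr ih => ?_
  · simp (disch := norm_num) only [reassoc (B.b_wu' _), reassoc (B.b_u' _), B.b_wu', B.b_u', H.d_u',
      reassoc (H.d_u' _), mul_assoc, swap, swap_mul, swap', swap_mul', Nat.reduceAdd, Nat.reduceSub]
  · have ih' : sh w 1 d * (sh w 1 b * sh w 2 r) = sh w 2 b * (sh w 1 b * (sh w 2 d * sh w 2 r)) := by
      simpa only [map_mul, sh_sh, Nat.reduceAdd, mul_assoc] using congrArg (sh w 1) ih
    calc _ = sh w 0 (snocOp c q) * ((sh w 1 d * (sh w 1 b * sh w 2 r)) * sh w 0 b) +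
          sh w 0 u * (sh w 0 (snocOp c q) * (sh w 1 b * (sh w 0 b * sh w 2 r))) := by
          simp (disch := norm_num) only [reassoc (B.b_wsnocOp' H _), reassoc (H.d_snocOp' _),
            mul_add, add_mul, mul_assoc, swap, swap_mul, swap', swap_mul', Nat.reduceAdd,
            Nat.reduceSub]
      _ = _ := by
          have h1 : sh w 2 d * (sh w 2 r * sh w 0 b) = sh w 0 b * (sh w 2 d * sh w 2 r) := by
            have h2 : sh w 0 b * sh w 2 r = sh w 2 r * sh w 0 b := by
              simp (disch := norm_num) only [mul_assoc, swap, swap_mul, swap', swap_mul',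
                Nat.reduceAdd, Nat.reduceSub]
            rw [← h2, ← mul_assoc, ← mul_assoc]
            simp (disch := norm_num) only [swap', Nat.reduceAdd, Nat.reduceSub]
          rw [ih']
          simp (disch := norm_num) only [reassoc (B.b_wsnocOp' H _), reassoc (B.b_snocOp' _),
            reassoc (H.d_snocOp' _), reassoc (B.b_wu' _), reassoc (B.b_u' _), mul_add, add_mul,
            mul_assoc, swap, swap_mul, swap', swap_mul', Nat.reduceAdd, Nat.reduceSub]
          rw [h1]

theorem d_b' (k : ℕ) :
    sh w k d * sh w k b = sh w (k + 1) b * (sh w k b * sh w (k + 1) d) := by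
  simpa only [map_mul, sh_sh, Nat.add_zero] using congrArg (sh w k) (B.d_b H)

theorem wd_b : sh w 1 d * sh w 0 b = sh w 0 b * (sh w 1 b * sh w 0 d) := by
  refine H.strand_induction 0 ?_ fun r hr ih => ?_
  · simp (disch := norm_num) only [reassoc (B.b_wu' _), reassoc (B.b_u' _), B.b_wu', B.b_u', H.d_u',
      reassoc (H.d_u' _), mul_assoc, swap, swap_mul, swap', swap_mul', Nat.reduceAdd, Nat.reduceSub]
  · have ih' : sh w 2 d * (sh w 1 b * sh w 1 r) = sh w 1 b * (sh w 2 b * (sh w 1 d * sh w 1 r)) := by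
      simpa only [map_mul, sh_sh, Nat.reduceAdd, mul_assoc] using congrArg (sh w 1) ih
    calc _ = sh w 1 (snocOp c q) * (sh w 0 b * (sh w 2 d * (sh w 1 b * sh w 1 r))) +
          sh w 1 u * (sh w 1 (snocOp c q) * (sh w 0 b * (sh w 1 b * sh w 1 r))) := by
          simp (disch := norm_num) only [reassoc (B.b_snocOp' _), reassoc (H.d_snocOp' _), mul_add,
            add_mul, mul_assoc, swap, swap_mul, swap', swap_mul', Nat.reduceAdd, Nat.reduceSub]
      _ = _ := by
          rw [ih']
          simp (disch := norm_num) only [reassoc (B.b_wsnocOp' H _), reassoc (B.b_snocOp' _),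
            reassoc (H.d_snocOp' _), reassoc (B.b_wu' _), reassoc (B.b_u' _), mul_add, add_mul,
            mul_assoc, swap, swap_mul, swap', swap_mul', Nat.reduceAdd, Nat.reduceSub]

theorem wd_b' (k : ℕ) :
    sh w (k + 1) d * sh w k b = sh w k b * (sh w (k + 1) b * sh w k d) := by
  simpa only [map_mul, sh_sh, Nat.add_zero] using congrArg (sh w k) (B.wd_b H)

end BraidRel

/-! ### Fixed point equations -/

/-- Uniqueness of the solution of a linear fixed point equation `Z = y F (Z ⊗ id) Γ`, where the
coproduct `Γ` is compatible with gradings `P` and `Q` and `F` kills the degree zero. -/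
theorem fixed_point_eq_zero {ι τ : Type*} (deg : ι → ℕ) {P Q : ι → R} (T : ι → Finset τ)
    (l r : τ → ι) (k : ℕ) {Γ F y Z : R} (hP : ∀ X, (∀ a, X * P a = 0) → X = 0)
    (hΓ : ∀ a, Γ * P a = ∑ t ∈ T a, sh w k (P (l t)) * (Q (r t) * Γ))
    (hdeg : ∀ a, ∀ t ∈ T a, deg (l t) + deg (r t) = deg a)
    (hQ : ∀ a x, Q a * sh w k x = sh w k x * Q a) (hF : ∀ a, deg a = 0 → F * Q a = 0)
    (hZ : Z = y * (F * (sh w k Z * Γ))) : Z = 0 := by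
  refine hP Z fun a => ?_
  induction hn : deg a using Nat.strong_induction_on generalizing a with
  | _ n ih =>
    rw [hZ]
    simp only [mul_assoc, hΓ, Finset.mul_sum]
    refine Finset.sum_eq_zero fun t ht => ?_
    have ht' := hdeg a t ht
    rw [← mul_assoc (sh w k Z), ← map_mul]
    by_cases h0 : deg (r t) = 0
    · rw [reassoc (hQ _ _).symm, mul_assoc, reassoc (hF _ h0), zero_mul, mul_zero]
    · rw [ih (deg (l t)) (by omega) (l t) rfl, map_zero, zero_mul, mul_zero, mul_zero]

namespace TensorRel

variable (H : TensorRel w u c e d q)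
include H

theorem d_d' (k : ℕ) : sh w k d * sh w k d = sh w (k + 1) d * sh w k d := by
  simpa only [map_mul, sh_sh, Nat.add_zero] using congrArg (sh w k) H.d_d

theorem e_d' (k : ℕ) : sh w k e * sh w k d = 1 := by
  simpa only [map_mul, map_one, sh_sh, Nat.add_zero] using congrArg (sh w k) H.e_d

theorem we_d' (k : ℕ) : sh w (k + 1) e * sh w k d = 1 := by
  simpa only [map_mul, map_one, sh_sh, Nat.add_zero] using congrArg (sh w k) H.we_d

theorem d_q' (n k : ℕ) : sh w k d * sh w k (q n) =
    ∑ t ∈ Finset.HasAntidiagonal.antidiagonal n,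
      sh w (k + 1) (q t.1) * (sh w k (q t.2) * sh w k d) := by
  simpa only [map_mul, map_sum, sh_sh, Nat.add_zero] using congrArg (sh w k) (H.d_q n)

theorem e_q_of_ne {n : ℕ} (hn : n ≠ 0) (k : ℕ) : sh w k e * sh w k (q n) = 0 := by
  simpa only [map_mul, map_zero, sh_sh, Nat.add_zero] using congrArg (sh w k) (H.e_q hn)

theorem e_q_zero' (k : ℕ) : sh w k e * sh w k (q 0) = sh w k e := by
  simpa only [map_mul, map_zero, sh_sh, Nat.add_zero] using congrArg (sh w k) H.e_q_zero

theorem q_zero' (k : ℕ) : sh w k (q 0) = sh w k u * sh w k e := by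
  rw [← map_mul]; exact congrArg (sh w k) H.q_zero

theorem e_snocOp : sh w 0 e * sh w 0 (snocOp c q) = 0 := by
  refine H.faithful' 1 fun n => ?_
  rw [mul_assoc, ← H.q_snocOp, reassoc (H.e_q n.succ_ne_zero), zero_mul, zero_mul]

/-- The part of degree one of `x v`, for a letter `v`, is `ε(x) v`. -/
theorem q_one_snocOp : sh w 0 (q 1) * sh w 0 (snocOp c q) = sh w 0 (q 1) * sh w 1 e := by
  refine H.faithful' 1 fun n => ?_
  rw [mul_assoc, mul_assoc]
  by_cases hn : n = 0
  · subst hn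
    rw [H.q_snocOp, H.e_q_zero', snocOp_def, H.q_zero']
    have h := H.c_wu
    simp (disch := norm_num) only [mul_assoc, swap, swap_mul, swap', swap_mul', Nat.reduceAdd,
      Nat.reduceSub]
    rw [reassoc h, one_mul]
  · rw [← H.q_snocOp, reassoc (H.q_mul_ne 1 (n + 1) (by omega)), zero_mul, H.e_q_of_ne hn, mul_zero]

/-- Every element of the tensor coalgebra is the sum of its counit and of what its coproduct gives
by appending the last letter. -/
theorem u_e_add_snocOp_d : sh w 0 u * sh w 0 e + sh w 0 (snocOp c q) * sh w 0 d = 1 := by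
  refine H.faithful' 0 fun n => ?_
  rw [add_mul, mul_assoc, mul_assoc, H.d_q, Finset.mul_sum, one_mul]
  cases n with
  | zero =>
    rw [H.e_q_zero, Finset.Nat.antidiagonal_zero, Finset.sum_singleton, snocOp_def, ← H.q_zero']
    simp (disch := norm_num) only [mul_assoc, swap, swap_mul, swap', swap_mul', Nat.reduceAdd,
      Nat.reduceSub]
    rw [reassoc (H.q_mul_ne 1 0 one_ne_zero)]
    simp
  | succ n =>
    rw [H.e_q n.succ_ne_zero, mul_zero, zero_add, Finset.sum_eq_single (n, 1)]
    · rw [← H.c_qq_d, snocOp_def]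
      simp (disch := norm_num) only [mul_assoc, swap, swap_mul, swap', swap_mul', Nat.reduceAdd,
        Nat.reduceSub]
      rw [reassoc (H.q_mul_self 1)]
    · rintro ⟨i, j⟩ hij hne
      have hj : 1 ≠ j := by
        rintro rfl
        simp at hij hne
        exact hne hij
      rw [snocOp_def]
      simp (disch := norm_num) only [mul_assoc, swap, swap_mul, swap', swap_mul', Nat.reduceAdd,
        Nat.reduceSub]
      rw [reassoc (H.q_mul_ne 1 j hj)]
      simp
    · simp

theorem e_c : sh w 0 e * sh w 0 c = sh w 0 e * sh w 0 e := by
  refine H.strand_induction 0 ?_ fun r hr _ => ?_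
  · rw [mul_assoc, mul_assoc, H.c_u, H.e_u]
  · rw [mul_assoc, mul_assoc, reassoc H.c_snocOp, mul_assoc, reassoc H.e_snocOp, reassoc H.e_snocOp]
    simp

/-- The equation `Z = f (Z ⊗ id) δ`, where `f` appends the part of degree one, has only the
solution `0`. -/
theorem eq_zero_of_eq_snocOp {Z : R} (hZ : Z = sh w 0 (snocOp c q) * (sh w 1 Z * sh w 0 d)) :
    Z = 0 := by
  refine fixed_point_eq_zero (w := w) (P := fun n => sh w 0 (q n)) (Q := fun n => sh w 0 (q n)) id
    (fun n => Finset.HasAntidiagonal.antidiagonal n) Prod.fst Prod.snd 1 (y := sh w 0 c)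
    (F := sh w 0 (q 1)) (Γ := sh w 0 d) (H.faithful 0) ?_ ?_ ?_ ?_ ?_
  · intro a
    rw [H.d_q]
    simp only [sh_sh, Nat.add_zero]
  · rintro a ⟨i, j⟩ ht
    simpa using ht
  · intro a x
    simp (disch := norm_num) only [far, Nat.reduceAdd, Nat.reduceSub]
  · rintro a rfl
    exact H.q_mul_ne 1 0 one_ne_zero
  · rw [← mul_assoc (sh w 0 c)]
    exact hZ

end TensorRel

/-- The coproduct of the tensor square of the tensor coalgebra. -/
def comulOp (w : R →+* R) (d b : R) : R := sh w 1 b * (sh w 2 d * sh w 0 d)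

omit [Letter w d 1 2 3] [Letter w b 2 2 2] in
theorem sh_comulOp (k : ℕ) :
    sh w k (comulOp w d b) = sh w (k + 1) b * (sh w (k + 2) d * sh w k d) := by
  simp only [comulOp, map_mul, sh_sh, Nat.add_zero]

namespace BraidRel

variable (H : TensorRel w u c e d q) (B : BraidRel w u c b q)
include H B

theorem e_b : sh w 0 e * sh w 0 b = sh w 1 e := by
  rw [← H.e_q_zero, mul_assoc, ← B.b_wq, H.q_zero', reassoc B.b_wu, reassoc H.e_u, one_mul]

theorem e_b' (k : ℕ) : sh w k e * sh w k b = sh w (k + 1) e := by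
  simpa only [map_mul, sh_sh, Nat.add_zero] using congrArg (sh w k) (B.e_b H)

theorem we_b : sh w 1 e * sh w 0 b = sh w 0 e := by
  rw [← H.e_q_zero' 1, mul_assoc, ← B.b_q, H.q_zero', reassoc B.b_u, reassoc (H.e_u' 1), one_mul]

theorem we_b' (k : ℕ) : sh w (k + 1) e * sh w k b = sh w k e := by
  simpa only [map_mul, sh_sh, Nat.add_zero] using congrArg (sh w k) (B.we_b H)

theorem comul_coassoc : sh w 2 (comulOp w d b) * sh w 0 (comulOp w d b) =
    sh w 0 (comulOp w d b) * sh w 0 (comulOp w d b) := by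
  simp (disch := norm_num) only [sh_comulOp, reassoc (B.d_b' H _), reassoc (B.wd_b' H _), H.d_d',
    reassoc (H.d_d' _), Nat.zero_add, mul_assoc, swap, swap_mul, swap', swap_mul', Nat.reduceAdd,
    Nat.reduceSub]

theorem counit_comul : sh w 2 e * (sh w 2 e * sh w 0 (comulOp w d b)) = 1 := by
  simp (disch := norm_num) only [sh_comulOp, reassoc (B.e_b' H _), reassoc (B.we_b' H _), H.e_d',
    reassoc (H.e_d' _), H.we_d', reassoc (H.we_d' _), Nat.zero_add, one_mul, mul_assoc, swap,
    swap_mul, swap', swap_mul', Nat.reduceAdd, Nat.reduceSub]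

theorem comul_counit : sh w 0 e * (sh w 0 e * sh w 0 (comulOp w d b)) = 1 := by
  simp (disch := norm_num) only [sh_comulOp, reassoc (B.e_b' H _), reassoc (B.we_b' H _), H.e_d',
    reassoc (H.e_d' _), H.we_d', reassoc (H.we_d' _), Nat.zero_add, one_mul, mul_assoc, swap,
    swap_mul, swap', swap_mul', Nat.reduceAdd, Nat.reduceSub]

/-- The coproduct of the tensor square is compatible with the bidegrees. -/
theorem comul_grading (a : ℕ × ℕ) :
    sh w 0 (comulOp w d b) * (sh w 1 (q a.1) * sh w 0 (q a.2)) =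
      ∑ t ∈ Finset.HasAntidiagonal.antidiagonal a.1 ×ˢ Finset.HasAntidiagonal.antidiagonal a.2,
        sh w 2 (sh w 1 (q t.1.1) * sh w 0 (q t.2.1)) *
          ((sh w 1 (q t.1.2) * sh w 0 (q t.2.2)) * sh w 0 (comulOp w d b)) := by
  obtain ⟨i, j⟩ := a
  have h1 : sh w 0 d * sh w 1 (q i) = sh w 2 (q i) * sh w 0 d := by
    simp (disch := norm_num) only [mul_assoc, swap, swap_mul, swap', swap_mul', Nat.reduceAdd,
      Nat.reduceSub]
  rw [sh_comulOp, mul_assoc, mul_assoc, reassoc h1, mul_assoc, H.d_q, reassoc (H.d_q' i 2),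
    Finset.sum_mul_sum, Finset.mul_sum, Finset.sum_product]
  refine Finset.sum_congr rfl fun t _ => ?_
  rw [Finset.mul_sum]
  refine Finset.sum_congr rfl fun t' _ => ?_
  simp (disch := norm_num) only [map_mul, sh_sh, reassoc (B.b_q' _ _), reassoc (B.b_wq' _ _),
    Nat.zero_add, mul_assoc, swap, swap_mul, swap', swap_mul', Nat.reduceAdd, Nat.reduceSub]

/-- Uniqueness of the solution of a fixed point equation on the tensor square. -/
theorem eq_zero_of_eq_comul {F y Z : R} (hF : F * (sh w 1 (q 0) * sh w 0 (q 0)) = 0)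
    (hZ : Z = y * (F * (sh w 2 Z * sh w 0 (comulOp w d b)))) : Z = 0 := by
  refine fixed_point_eq_zero (w := w) (P := fun a : ℕ × ℕ => sh w 1 (q a.1) * sh w 0 (q a.2))
    (Q := fun a : ℕ × ℕ => sh w 1 (q a.1) * sh w 0 (q a.2)) (fun a => a.1 + a.2)
    (fun a => Finset.HasAntidiagonal.antidiagonal a.1 ×ˢ Finset.HasAntidiagonal.antidiagonal a.2)
    (fun t => (t.1.1, t.2.1)) (fun t => (t.1.2, t.2.2)) 2 ?_ (B.comul_grading H) ?_ ?_ ?_ hZ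
  · exact fun X hX => H.faithful 1 X fun i => H.faithful 0 _ fun j => by
      rw [mul_assoc]; exact hX (i, j)
  · rintro ⟨i, j⟩ ⟨⟨i₁, i₂⟩, ⟨j₁, j₂⟩⟩ ht
    simp at ht ⊢
    omega
  · intro a x
    simp (disch := norm_num) only [far, reassoc (far _ _), mul_assoc, Nat.reduceAdd, Nat.reduceSub]
  · rintro ⟨i, j⟩ hij
    simp at hij
    obtain ⟨rfl, rfl⟩ := hij
    exact hF

/-- Uniqueness of the solution of a fixed point equation on `C ⊗ T`, where the tensor square `C` is
first moved past `T`. -/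
theorem eq_zero_of_eq_braid_comul {F y Z : R} (hF : F * (sh w 1 (q 0) * sh w 0 (q 0)) = 0)
    (hZ : Z = y * (F * (sh w 2 Z * (sh w 1 b * (sh w 0 b * sh w 1 (comulOp w d b)))))) : Z = 0 := by
  refine fixed_point_eq_zero (w := w)
    (P := fun a : ℕ × ℕ => sh w 1 (sh w 1 (q a.1) * sh w 0 (q a.2)))
    (Q := fun a : ℕ × ℕ => sh w 1 (q a.1) * sh w 0 (q a.2)) (fun a => a.1 + a.2)
    (fun a => Finset.HasAntidiagonal.antidiagonal a.1 ×ˢ Finset.HasAntidiagonal.antidiagonal a.2)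
    (fun t => (t.1.1, t.2.1)) (fun t => (t.1.2, t.2.2)) 2 ?_ ?_ ?_ ?_ ?_ hZ
  · refine fun X hX => H.faithful 2 X fun i => H.faithful 1 _ fun j => ?_
    have := hX (i, j)
    simp only [map_mul, sh_sh, Nat.reduceAdd, Nat.add_zero] at this
    rw [mul_assoc, this]
  · intro a
    have h := congrArg (sh w 1) (B.comul_grading H a)
    rw [map_mul, sh_sh, Nat.add_zero] at h
    rw [mul_assoc, mul_assoc, h, map_sum, Finset.mul_sum, Finset.mul_sum]
    refine Finset.sum_congr rfl fun t _ => ?_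
    simp (disch := norm_num) only [map_mul, sh_sh, reassoc (B.b_q' _ _), reassoc (B.b_wq' _ _),
      Nat.zero_add, sh_comulOp, mul_assoc, swap, swap_mul, swap', swap_mul', Nat.reduceAdd,
      Nat.reduceSub]
  · rintro ⟨i, j⟩ ⟨⟨i₁, i₂⟩, ⟨j₁, j₂⟩⟩ ht
    simp at ht ⊢
    omega
  · intro a x
    simp (disch := norm_num) only [far, reassoc (far _ _), mul_assoc, Nat.reduceAdd, Nat.reduceSub]
  · rintro ⟨i, j⟩ hij
    simp at hij
    obtain ⟨rfl, rfl⟩ := hij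
    exact hF

/-- Uniqueness of the solution of a fixed point equation on the tensor cube. -/
theorem eq_zero_of_eq_comul₃ {F y Z : R}
    (hF : F * (sh w 2 (q 0) * (sh w 1 (q 0) * sh w 0 (q 0))) = 0)
    (hZ : Z = y * (F * (sh w 3 Z * (sh w 2 b * (sh w 1 b * (sh w 2 (comulOp w d b) * sh w 0 d)))))) :
    Z = 0 := by
  refine fixed_point_eq_zero (w := w)
    (P := fun a : (ℕ × ℕ) × ℕ => sh w 2 (q a.1.1) * (sh w 1 (q a.1.2) * sh w 0 (q a.2)))
    (Q := fun a : (ℕ × ℕ) × ℕ => sh w 2 (q a.1.1) * (sh w 1 (q a.1.2) * sh w 0 (q a.2)))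
    (fun a => a.1.1 + a.1.2 + a.2)
    (fun a => (Finset.HasAntidiagonal.antidiagonal a.1.1 ×ˢ
      Finset.HasAntidiagonal.antidiagonal a.1.2) ×ˢ Finset.HasAntidiagonal.antidiagonal a.2)
    (fun t => ((t.1.1.1, t.1.2.1), t.2.1)) (fun t => ((t.1.1.2, t.1.2.2), t.2.2)) 3 ?_ ?_ ?_ ?_ ?_ hZ
  · refine fun X hX => H.faithful 2 X fun i => H.faithful 1 _ fun j => H.faithful 0 _ fun k => ?_
    rw [mul_assoc, mul_assoc]
    exact hX ((i, j), k)
  · rintro ⟨a, k⟩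
    have h := congrArg (sh w 2) (B.comul_grading H a)
    rw [map_mul, sh_sh, Nat.add_zero, map_sum] at h
    have h1 : sh w 0 d * (sh w 2 (q a.1) * (sh w 1 (q a.2) * sh w 0 (q k))) =
        sh w 2 (sh w 1 (q a.1) * sh w 0 (q a.2)) * (sh w 0 d * sh w 0 (q k)) := by
      simp (disch := norm_num) only [map_mul, sh_sh, mul_assoc, swap, swap_mul, swap', swap_mul',
        Nat.reduceAdd, Nat.reduceSub]
    simp only [mul_assoc]
    rw [h1, reassoc h, H.d_q, Finset.sum_mul_sum]
    simp only [Finset.mul_sum, Finset.sum_product]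
    refine Finset.sum_congr rfl fun t _ => Finset.sum_congr rfl fun t' _ =>
      Finset.sum_congr rfl fun t'' _ => ?_
    have h2 : ∀ z, sh w 3 b * (sh w 2 (q t''.1) * z) = sh w 2 (q t''.1) * (sh w 3 b * z) := by
      intro z; simp (disch := norm_num) only [mul_assoc, swap, swap_mul, swap', swap_mul',
        Nat.reduceAdd, Nat.reduceSub]
    simp (disch := norm_num) only [map_mul, sh_sh, reassoc (B.b_q' _ _), reassoc (B.b_wq' _ _),
      Nat.zero_add, sh_comulOp, mul_assoc, swap, swap_mul, swap', swap_mul', Nat.reduceAdd,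
      Nat.reduceSub]
    rw [h2, reassoc (B.b_q' _ 2), mul_assoc]
    simp (disch := norm_num) only [mul_assoc, swap, swap_mul, swap', swap_mul', Nat.reduceAdd,
      Nat.reduceSub]
  · rintro ⟨⟨i, j⟩, k⟩ ⟨⟨⟨i₁, i₂⟩, ⟨j₁, j₂⟩⟩, k₁, k₂⟩ ht
    simp at ht ⊢
    omega
  · intro a x
    simp (disch := norm_num) only [far, reassoc (far _ _), mul_assoc, Nat.reduceAdd, Nat.reduceSub]
  · rintro ⟨⟨i, j⟩, k⟩ hij
    simp at hij
    obtain ⟨⟨rfl, rfl⟩, rfl⟩ := hij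
    exact hF

end BraidRel

/-! ### The product as a solution of a fixed point equation -/

namespace BraidRel

variable (H : TensorRel w u c e d q) (B : BraidRel w u c b q)
include H B

omit B H in
/-- A braiding of the strands `k` and `k + 1` can be interchanged with operations on deeper strands. -/
theorem cross_far {k j : ℕ} (h : k + 2 ≤ j) (X z : R) :
    sh w k b * (sh w j X * z) = sh w j X * (sh w k b * z) := by
  rw [reassoc (far h X), Nat.sub_add_cancel (by omega), mul_assoc]

/-- A strand can be moved past the coproduct of the tensor square. -/
theorem comul_braid : sh w 0 (comulOp w d b) * (sh w 1 b * sh w 0 b) =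
    sh w 3 b * (sh w 2 b * (sh w 1 b * (sh w 0 b * sh w 1 (comulOp w d b)))) := by
  have h1 : ∀ z, sh w 0 d * (sh w 1 b * z) = sh w 2 b * (sh w 0 d * z) := fun z => by
    rw [swap_mul (by norm_num) (by norm_num)]
  have h2 : ∀ z, sh w 2 d * (sh w 2 b * z) = sh w 3 b * (sh w 2 b * (sh w 3 d * z)) := fun z => by
    rw [reassoc (B.d_b' H 2)]; simp only [mul_assoc, Nat.reduceAdd]
  have h3 : ∀ z, sh w 3 d * (sh w 1 b * z) = sh w 1 b * (sh w 3 d * z) := fun z => by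
    rw [cross_far (k := 1) (j := 3) (by norm_num)]
  have h4 : sh w 3 d * (sh w 0 b * sh w 1 d) = sh w 0 b * (sh w 3 d * sh w 1 d) := by
    rw [cross_far (k := 0) (j := 3) (by norm_num)]
  have h5 : ∀ z, sh w 1 b * (sh w 3 b * z) = sh w 3 b * (sh w 1 b * z) := fun z => by
    rw [cross_far (k := 1) (j := 3) (by norm_num)]
  have h6 : ∀ z, sh w 1 b * (sh w 2 b * (sh w 1 b * z)) =
      sh w 2 b * (sh w 1 b * (sh w 2 b * z)) := fun z => by
    rw [reassoc₃ (B.yang_baxter_eq' H 1)]; simp only [mul_assoc]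
  have h7 : ∀ z, sh w 2 b * (sh w 0 b * z) = sh w 0 b * (sh w 2 b * z) := fun z => by
    rw [cross_far (k := 0) (j := 2) (by norm_num)]
  rw [sh_comulOp, sh_comulOp, mul_assoc, mul_assoc, h1, B.d_b' H 0]
  simp only [Nat.reduceAdd, Nat.zero_add]
  rw [h2, h3, h4, h5, h6, h7]

theorem braid_comul : sh w 1 (comulOp w d b) * (sh w 0 b * sh w 1 b) =
    sh w 0 b * (sh w 1 b * (sh w 2 b * (sh w 3 b * sh w 0 (comulOp w d b)))) := by
  have h1 : sh w 0 d * sh w 1 b = sh w 2 b * sh w 0 d := by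
    rw [swap (by norm_num) (by norm_num)]
  have h2 : ∀ z, sh w 3 d * (sh w 2 b * z) = sh w 2 b * (sh w 3 b * (sh w 2 d * z)) := fun z => by
    rw [reassoc (B.wd_b' H 2)]; simp only [mul_assoc]
  have h3 : ∀ z, sh w 3 d * (sh w 0 b * (sh w 1 b * z)) =
      sh w 0 b * (sh w 1 b * (sh w 3 d * z)) := fun z => by
    rw [cross_far (b := b) (k := 1) (j := 3) (by norm_num), cross_far (k := 0) (j := 3) (by norm_num)]
  have h4 : ∀ z, sh w 1 d * (sh w 0 b * z) = sh w 0 b * (sh w 1 b * (sh w 0 d * z)) := fun z => by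
    rw [reassoc (B.wd_b' H 0)]; simp only [mul_assoc]
  have h5 : ∀ z, sh w 1 b * (sh w 3 b * z) = sh w 3 b * (sh w 1 b * z) := fun z => by
    rw [cross_far (k := 1) (j := 3) (by norm_num)]
  have h6 : ∀ z, sh w 2 b * (sh w 1 b * (sh w 2 b * z)) =
      sh w 1 b * (sh w 2 b * (sh w 1 b * z)) := fun z => by
    rw [reassoc₃ (B.yang_baxter_eq' H 1).symm]; simp only [mul_assoc]
  have h7 : ∀ z, sh w 2 b * (sh w 0 b * z) = sh w 0 b * (sh w 2 b * z) := fun z => by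
    rw [cross_far (k := 0) (j := 2) (by norm_num)]
  rw [sh_comulOp, sh_comulOp, mul_assoc, mul_assoc, h4, h1]
  simp only [Nat.reduceAdd, Nat.zero_add]
  rw [h3, h2, h7, h6, h5]

end BraidRel

/-- The relations of the operations of a quantum `B_∞`-algebra: `m` is the sum of the maps
`M_{pq}`. -/
structure MulRel (w : R →+* R) (u b m : R) (q : ℕ → R) : Prop where
  q_m : sh w 0 (q 1) * sh w 0 m = sh w 0 m
  m_u : sh w 0 m * sh w 0 u = sh w 0 (q 1)
  m_wu : sh w 0 m * sh w 1 u = sh w 0 (q 1)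
  b_wm : sh w 0 b * sh w 1 m = sh w 0 m * (sh w 1 b * sh w 0 b)
  b_m : sh w 0 b * sh w 0 m = sh w 1 m * (sh w 0 b * sh w 1 b)

/-- The product `s` of a quantum `B_∞`-algebra is determined by a fixed point equation: apart from
its constant term, it is the concatenation of `s` and `m` after the coproduct of the tensor square. -/
structure StarRel (w : R →+* R) (u c e d b m s : R) (q : ℕ → R) : Prop
    extends MulRel w u b m q where
  s_eq : sh w 0 s = sh w 0 u * (sh w 0 e * sh w 0 e) +
    sh w 0 c * (sh w 0 m * (sh w 2 s * sh w 0 (comulOp w d b)))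

namespace MulRel

variable (H : TensorRel w u c e d q) (P : MulRel w u b m q)

theorem m_far (X z : R) : sh w 0 m * (sh w 2 X * z) = sh w 1 X * (sh w 0 m * z) := by
  rw [reassoc (far (by norm_num) X), mul_assoc]

include P

theorem m_u' (k : ℕ) : sh w k m * sh w k u = sh w k (q 1) := by
  simpa only [map_mul, sh_sh, Nat.add_zero] using congrArg (sh w k) P.m_u

theorem m_wu' (k : ℕ) : sh w k m * sh w (k + 1) u = sh w k (q 1) := by
  simpa only [map_mul, sh_sh, Nat.add_zero] using congrArg (sh w k) P.m_wu

theorem b_wm' (k : ℕ) : sh w k b * sh w (k + 1) m = sh w k m * (sh w (k + 1) b * sh w k b) := by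
  simpa only [map_mul, sh_sh, Nat.add_zero] using congrArg (sh w k) P.b_wm

theorem b_m' (k : ℕ) : sh w k b * sh w k m = sh w (k + 1) m * (sh w k b * sh w (k + 1) b) := by
  simpa only [map_mul, sh_sh, Nat.add_zero] using congrArg (sh w k) P.b_m

include H

theorem m_q_zero : sh w 0 m * (sh w 1 (q 0) * sh w 0 (q 0)) = 0 := by
  rw [H.q_zero', H.q_zero', mul_assoc, reassoc P.m_wu]
  simp (disch := norm_num) only [reassoc H.q_one_u, zero_mul, mul_zero, mul_assoc, swap, swap_mul,
    swap', swap_mul', Nat.reduceAdd, Nat.reduceSub]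

end MulRel

namespace StarRel

variable (H : TensorRel w u c e d q) (B : BraidRel w u c b q) (S : StarRel w u c e d b m s q)
include S

theorem s_eq' (k : ℕ) : sh w k s = sh w k u * (sh w k e * sh w k e) +
    sh w k c * (sh w k m * (sh w (k + 2) s * sh w k (comulOp w d b))) := by
  rw [show sh w k s = sh w k (sh w 0 s) by rw [sh_sh, Nat.add_zero], S.s_eq]
  simp only [map_mul, map_add, sh_sh, Nat.add_zero]

theorem c_m : sh w 0 c * sh w 0 m = sh w 0 (snocOp c q) * sh w 0 m := by
  rw [snocOp_def, mul_assoc, S.q_m]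

include H

theorem e_m : sh w 0 e * sh w 0 m = 0 := by
  rw [← S.q_m, reassoc (H.e_q one_ne_zero), zero_mul]

theorem e_s : sh w 0 e * sh w 0 s = sh w 0 e * sh w 0 e := by
  rw [S.s_eq, mul_add, reassoc H.e_u, one_mul, reassoc H.e_c, mul_assoc, reassoc (S.e_m H),
    zero_mul, mul_zero, add_zero]

theorem e_s' (k : ℕ) : sh w k e * sh w k s = sh w k e * sh w k e := by
  simpa only [map_mul, sh_sh, Nat.add_zero] using congrArg (sh w k) (S.e_s H)

include B

/-- The product has the given part of degree one. -/
theorem q_s : sh w 0 (q 1) * sh w 0 s = sh w 0 m := by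
  rw [S.s_eq, mul_add, reassoc H.q_one_u, zero_mul, zero_add, reassoc S.c_m, mul_assoc,
    reassoc H.q_one_snocOp, mul_assoc, ← MulRel.m_far, reassoc S.q_m, reassoc (S.e_s' H 2), mul_assoc,
    B.counit_comul H, mul_one]

/-- The unit is a right unit: the fixed point equation becomes the recursion which rebuilds an element
from its letters. -/
theorem s_u : sh w 0 s * sh w 0 u = 1 := by
  have h : sh w 0 s * sh w 0 u = sh w 0 u * sh w 0 e +
      sh w 0 (snocOp c q) * (sh w 1 (sh w 0 s * sh w 0 u) * sh w 0 d) := by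
    calc _ = (sh w 0 u * (sh w 0 e * sh w 0 e) +
          sh w 0 c * (sh w 0 m * (sh w 2 s * sh w 0 (comulOp w d b)))) * sh w 0 u := by
          rw [← S.s_eq]
      _ = _ := by
          simp (disch := norm_num) only [map_mul, sh_sh, sh_comulOp, add_mul, mul_add, H.e_u',
            reassoc (H.e_u' _), one_mul, H.d_u', reassoc (H.d_u' _), reassoc (B.b_u' _),
            reassoc (B.b_wu' _), reassoc (S.m_u' _), snocOp_def, reassoc (S.m_wu' _), mul_one,
            Nat.zero_add, mul_assoc, swap, swap_mul, swap', swap_mul', Nat.reduceAdd, Nat.reduceSub]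
  rw [← sub_eq_zero]
  refine H.eq_zero_of_eq_snocOp ?_
  conv_lhs => rw [h, ← H.u_e_add_snocOp_d]
  rw [map_sub, map_one, sub_mul, mul_sub, one_mul]
  abel

theorem s_wu : sh w 0 s * sh w 1 u = 1 := by
  have h : sh w 0 s * sh w 1 u = sh w 0 u * sh w 0 e +
      sh w 0 (snocOp c q) * (sh w 1 (sh w 0 s * sh w 1 u) * sh w 0 d) := by
    calc _ = (sh w 0 u * (sh w 0 e * sh w 0 e) +
          sh w 0 c * (sh w 0 m * (sh w 2 s * sh w 0 (comulOp w d b)))) * sh w 1 u := by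
          rw [← S.s_eq]
      _ = _ := by
          simp (disch := norm_num) only [map_mul, sh_sh, sh_comulOp, add_mul, mul_add, H.e_u',
            reassoc (H.e_u' _), one_mul, H.d_u', reassoc (H.d_u' _), reassoc (B.b_u' _),
            reassoc (B.b_wu' _), reassoc (S.m_u' _), snocOp_def, reassoc (S.m_wu' _), mul_one,
            Nat.zero_add, mul_assoc, swap, swap_mul, swap', swap_mul', Nat.reduceAdd, Nat.reduceSub]
  rw [← sub_eq_zero]
  refine H.eq_zero_of_eq_snocOp ?_
  conv_lhs => rw [h, ← H.u_e_add_snocOp_d]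
  rw [map_sub, map_one, sub_mul, mul_sub, one_mul]
  abel

theorem s_u' (k : ℕ) : sh w k s * sh w k u = 1 := by
  simpa only [map_mul, map_one, sh_sh, Nat.add_zero] using congrArg (sh w k) (S.s_u H B)

theorem s_wu' (k : ℕ) : sh w k s * sh w (k + 1) u = 1 := by
  simpa only [map_mul, map_one, sh_sh, Nat.add_zero] using congrArg (sh w k) (S.s_wu H B)

/-- The product is a morphism of coalgebras: by coassociativity both sides solve the same fixed point
equation. -/
theorem d_s : sh w 0 d * sh w 0 s = sh w 0 s * (sh w 2 s * sh w 0 (comulOp w d b)) := by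
  have hs : sh w 0 s = sh w 0 u * (sh w 0 e * sh w 0 e) + sh w 0 (snocOp c q) *
      (sh w 0 m * (sh w 2 s * sh w 0 (comulOp w d b))) := by
    rw [reassoc S.c_m.symm, mul_assoc]
    exact S.s_eq
  have hX : sh w 0 d * sh w 0 s = sh w 0 u * sh w 0 s + sh w 0 c *
      (sh w 0 m * (sh w 2 (sh w 0 d * sh w 0 s) * sh w 0 (comulOp w d b))) := by
    calc _ = sh w 0 d * (sh w 0 u * (sh w 0 e * sh w 0 e) + sh w 0 (snocOp c q) *
          (sh w 0 m * (sh w 2 s * sh w 0 (comulOp w d b)))) := by rw [← hs]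
      _ = sh w 0 u * (sh w 0 u * (sh w 0 e * sh w 0 e) + sh w 0 (snocOp c q) *
          (sh w 0 m * (sh w 2 s * sh w 0 (comulOp w d b)))) + sh w 0 (snocOp c q) *
          (sh w 0 m * (sh w 2 d * (sh w 2 s * sh w 0 (comulOp w d b)))) := by
          rw [mul_add, reassoc (H.d_u' 0), mul_assoc, reassoc H.d_snocOp, add_mul, mul_assoc,
            mul_assoc, MulRel.m_far d, mul_add]
          abel
      _ = _ := by
          rw [← hs, map_mul, sh_sh, sh_sh, reassoc S.c_m]
          simp only [mul_assoc, Nat.add_zero]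
  have hY : sh w 0 s * (sh w 2 s * sh w 0 (comulOp w d b)) = sh w 0 u * sh w 0 s + sh w 0 c *
      (sh w 0 m * (sh w 2 (sh w 0 s * (sh w 2 s * sh w 0 (comulOp w d b))) *
        sh w 0 (comulOp w d b))) := by
    have hd : sh w 0 (comulOp w d b) * (sh w 2 s * sh w 0 (comulOp w d b)) =
        sh w 4 s * (sh w 2 (comulOp w d b) * sh w 0 (comulOp w d b)) := by
      rw [B.comul_coassoc H]
      simp (disch := norm_num) only [sh_comulOp, mul_assoc, swap, swap_mul, swap', swap_mul',
        Nat.reduceAdd, Nat.reduceSub]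
    calc _ = (sh w 0 u * (sh w 0 e * sh w 0 e) + sh w 0 c *
          (sh w 0 m * (sh w 2 s * sh w 0 (comulOp w d b)))) *
          (sh w 2 s * sh w 0 (comulOp w d b)) := by
          rw [← S.s_eq]
      _ = _ := by
          rw [add_mul]
          congr 1
          · have he : ∀ z, sh w 0 e * (sh w 0 e * (sh w 2 s * z)) =
                sh w 0 s * (sh w 0 e * (sh w 0 e * z)) := fun z => by
              simp (disch := norm_num) only [mul_assoc, swap, swap_mul, swap', swap_mul',
                Nat.reduceAdd, Nat.reduceSub]
            rw [mul_assoc, mul_assoc, he, B.comul_counit H, mul_one]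
          · simp only [mul_assoc, hd, map_mul, sh_sh, Nat.reduceAdd, Nat.add_zero]
  rw [← sub_eq_zero]
  refine B.eq_zero_of_eq_comul H (y := sh w 0 c) (S.m_q_zero H) ?_
  conv_lhs => rw [hX, hY]
  rw [map_sub, sub_mul, mul_sub, mul_sub]
  abel

/-- The braiding is natural with respect to the product: both sides solve the fixed point equation in
which the tensor square is moved past the strand. -/
theorem b_ws : sh w 0 b * sh w 1 s = sh w 0 s * (sh w 1 b * sh w 0 b) := by
  have hX : sh w 0 b * sh w 1 s = sh w 0 u * (sh w 1 e * sh w 1 e) + sh w 0 c * (sh w 0 m *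
      (sh w 2 (sh w 0 b * sh w 1 s) * (sh w 1 b * (sh w 0 b * sh w 1 (comulOp w d b))))) := by
    have hb : sh w 1 b * (sh w 0 b * (sh w 3 s * sh w 1 (comulOp w d b))) =
        sh w 3 s * (sh w 1 b * (sh w 0 b * sh w 1 (comulOp w d b))) := by
      rw [BraidRel.cross_far (k := 0) (by norm_num), BraidRel.cross_far (k := 1) (j := 3) (by norm_num)]
    conv_lhs => rw [S.s_eq' 1, mul_add, reassoc (B.b_wu' 0), reassoc (B.b_wc' H 0), mul_assoc,
      mul_assoc, reassoc (S.b_wm' 0), mul_assoc, mul_assoc, ← MulRel.m_far, hb]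
    simp only [mul_assoc, map_mul, sh_sh, Nat.reduceAdd, Nat.add_zero]
  have hY : sh w 0 s * (sh w 1 b * sh w 0 b) = sh w 0 u * (sh w 1 e * sh w 1 e) + sh w 0 c *
      (sh w 0 m * (sh w 2 (sh w 0 s * (sh w 1 b * sh w 0 b)) *
        (sh w 1 b * (sh w 0 b * sh w 1 (comulOp w d b))))) := by
    have he : sh w 0 e * (sh w 0 e * (sh w 1 b * sh w 0 b)) = sh w 1 e * sh w 1 e := by
      simp (disch := norm_num) only [reassoc (B.e_b' H _), B.e_b' H, mul_assoc, swap, swap_mul,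
        swap', swap_mul', Nat.reduceAdd, Nat.reduceSub]
    conv_lhs => rw [S.s_eq, add_mul, mul_assoc, mul_assoc, he, mul_assoc, mul_assoc, mul_assoc,
      B.comul_braid H]
    simp only [mul_assoc, map_mul, sh_sh, Nat.reduceAdd, Nat.add_zero]
  rw [← sub_eq_zero]
  refine B.eq_zero_of_eq_braid_comul H (y := sh w 0 c) (S.m_q_zero H) ?_
  conv_lhs => rw [hX, hY]
  rw [map_sub, sub_mul, mul_sub, mul_sub]
  abel

theorem b_s : sh w 0 b * sh w 0 s = sh w 1 s * (sh w 0 b * sh w 1 b) := by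
  have hX : sh w 0 b * sh w 0 s = sh w 1 u * (sh w 0 e * sh w 0 e) + sh w 1 c *
      ((sh w 1 m * (sh w 0 b * sh w 1 b)) *
        (sh w 2 (sh w 0 b * sh w 0 s) * sh w 0 (comulOp w d b))) := by
    conv_lhs => rw [S.s_eq, mul_add, reassoc (B.b_u' 0), reassoc (B.b_c' H 0), mul_assoc,
      mul_assoc, ← MulRel.m_far b, reassoc (S.b_m' 0)]
    simp only [mul_assoc, map_mul, sh_sh, Nat.reduceAdd, Nat.add_zero]
  have hY : sh w 1 s * (sh w 0 b * sh w 1 b) = sh w 1 u * (sh w 0 e * sh w 0 e) + sh w 1 c *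
      ((sh w 1 m * (sh w 0 b * sh w 1 b)) *
        (sh w 2 (sh w 1 s * (sh w 0 b * sh w 1 b)) * sh w 0 (comulOp w d b))) := by
    have he : sh w 1 e * (sh w 1 e * (sh w 0 b * sh w 1 b)) = sh w 0 e * sh w 0 e := by
      simp (disch := norm_num) only [reassoc (B.we_b' H _), B.we_b' H, mul_assoc, swap, swap_mul,
        swap', swap_mul', Nat.reduceAdd, Nat.reduceSub]
    have hb : ∀ z, sh w 3 s * (sh w 0 b * (sh w 1 b * z)) = sh w 0 b * (sh w 1 b * (sh w 3 s * z)) :=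
      fun z => by
        rw [BraidRel.cross_far (b := b) (k := 1) (j := 3) (by norm_num),
          BraidRel.cross_far (b := b) (k := 0) (j := 3) (by norm_num)]
    conv_lhs => rw [S.s_eq' 1, add_mul, mul_assoc, mul_assoc, he, mul_assoc, mul_assoc, mul_assoc,
      B.braid_comul H, hb]
    simp only [mul_assoc, map_mul, sh_sh, Nat.reduceAdd, Nat.add_zero]
  rw [← sub_eq_zero]
  refine B.eq_zero_of_eq_comul H (y := sh w 1 c) (F := sh w 1 m * (sh w 0 b * sh w 1 b)) ?_ ?_
  · have h0 : sh w 1 m * (sh w 2 (q 0) * sh w 1 (q 0)) = 0 := by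
      simpa only [map_mul, map_zero, sh_sh, Nat.reduceAdd, Nat.add_zero]
        using congrArg (sh w 1) (S.m_q_zero H)
    have h1 : sh w 0 b * sh w 2 (q 0) = sh w 2 (q 0) * sh w 0 b := by rw [far (by norm_num)]
    have h2 : sh w 1 b * sh w 0 (q 0) = sh w 0 (q 0) * sh w 1 b := by
      rw [far (x := q 0) (by norm_num)]
    rw [mul_assoc, mul_assoc, reassoc (B.b_q' 0 1), mul_assoc, h2, reassoc h1, mul_assoc,
      reassoc (B.b_q' 0 0), mul_assoc]
    simpa only [mul_assoc, zero_mul] using congrArg (· * (sh w 0 b * sh w 1 b)) h0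
  · conv_lhs => rw [hX, hY]
    rw [map_sub, sub_mul, mul_sub, mul_sub]
    abel

end StarRel

/-! ### The product from its homogeneous data, uniqueness and associativity -/

theorem far_mul {x : R} {a b r : ℕ} [Letter w x a b r] {i j j' : ℕ} (h : i + a ≤ j)
    (hj : j' + a = j + b) (y z : R) :
    sh w i x * (sh w j y * z) = sh w j' y * (sh w i x * z) := by
  rw [reassoc (far h y), show j - a + b = j' by omega, mul_assoc]

/-- Two operations on the tensor cube agree if they agree on units and in positive degrees. -/
theorem TensorRel.cube_ext (H : TensorRel w u c e d q) {X Y : R}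
    (h2 : X * sh w 2 u = Y * sh w 2 u) (h1 : X * sh w 1 u = Y * sh w 1 u)
    (h0 : X * sh w 0 u = Y * sh w 0 u)
    (h : ∀ i j k, 1 ≤ i → 1 ≤ j → 1 ≤ k → X * (sh w 2 (q i) * (sh w 1 (q j) * sh w 0 (q k))) =
      Y * (sh w 2 (q i) * (sh w 1 (q j) * sh w 0 (q k)))) : X = Y := by
  refine H.faithful' 2 fun i => H.faithful' 1 fun j => H.faithful' 0 fun k => ?_
  simp only [mul_assoc]
  rcases Nat.eq_zero_or_pos i with rfl | hi
  · rw [H.q_zero' 2, mul_assoc, reassoc h2, mul_assoc]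
  rcases Nat.eq_zero_or_pos j with rfl | hj
  · have h3 : sh w 2 (q i) * (sh w 1 u * (sh w 1 e * sh w 0 (q k))) =
        sh w 1 u * (sh w 1 (q i) * (sh w 1 e * sh w 0 (q k))) :=
      (far_mul (by norm_num) (by norm_num) _ _).symm
    rw [H.q_zero' 1, mul_assoc, h3, reassoc h1, mul_assoc]
  rcases Nat.eq_zero_or_pos k with rfl | hk
  · have h3 : sh w 2 (q i) * (sh w 1 (q j) * (sh w 0 u * sh w 0 e)) =
        sh w 0 u * (sh w 1 (q i) * (sh w 0 (q j) * sh w 0 e)) := by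
      simp (disch := norm_num) only [mul_assoc, swap, swap_mul, swap', swap_mul', Nat.reduceAdd,
        Nat.reduceSub]
    rw [H.q_zero' 0, h3, reassoc h0, mul_assoc]
  exact h i j k hi hj hk

namespace MulRel

/-- The braid relation of `m` follows from its positive degree part. On the right of the hypothesis
the two factors of `m` are multiplied, braided as one strand and cut again, as in the definition of a
quantum `B_∞`-algebra. -/
theorem b_wm_of_pos (H : TensorRel w u c e d q) (B : BraidRel w u c b q)
    (hu : sh w 0 m * sh w 0 u = sh w 0 (q 1)) (hwu : sh w 0 m * sh w 1 u = sh w 0 (q 1))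
    (h : ∀ i j k, 1 ≤ i → 1 ≤ j → 1 ≤ k →
      sh w 0 b * (sh w 1 m * (sh w 2 (q i) * (sh w 1 (q j) * sh w 0 (q k)))) =
        sh w 0 m * (sh w 1 (q i) * (sh w 0 (q j) * (sh w 0 d * (sh w 0 b * (sh w 1 c *
          (sh w 2 (q i) * (sh w 1 (q j) * sh w 0 (q k))))))))) :
    sh w 0 b * sh w 1 m = sh w 0 m * (sh w 1 b * sh w 0 b) := by
  have hu' : sh w 1 m * sh w 1 u = sh w 1 (q 1) := by
    simpa only [map_mul, sh_sh, Nat.add_zero] using congrArg (sh w 1) hu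
  have hwu' : sh w 1 m * sh w 2 u = sh w 1 (q 1) := by
    simpa only [map_mul, sh_sh, Nat.reduceAdd, Nat.add_zero] using congrArg (sh w 1) hwu
  refine H.cube_ext ?_ ?_ ?_ fun i j k hi hj hk => ?_
  · simp (disch := norm_num) only [hwu', reassoc hwu, B.b_wq' 1 0, reassoc (B.b_wu' _), mul_assoc,
      swap, swap_mul, swap', swap_mul', Nat.reduceAdd, Nat.reduceSub]
  · simp (disch := norm_num) only [hu', reassoc hu, B.b_wq' 1 0, reassoc (B.b_wu' _), B.b_wu',
      mul_assoc, swap, swap_mul, swap', swap_mul', Nat.reduceAdd, Nat.reduceSub]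
  · simp (disch := norm_num) only [B.b_u', reassoc (B.b_u' _), mul_assoc, swap, swap_mul, swap',
      swap_mul', Nat.reduceAdd, Nat.reduceSub]
  · have h1 : sh w 1 b * (sh w 0 b * (sh w 2 (q i) * (sh w 1 (q j) * sh w 0 (q k)))) =
        sh w 1 (q i) * (sh w 0 (q j) * (sh w 2 (q k) * (sh w 1 b * sh w 0 b))) := by
      simp (disch := norm_num) only [reassoc (B.b_q' _ _), B.b_q', reassoc (B.b_wq' _ _), B.b_wq',
        mul_assoc, swap, swap_mul, swap', swap_mul', Nat.reduceAdd, Nat.reduceSub]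
    have h2 := fun z => congrArg (· * z) (H.qq_d_c_qq i j)
    simp only [mul_assoc] at h2 ⊢
    rw [h i j k hi hj hk, reassoc (B.b_wc' H 0)]
    simp only [mul_assoc, Nat.zero_add]
    rw [h1, h2]

theorem b_m_of_pos (H : TensorRel w u c e d q) (B : BraidRel w u c b q)
    (hu : sh w 0 m * sh w 0 u = sh w 0 (q 1)) (hwu : sh w 0 m * sh w 1 u = sh w 0 (q 1))
    (h : ∀ i j k, 1 ≤ i → 1 ≤ j → 1 ≤ k →
      sh w 0 b * (sh w 0 m * (sh w 2 (q i) * (sh w 1 (q j) * sh w 0 (q k)))) =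
        sh w 1 m * (sh w 2 (q j) * (sh w 1 (q k) * (sh w 1 d * (sh w 0 b * (sh w 0 c *
          (sh w 2 (q i) * (sh w 1 (q j) * sh w 0 (q k))))))))) :
    sh w 0 b * sh w 0 m = sh w 1 m * (sh w 0 b * sh w 1 b) := by
  have hu' : sh w 1 m * sh w 1 u = sh w 1 (q 1) := by
    simpa only [map_mul, sh_sh, Nat.add_zero] using congrArg (sh w 1) hu
  have hwu' : sh w 1 m * sh w 2 u = sh w 1 (q 1) := by
    simpa only [map_mul, sh_sh, Nat.reduceAdd, Nat.add_zero] using congrArg (sh w 1) hwu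
  refine H.cube_ext ?_ ?_ ?_ fun i j k hi hj hk => ?_
  · simp (disch := norm_num) only [B.b_wu', reassoc (B.b_wu' _), mul_assoc, swap, swap_mul, swap',
      swap_mul', Nat.reduceAdd, Nat.reduceSub]
  · simp (disch := norm_num) only [hwu, reassoc hwu', B.b_q' 1 0, reassoc (B.b_u' _), B.b_u',
      mul_assoc, swap, swap_mul, swap', swap_mul', Nat.reduceAdd, Nat.reduceSub]
  · simp (disch := norm_num) only [hu, reassoc hu', B.b_q' 1 0, reassoc (B.b_u' _), B.b_u',
      mul_assoc, swap, swap_mul, swap', swap_mul', Nat.reduceAdd, Nat.reduceSub]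
  · have h1 : sh w 0 b * (sh w 1 b * (sh w 2 (q i) * (sh w 1 (q j) * sh w 0 (q k)))) =
        sh w 2 (q j) * (sh w 1 (q k) * (sh w 0 (q i) * (sh w 0 b * sh w 1 b))) := by
      have h3 : sh w 1 b * sh w 0 (q k) = sh w 0 (q k) * sh w 1 b := by
        rw [far (x := q k) (by norm_num)]
      simp (disch := norm_num) only [reassoc (B.b_q' _ _), B.b_q', reassoc (B.b_wq' _ _), B.b_wq',
        mul_assoc, swap, swap_mul, swap', swap_mul', Nat.reduceAdd, Nat.reduceSub]
      rw [h3, reassoc (B.b_q' k 0), mul_assoc,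
        far_mul (x := q i) (i := 0) (j := 0 + 1) (j' := 1) (by norm_num) (by norm_num)]
    have h2 := fun z => congrArg (· * z) (congrArg (sh w 1) (H.qq_d_c_qq j k))
    simp only [mul_assoc, map_mul, sh_sh, Nat.reduceAdd, Nat.add_zero] at h2 ⊢
    rw [h i j k hi hj hk, reassoc (B.b_c' H 0)]
    simp only [mul_assoc, Nat.zero_add]
    rw [h1, h2]

variable (H : TensorRel w u c e d q) (B : BraidRel w u c b q) (P : MulRel w u b m q)
include H P

theorem m_units : sh w 0 m * (sh w 0 u * sh w 0 u) = 0 := by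
  rw [reassoc P.m_u, H.q_one_u]

include B

/-- In the iterates defining the product, the reduced coproduct may be replaced by the coproduct. -/
theorem iterate_eq {N N' : R} (hN : sh w 0 N * (sh w 0 u * sh w 0 u) = 0)
    (h : N' = sh w 0 c * (sh w 0 m * (sh w 2 N * (sh w 0 (comulOp w d b) - sh w 0 u * sh w 0 u -
      sh w 2 u * sh w 2 u)))) :
    N' = sh w 0 c * (sh w 0 m * (sh w 2 N * sh w 0 (comulOp w d b))) ∧
      N' * (sh w 0 u * sh w 0 u) = 0 := by
  have h1 : sh w 2 N * (sh w 2 u * sh w 2 u) = 0 := by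
    simpa only [map_mul, map_zero, sh_sh, Nat.add_zero] using congrArg (sh w 2) hN
  have h2 : sh w 2 N * (sh w 0 u * sh w 0 u) = sh w 0 u * (sh w 0 u * sh w 0 N) := by
    rw [← far_mul (x := u) (j := 1) (by norm_num) (by norm_num),
      far (x := u) (i := 0) (j := 0) (by norm_num)]
  have h3 : sh w 0 (comulOp w d b) * (sh w 0 u * sh w 0 u) =
      sh w 2 u * (sh w 2 u * (sh w 0 u * sh w 0 u)) := by
    simp (disch := norm_num) only [sh_comulOp, H.d_u', reassoc (H.d_u' _), B.b_u',
      reassoc (B.b_u' _), reassoc (B.b_wu' _), Nat.zero_add, mul_assoc, swap, swap_mul, swap',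
      swap_mul', Nat.reduceAdd, Nat.reduceSub]
  -- The term `x ⊗ (1 ⊗ 1)` does not contribute since `m` kills `1 ⊗ 1`, and `(1 ⊗ 1) ⊗ x` does not
  -- since `N` does.
  have h4 : N' = sh w 0 c * (sh w 0 m * (sh w 2 N * sh w 0 (comulOp w d b))) := by
    have h5 := congrArg (· * sh w 0 N) (P.m_units H)
    simp only [mul_assoc, zero_mul] at h5
    rw [h]
    simp only [mul_sub, h1, h2, h5, sub_zero, mul_zero]
  refine ⟨h4, ?_⟩
  rw [h4, mul_assoc, mul_assoc, mul_assoc, h3, ← mul_assoc (sh w 2 u), reassoc h1, zero_mul,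
    mul_zero, mul_zero]

/-- The `n`-th iterate vanishes in degrees at most `n`. -/
theorem iterate_mul_grading {N : ℕ → R} (h0 : N 0 = sh w 0 m)
    (hs : ∀ n, N (n + 1) = sh w 0 c * (sh w 0 m * (sh w 2 (N n) * sh w 0 (comulOp w d b))))
    (n : ℕ) (a : ℕ × ℕ) (ha : a.1 + a.2 ≤ n) : N n * (sh w 1 (q a.1) * sh w 0 (q a.2)) = 0 := by
  induction n generalizing a with
  | zero =>
    obtain ⟨i, j⟩ := a
    obtain rfl : i = 0 := by simp at ha; omega
    obtain rfl : j = 0 := by simp at ha; omega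
    rw [h0, P.m_q_zero H]
  | succ n ih =>
    rw [hs, mul_assoc, mul_assoc, mul_assoc, B.comul_grading H, Finset.mul_sum, Finset.mul_sum,
      Finset.mul_sum]
    refine Finset.sum_eq_zero fun t ht => ?_
    obtain ⟨⟨i₁, i₂⟩, ⟨j₁, j₂⟩⟩ := t
    simp at ht
    -- Either the part fed into the previous iterate has degree at most `n`, or nothing is left for `m`.
    rcases Nat.lt_or_ge n (i₁ + j₁) with hn | hn
    · obtain rfl : i₂ = 0 := by omega
      obtain rfl : j₂ = 0 := by omega
      have h1 : ∀ X Y z : R, sh w 2 X * (sh w 2 Y * ((sh w 1 (q 0) * sh w 0 (q 0)) * z)) =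
          (sh w 1 (q 0) * sh w 0 (q 0)) * (sh w 2 X * (sh w 2 Y * z)) := by
        intro X Y z
        have h2 : ∀ X z : R, sh w 2 X * ((sh w 1 (q 0) * sh w 0 (q 0)) * z) =
            (sh w 1 (q 0) * sh w 0 (q 0)) * (sh w 2 X * z) := by
          intro X z
          rw [mul_assoc, mul_assoc, far_mul (x := q 0) (i := 0) (j := 2) (j' := 2),
            far_mul (x := q 0) (i := 1) (j := 2) (j' := 2)] <;> norm_num
        rw [h2, h2]
      rw [h1, reassoc (P.m_q_zero H), zero_mul, mul_zero]
    · rw [← mul_assoc (sh w 2 (N n)), ← map_mul, ih (i₁, j₁) hn, map_zero, zero_mul, mul_zero,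
        mul_zero]

/-- The sum of the iterates satisfies the fixed point equation of the product: applying the equation
shifts the iterates by one, and its constant term gives the first of them. -/
theorem s_eq_of_iterate {N : ℕ → R} (h0 : N 0 = sh w 0 m)
    (hs : ∀ n, N (n + 1) = sh w 0 c * (sh w 0 m * (sh w 2 (N n) * sh w 0 (comulOp w d b))))
    (h : ∀ i j, sh w 0 s * (sh w 1 (q i) * sh w 0 (q j)) =
      (sh w 0 u * (sh w 0 e * sh w 0 e) + ∑ n ∈ Finset.range (i + j), N n) *
        (sh w 1 (q i) * sh w 0 (q j))) :
    sh w 0 s = sh w 0 u * (sh w 0 e * sh w 0 e) +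
      sh w 0 c * (sh w 0 m * (sh w 2 s * sh w 0 (comulOp w d b))) := by
  have hN : ∀ (k : ℕ) (a : ℕ × ℕ), a.1 + a.2 ≤ k → sh w 0 s * (sh w 1 (q a.1) * sh w 0 (q a.2)) =
      (sh w 0 u * (sh w 0 e * sh w 0 e) + ∑ n ∈ Finset.range k, N n) *
        (sh w 1 (q a.1) * sh w 0 (q a.2)) := by
    intro k a ha
    induction k, ha using Nat.le_induction with
    | base => exact h _ _
    | succ k hk ih =>
      rw [Finset.sum_range_succ, ← add_assoc, add_mul, P.iterate_mul_grading H B h0 hs k a hk,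
        add_zero, ih]
  have hfirst : sh w 0 c * (sh w 0 m * (sh w 2 (sh w 0 u * (sh w 0 e * sh w 0 e)) *
      sh w 0 (comulOp w d b))) = sh w 0 m := by
    simp only [map_mul, sh_sh, Nat.add_zero, mul_assoc]
    rw [B.counit_comul H, mul_one, far (by norm_num), reassoc (H.c_wu' 0), one_mul]
  refine H.faithful' 1 fun i => H.faithful' 0 fun j => ?_
  rw [mul_assoc, mul_assoc]
  -- In degrees `(i, j)` the right hand side only sees `s` in total degrees up to `i + j`.
  have key : sh w 0 c * (sh w 0 m * (sh w 2 s * sh w 0 (comulOp w d b))) *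
      (sh w 1 (q i) * sh w 0 (q j)) = (∑ n ∈ Finset.range (i + j + 1), N n) *
        (sh w 1 (q i) * sh w 0 (q j)) := by
    calc _ = sh w 0 c * (sh w 0 m * (sh w 2 (sh w 0 u * (sh w 0 e * sh w 0 e) +
          ∑ n ∈ Finset.range (i + j), N n) * sh w 0 (comulOp w d b))) *
          (sh w 1 (q i) * sh w 0 (q j)) := by
          simp only [mul_assoc]
          rw [B.comul_grading H (i, j)]
          congr 2
          rw [Finset.mul_sum, Finset.mul_sum]
          refine Finset.sum_congr rfl fun t ht => ?_
          obtain ⟨⟨i₁, i₂⟩, ⟨j₁, j₂⟩⟩ := t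
          have ht' : i₁ + j₁ ≤ i + j := by
            simp at ht ⊢
            omega
          have h6 := congrArg (sh w 2) (hN (i + j) (i₁, j₁) ht')
          rw [map_mul (sh w 2) (sh w 0 s), map_mul (sh w 2) (_ + _), sh_sh, Nat.add_zero] at h6
          dsimp only at h6 ⊢
          rw [reassoc h6]
          simp only [mul_assoc]
      _ = _ := by
          rw [map_add, add_mul, mul_add, mul_add, hfirst, Finset.sum_range_succ', h0]
          simp only [hs, map_sum, Finset.sum_mul, Finset.mul_sum]
          rw [add_comm]
  rw [add_mul, key, Finset.sum_range_succ, add_mul, P.iterate_mul_grading H B h0 hs _ (i, j) le_rfl,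
    add_zero, ← add_mul, h]

end MulRel

namespace StarRel

variable (H : TensorRel w u c e d q) (B : BraidRel w u c b q) (S : StarRel w u c e d b m s q)
include S H B

/-- The product is determined by being a coalgebra morphism with the given primitive part. -/
theorem eq_of_coalg {f : R} (he : sh w 0 e * sh w 0 f = sh w 0 e * sh w 0 e)
    (hd : sh w 0 d * sh w 0 f = sh w 0 f * (sh w 2 f * sh w 0 (comulOp w d b)))
    (hq : sh w 0 (q 1) * sh w 0 f = sh w 0 m) : sh w 0 f = sh w 0 s := by
  have h : sh w 0 f = sh w 0 u * (sh w 0 e * sh w 0 e) +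
      sh w 0 c * (sh w 0 m * (sh w 2 f * sh w 0 (comulOp w d b))) := by
    calc sh w 0 f = (sh w 0 u * sh w 0 e + sh w 0 (snocOp c q) * sh w 0 d) * sh w 0 f := by
          rw [H.u_e_add_snocOp_d, one_mul]
      _ = _ := by rw [add_mul, mul_assoc, mul_assoc, he, hd, snocOp_def, mul_assoc, reassoc hq]
  rw [← sub_eq_zero, ← map_sub]
  refine B.eq_zero_of_eq_comul H (y := sh w 0 c) (S.m_q_zero H) ?_
  conv_lhs => rw [map_sub, h, S.s_eq]
  simp only [map_sub, sub_mul, mul_sub, sh_sh, Nat.add_zero]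
  abel

theorem d_s' (k : ℕ) : sh w k d * sh w k s =
    sh w k s * (sh w (k + 2) s * sh w k (comulOp w d b)) := by
  simpa only [map_mul, sh_sh, Nat.add_zero] using congrArg (sh w k) (S.d_s H B)

theorem b_ws' (k : ℕ) : sh w k b * sh w (k + 1) s = sh w k s * (sh w (k + 1) b * sh w k b) := by
  simpa only [map_mul, sh_sh, Nat.add_zero] using congrArg (sh w k) (S.b_ws H B)

theorem b_s' (k : ℕ) : sh w k b * sh w k s = sh w (k + 1) s * (sh w k b * sh w (k + 1) b) := by
  simpa only [map_mul, sh_sh, Nat.add_zero] using congrArg (sh w k) (S.b_s H B)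

/-- The associativity condition on `m` extends from positive degrees to units. -/
theorem m_s_s (h : ∀ i j k, 1 ≤ i → 1 ≤ j → 1 ≤ k →
    sh w 0 m * (sh w 1 s * (sh w 2 (q i) * (sh w 1 (q j) * sh w 0 (q k)))) =
      sh w 0 m * (sh w 0 s * (sh w 2 (q i) * (sh w 1 (q j) * sh w 0 (q k))))) :
    sh w 0 m * sh w 1 s = sh w 0 m * sh w 0 s := by
  refine H.cube_ext ?_ ?_ ?_ fun i j k hi hj hk => ?_
  · rw [mul_assoc, mul_assoc, S.s_wu' H B 1, far (by norm_num), reassoc S.m_wu, S.q_s H B, mul_one]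
  · rw [mul_assoc, mul_assoc, S.s_u' H B 1, S.s_wu' H B 0]
  · have h1 : sh w 1 s * sh w 0 u = sh w 0 u * sh w 0 s := by rw [far (x := u) (by norm_num)]
    rw [mul_assoc, mul_assoc, h1, S.s_u' H B 0, reassoc S.m_u, S.q_s H B, mul_one]
  · rw [mul_assoc, mul_assoc, h i j k hi hj hk]

/-- The product is associative if the given operation is: both bracketings solve a fixed point
equation on the tensor cube, and the two equations agree by the hypothesis. -/
theorem s_s (h : sh w 0 m * sh w 1 s = sh w 0 m * sh w 0 s) :
    sh w 0 s * sh w 1 s = sh w 0 s * sh w 0 s := by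
  have hX : sh w 0 s * sh w 1 s = sh w 0 u * (sh w 0 e * (sh w 0 e * sh w 0 e)) +
      sh w 0 c * ((sh w 0 m * sh w 0 s) * (sh w 3 (sh w 0 s * sh w 1 s) *
        (sh w 2 b * (sh w 1 b * (sh w 2 (comulOp w d b) * sh w 0 d))))) := by
    have he : sh w 0 e * (sh w 0 e * sh w 1 s) = sh w 0 e * (sh w 0 e * sh w 0 e) := by
      rw [far (x := e) (by norm_num)]
      exact (reassoc (S.e_s H) _).trans (mul_assoc _ _ _)
    have h1 : sh w 0 d * sh w 1 s = sh w 2 s * sh w 0 d := by rw [far (by norm_num)]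
    have h2 : sh w 1 b * (sh w 2 s * (sh w 4 s * (sh w 2 (comulOp w d b) * sh w 0 d))) =
        sh w 1 s * (sh w 4 s *
          (sh w 2 b * (sh w 1 b * (sh w 2 (comulOp w d b) * sh w 0 d)))) := by
      rw [reassoc (S.b_ws' H B 1), mul_assoc, mul_assoc,
        BraidRel.cross_far (b := b) (k := 1) (j := 4) (by norm_num),
        BraidRel.cross_far (b := b) (k := 1 + 1) (j := 4) (by norm_num)]
    have h3 : ∀ z, sh w 2 s * (sh w 1 s * z) = sh w 1 s * (sh w 3 s * z) := fun z => by
      rw [swap_mul (i := 1) (j := 3) (by norm_num) (by norm_num)]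
    have h4 : sh w 0 (comulOp w d b) * sh w 1 s = sh w 1 s * (sh w 4 s *
          (sh w 2 b * (sh w 1 b * (sh w 2 (comulOp w d b) * sh w 0 d)))) := by
      rw [sh_comulOp, mul_assoc, mul_assoc, h1, reassoc (S.d_s' H B 2), ← h2]
      simp only [mul_assoc, Nat.zero_add, Nat.reduceAdd]
    rw [← h]
    conv_lhs => rw [S.s_eq, add_mul, mul_assoc, mul_assoc, he, mul_assoc, mul_assoc, mul_assoc,
      h4, h3]
    simp only [mul_assoc, map_mul, sh_sh, Nat.reduceAdd, Nat.add_zero]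
  have hY : sh w 0 s * sh w 0 s = sh w 0 u * (sh w 0 e * (sh w 0 e * sh w 0 e)) +
      sh w 0 c * ((sh w 0 m * sh w 0 s) * (sh w 3 (sh w 0 s * sh w 0 s) *
        (sh w 2 b * (sh w 1 b * (sh w 2 (comulOp w d b) * sh w 0 d))))) := by
    have h1 : sh w 2 d * (sh w 0 s * (sh w 2 s * sh w 0 (comulOp w d b))) =
        sh w 0 s * (sh w 2 s * (sh w 4 d * sh w 0 (comulOp w d b))) := by
      rw [← far_mul (x := s) (j := 3) (by norm_num) (by norm_num),
        ← far_mul (x := s) (i := 2) (j := 4) (by norm_num) (by norm_num)]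
    have h2 : ∀ z, sh w 1 b * (sh w 0 s * (sh w 2 s * z)) =
        sh w 0 s * (sh w 3 s * (sh w 2 b * (sh w 3 b * z))) := fun z => by
      rw [← far_mul (x := s) (i := 0) (j := 2) (by norm_num) (by norm_num), reassoc (S.b_s' H B 2)]
      simp only [mul_assoc, Nat.reduceAdd]
    have h3 : sh w 3 b * (sh w 4 d * sh w 0 (comulOp w d b)) =
        sh w 1 b * (sh w 2 (comulOp w d b) * sh w 0 d) := by
      rw [sh_comulOp, sh_comulOp, ← BraidRel.cross_far (b := b) (k := 0 + 1) (j := 4) (by norm_num),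
        ← BraidRel.cross_far (b := b) (k := 0 + 1) (j := 3) (by norm_num)]
      simp only [mul_assoc, Nat.zero_add, Nat.reduceAdd]
    have h4 : sh w 0 (comulOp w d b) * sh w 0 s = sh w 0 s * (sh w 3 s *
          (sh w 2 b * (sh w 1 b * (sh w 2 (comulOp w d b) * sh w 0 d)))) := by
      rw [← h3, ← h2, ← h1, ← S.d_s H B]
      simp only [sh_comulOp, mul_assoc, Nat.zero_add]
    have h5 : ∀ z, sh w 2 s * (sh w 0 s * z) = sh w 0 s * (sh w 3 s * z) := fun z => by
      rw [swap_mul (i := 0) (j := 3) (by norm_num) (by norm_num)]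
    calc _ = (sh w 0 u * (sh w 0 e * sh w 0 e) +
          sh w 0 c * (sh w 0 m * (sh w 2 s * sh w 0 (comulOp w d b)))) * sh w 0 s := by
          rw [← S.s_eq]
      _ = _ := by
          rw [add_mul, mul_assoc, mul_assoc, S.e_s H, mul_assoc, mul_assoc, mul_assoc, h4, h5]
          simp only [mul_assoc, map_mul, sh_sh, Nat.reduceAdd, Nat.add_zero]
  rw [← sub_eq_zero]
  refine B.eq_zero_of_eq_comul₃ H (y := sh w 0 c) (F := sh w 0 m * sh w 0 s) ?_ ?_
  · have h1 : sh w 0 s * sh w 2 u = sh w 1 u * sh w 0 s := by rw [far (by norm_num)]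
    have h2 : sh w 2 e * (sh w 1 (q 0) * sh w 0 (q 0)) =
        sh w 1 (q 0) * (sh w 0 (q 0) * sh w 2 e) := by
      simp (disch := norm_num) only [mul_assoc, swap, swap_mul, swap', swap_mul', Nat.reduceAdd,
        Nat.reduceSub]
    rw [H.q_zero' 2, mul_assoc, mul_assoc, reassoc h1, mul_assoc, h2, reassoc S.m_wu,
      reassoc (S.q_s H B)]
    simpa only [mul_assoc, zero_mul] using congrArg (· * sh w 2 e) (S.m_q_zero H)
  · conv_lhs => rw [hX, hY]
    rw [map_sub, sub_mul, mul_sub, mul_sub]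
    abel

end StarRel

/-! ### The braid relations from their products -/

namespace TensorRel

variable (H : TensorRel w u c e d q)
include H

/-- In fixed degrees, an operation with two outputs is determined by their product. -/
theorem ext_of_c {i j : ℕ} {X Y : R} (hX : sh w 1 (q i) * (sh w 0 (q j) * X) = X)
    (hY : sh w 1 (q i) * (sh w 0 (q j) * Y) = Y) (h : sh w 0 c * X = sh w 0 c * Y) : X = Y := by
  have key : ∀ Z, sh w 1 (q i) * (sh w 0 (q j) * Z) = Z →
      Z = sh w 1 (q i) * (sh w 0 (q j) * (sh w 0 d * (sh w 0 c * Z))) := by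
    intro Z hZ
    have h1 := congrArg (· * Z) (H.qq_d_c_qq i j)
    simp only [mul_assoc] at h1
    rw [hZ] at h1
    exact h1.symm
  rw [key X hX, h, ← key Y hY]

theorem q_snocOp' (n k : ℕ) : sh w k (q (n + 1)) * (sh w k (snocOp c q) * sh w (k + 1) (q n)) =
    sh w k (snocOp c q) * sh w (k + 1) (q n) := by
  simpa only [map_mul, sh_sh, Nat.add_zero] using congrArg (sh w k) (H.q_snocOp n)

/- The braiding interchanges degrees, so both sides of a braid relation have the same degrees and may
be compared after multiplication. -/
variable (hwq : ∀ n, sh w 0 b * sh w 1 (q n) = sh w 0 (q n) * sh w 0 b)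
  (hq : ∀ n, sh w 0 b * sh w 0 (q n) = sh w 1 (q n) * sh w 0 b)
include hwq hq

theorem b_snocOp_of_c (h : ∀ i j, sh w 0 c * (sh w 0 b * (sh w 0 (snocOp c q) *
      (sh w 2 (q i) * sh w 1 (q j)))) = sh w 0 c * (sh w 1 (snocOp c q) * (sh w 0 b *
      (sh w 1 b * (sh w 2 (q i) * sh w 1 (q j)))))) :
    sh w 0 b * sh w 0 (snocOp c q) = sh w 1 (snocOp c q) * (sh w 0 b * sh w 1 b) := by
  have hwq1 : ∀ n, sh w 1 b * sh w 2 (q n) = sh w 1 (q n) * sh w 1 b := fun n => by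
    simpa only [map_mul, sh_sh, Nat.reduceAdd, Nat.add_zero] using congrArg (sh w 1) (hwq n)
  have hq1 : ∀ n, sh w 1 b * sh w 1 (q n) = sh w 2 (q n) * sh w 1 b := fun n => by
    simpa only [map_mul, sh_sh, Nat.reduceAdd, Nat.add_zero] using congrArg (sh w 1) (hq n)
  refine H.faithful' 2 fun i => H.faithful' 1 fun j => ?_
  simp only [mul_assoc]
  refine H.ext_of_c (i := j + 1) (j := i) ?_ ?_ (h i j)
  · have h1 : ∀ X, sh w 0 (snocOp c q) * (sh w 2 (q i) * X) =
        sh w 1 (q i) * (sh w 0 (snocOp c q) * X) := fun X =>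
      far_mul (by norm_num) (by norm_num) _ X
    rw [h1, ← H.q_snocOp j, reassoc (hwq i), mul_assoc, reassoc (hq (j + 1)), mul_assoc,
      reassoc (H.q_mul_self i)]
    have h2 : ∀ X, sh w 0 (q i) * (sh w 1 (q (j + 1)) * X) =
        sh w 1 (q (j + 1)) * (sh w 0 (q i) * X) := fun X =>
      far_mul (by norm_num) (by norm_num) _ X
    rw [h2, reassoc (H.q_mul_self' _ 1)]
  · have h1 : sh w 0 b * (sh w 1 b * (sh w 2 (q i) * sh w 1 (q j))) =
        sh w 2 (q j) * (sh w 0 (q i) * (sh w 0 b * sh w 1 b)) := by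
      have h5 : ∀ X, sh w 0 b * (sh w 2 (q j) * X) = sh w 2 (q j) * (sh w 0 b * X) := fun X =>
        far_mul (by norm_num) (by norm_num) _ X
      rw [reassoc (hwq1 i), mul_assoc, hq1, reassoc (hwq i), mul_assoc, h5]
      exact far_mul (by norm_num) (by norm_num) _ _
    have h2 : ∀ X, sh w 0 (q i) * (sh w 1 (snocOp c q) * X) =
        sh w 1 (snocOp c q) * (sh w 0 (q i) * X) := fun X =>
      far_mul (by norm_num) (by norm_num) _ X
    have h3 : ∀ X, sh w 0 (q i) * (sh w 2 (q j) * X) =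
        sh w 2 (q j) * (sh w 0 (q i) * X) := fun X =>
      far_mul (by norm_num) (by norm_num) _ X
    rw [h1, h2, h3, reassoc (H.q_mul_self i)]
    have h4 := congrArg (· * (sh w 0 (q i) * (sh w 0 b * sh w 1 b))) (H.q_snocOp' j 1)
    simpa only [mul_assoc] using h4

theorem b_wsnocOp_of_c (h : ∀ i, sh w 0 c * (sh w 0 b * (sh w 1 (snocOp c q) *
      (sh w 2 (q i) * sh w 0 (q 1)))) = sh w 0 c * (sh w 0 (snocOp c q) * (sh w 1 b *
      (sh w 0 b * (sh w 2 (q i) * sh w 0 (q 1)))))) :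
    sh w 1 (q 1) * (sh w 0 b * sh w 1 (snocOp c q)) =
      sh w 1 (q 1) * (sh w 0 (snocOp c q) * (sh w 1 b * sh w 0 b)) := by
  have hwq1 : ∀ n, sh w 1 b * sh w 2 (q n) = sh w 1 (q n) * sh w 1 b := fun n => by
    simpa only [map_mul, sh_sh, Nat.reduceAdd, Nat.add_zero] using congrArg (sh w 1) (hwq n)
  have hq1 : ∀ n, sh w 1 b * sh w 1 (q n) = sh w 2 (q n) * sh w 1 b := fun n => by
    simpa only [map_mul, sh_sh, Nat.reduceAdd, Nat.add_zero] using congrArg (sh w 1) (hq n)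
  have hX : sh w 1 (q 1) * (sh w 0 b * sh w 1 (snocOp c q)) =
      sh w 0 b * (sh w 1 (snocOp c q) * sh w 0 (q 1)) := by
    rw [reassoc (hq 1).symm, mul_assoc, far (x := q 1) (i := 0) (by norm_num)]
  have hY : sh w 1 (q 1) * (sh w 0 (snocOp c q) * (sh w 1 b * sh w 0 b)) =
      sh w 0 (snocOp c q) * (sh w 1 b * (sh w 0 b * sh w 0 (q 1))) := by
    rw [hq 1, reassoc (hq1 1), mul_assoc]
    exact (far_mul (by norm_num) (by norm_num) _ _).symm
  have hc : ∀ i, sh w 0 (q 1) * sh w 2 (q i) = sh w 2 (q i) * sh w 0 (q 1) :=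
    fun i => by rw [far (by norm_num)]
  have hd : ∀ i X, sh w 0 (q i) * (sh w 1 (q 1) * X) = sh w 1 (q 1) * (sh w 0 (q i) * X) :=
    fun i X => far_mul (by norm_num) (by norm_num) _ X
  have hbq : ∀ i, sh w 0 b * sh w 2 (q i) = sh w 2 (q i) * sh w 0 b :=
    fun i => by rw [far (by norm_num)]
  refine H.faithful' 2 fun i => ?_
  refine H.ext_of_c (i := 1) (j := i + 1) ?_ ?_ ?_
  · simp only [mul_assoc]
    rw [hd, reassoc (H.q_mul_self' 1 1), ← H.q_snocOp' i 1, reassoc (hwq _), mul_assoc,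
      reassoc (H.q_mul_self _)]
  · simp only [mul_assoc]
    have h1 := H.q_snocOp' i 0
    rw [hd, reassoc (H.q_mul_self' 1 1), hbq, reassoc (hwq1 i), mul_assoc]
    congr 1
    simpa only [mul_assoc] using congrArg (· * (sh w 1 b * sh w 0 b)) h1
  · rw [hX, hY]
    simpa only [mul_assoc, hc] using h i

theorem yang_baxter_of (h : sh w 0 b * (sh w 1 b * (sh w 0 b * (sh w 2 (q 1) * (sh w 1 (q 1) *
      sh w 0 (q 1))))) = sh w 1 b * (sh w 0 b * (sh w 1 b * (sh w 2 (q 1) * (sh w 1 (q 1) *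
      sh w 0 (q 1)))))) :
    sh w 2 (q 1) * (sh w 1 (q 1) * (sh w 0 (q 1) * (sh w 0 b * (sh w 1 b * sh w 0 b)))) =
      sh w 2 (q 1) * (sh w 1 (q 1) * (sh w 0 (q 1) * (sh w 1 b * (sh w 0 b * sh w 1 b)))) := by
  have hwq1 : ∀ n, sh w 1 b * sh w 2 (q n) = sh w 1 (q n) * sh w 1 b := fun n => by
    simpa only [map_mul, sh_sh, Nat.reduceAdd, Nat.add_zero] using congrArg (sh w 1) (hwq n)
  have hq1 : ∀ n, sh w 1 b * sh w 1 (q n) = sh w 2 (q n) * sh w 1 b := fun n => by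
    simpa only [map_mul, sh_sh, Nat.reduceAdd, Nat.add_zero] using congrArg (sh w 1) (hq n)
  have h0 : sh w 0 b * (sh w 2 (q 1) * (sh w 1 (q 1) * sh w 0 (q 1))) =
      sh w 2 (q 1) * (sh w 1 (q 1) * sh w 0 (q 1)) * sh w 0 b := by
    have h2 : ∀ X, sh w 0 b * (sh w 2 (q 1) * X) = sh w 2 (q 1) * (sh w 0 b * X) := fun X =>
      far_mul (by norm_num) (by norm_num) _ X
    have h3 : sh w 0 (q 1) * (sh w 1 (q 1) * sh w 0 b) = sh w 1 (q 1) * (sh w 0 (q 1) * sh w 0 b) :=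
      far_mul (by norm_num) (by norm_num) _ _
    rw [h2, reassoc (hwq 1), mul_assoc, hq, h3, mul_assoc, mul_assoc]
  have h1 : sh w 1 b * (sh w 2 (q 1) * (sh w 1 (q 1) * sh w 0 (q 1))) =
      sh w 2 (q 1) * (sh w 1 (q 1) * sh w 0 (q 1)) * sh w 1 b := by
    have h2 : sh w 1 b * sh w 0 (q 1) = sh w 0 (q 1) * sh w 1 b := by
      rw [far (x := q 1) (by norm_num)]
    have h3 : ∀ X, sh w 1 (q 1) * (sh w 2 (q 1) * X) = sh w 2 (q 1) * (sh w 1 (q 1) * X) :=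
      fun X => far_mul (by norm_num) (by norm_num) _ _
    rw [reassoc (hwq1 1), mul_assoc, reassoc (hq1 1), mul_assoc, h2, h3, mul_assoc, mul_assoc]
  generalize hQ : sh w 2 (q 1) * (sh w 1 (q 1) * sh w 0 (q 1)) = Q at h h0 h1
  rw [h0, h1, reassoc h1, reassoc h0, mul_assoc, mul_assoc, reassoc h0, reassoc h1, ← hQ] at h
  simpa only [mul_assoc] using h

end TensorRel

end Words

/-! ### The tensor space -/

section TensorSpaceLemmas

variable {K V : Type*} [Field K] [AddCommGroup V] [Module K V]

theorem incl_mul_incl (m n : ℕ) (x : ⨂[K]^m V) (y : ⨂[K]^n V) :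
    incl K V m x * incl K V n y = incl K V (m + n) (TensorPower.mulEquiv (x ⊗ₜ y)) :=
  DirectSum.of_mul_of _ _

theorem incl_cast {m n : ℕ} (h : m = n) (x : ⨂[K]^m V) :
    incl K V n (TensorPower.cast K V h x) = incl K V m x := by
  subst h; simp

theorem one_eq_incl : (1 : TV K V) = incl K V 0 (TensorPower.algebraMap₀ (1 : K)) := by
  rw [TensorPower.algebraMap₀_one]; rfl

variable (K V) in
/-- The projection of `T(V)` onto `V^{⊗n}`, as an endomorphism of `T(V)`. -/
def degProj (n : ℕ) : TV K V →ₗ[K] TV K V :=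
  incl K V n ∘ₗ DirectSum.component K ℕ (fun n => ⨂[K]^n V) n

theorem component_incl (n : ℕ) (x : ⨂[K]^n V) :
    DirectSum.component K ℕ (fun n => ⨂[K]^n V) n (incl K V n x) = x :=
  DirectSum.component.lof_self ..

theorem component_incl_of_ne {m n : ℕ} (h : m ≠ n) (x : ⨂[K]^m V) :
    DirectSum.component K ℕ (fun n => ⨂[K]^n V) n (incl K V m x) = 0 := by
  rw [DirectSum.component.of, dif_neg h]

theorem degProj_incl (n : ℕ) (x : ⨂[K]^n V) : degProj K V n (incl K V n x) = incl K V n x := by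
  rw [degProj, LinearMap.comp_apply, component_incl]

theorem degProj_incl_of_ne {m n : ℕ} (h : m ≠ n) (x : ⨂[K]^m V) :
    degProj K V n (incl K V m x) = 0 := by
  rw [degProj, LinearMap.comp_apply, component_incl_of_ne h, map_zero]

theorem tv_ext {W : Type*} [AddCommMonoid W] [Module K W] {f g : TV K V →ₗ[K] W}
    (h : ∀ n x, f (incl K V n x) = g (incl K V n x)) : f = g :=
  DirectSum.linearMap_ext K fun n => LinearMap.ext fun x => h n x

theorem tv_ext₂ {W : Type*} [AddCommMonoid W] [Module K W] {f g : TV K V ⊗[K] TV K V →ₗ[K] W}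
    (h : ∀ p q x y, f (incl K V p x ⊗ₜ incl K V q y) = g (incl K V p x ⊗ₜ incl K V q y)) :
    f = g := by
  refine TensorProduct.ext (tv_ext fun p x => tv_ext fun q y => ?_)
  simpa using h p q x y

theorem counit_incl_zero (a : K) : counit K V (incl K V 0 (TensorPower.algebraMap₀ a)) = a := by
  rw [counit, LinearMap.comp_apply, component_incl]; simp

theorem counit_incl_of_ne {n : ℕ} (h : n ≠ 0) (x : ⨂[K]^n V) : counit K V (incl K V n x) = 0 := by
  rw [counit, LinearMap.comp_apply, component_incl_of_ne h, map_zero]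

theorem degProj_zero : degProj K V 0 = Algebra.linearMap K (TV K V) ∘ₗ counit K V := by
  refine tv_ext fun n x => ?_
  by_cases hn : n = 0
  · subst hn
    obtain ⟨a, rfl⟩ := (TensorPower.algebraMap₀ (R := K) (M := V)).surjective x
    rw [degProj_incl, LinearMap.comp_apply, counit_incl_zero]; rfl
  · rw [degProj_incl_of_ne hn, LinearMap.comp_apply, counit_incl_of_ne hn, map_zero]

/-- The part of the deconcatenation which cuts after the letter `i` and has `j` letters in the
second factor. -/
def cut (i j : ℕ) : TV K V →ₗ[K] TV K V ⊗[K] TV K V :=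
  incl₂ K V i j ∘ₗ TensorPower.mulEquiv.symm.toLinearMap ∘ₗ
    DirectSum.component K ℕ (fun n => ⨂[K]^n V) (i + j)

theorem cut_incl (i j : ℕ) (x : ⨂[K]^(i + j) V) :
    cut i j (incl K V (i + j) x) = incl₂ K V i j (TensorPower.mulEquiv.symm x) := by
  rw [cut, LinearMap.comp_apply, LinearMap.comp_apply, component_incl]; rfl

theorem cut_incl_of_ne {n i j : ℕ} (h : n ≠ i + j) (x : ⨂[K]^n V) : cut i j (incl K V n x) = 0 := by
  rw [cut, LinearMap.comp_apply, LinearMap.comp_apply, component_incl_of_ne h, map_zero, map_zero]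

theorem deconc_incl (n : ℕ) (x : ⨂[K]^n V) : deconc K V (incl K V n x) =
    ∑ t ∈ Finset.HasAntidiagonal.antidiagonal n, cut t.1 t.2 (incl K V n x) := by
  rw [deconc, DirectSum.toModule_lof, LinearMap.sum_apply,
    ← Finset.sum_coe_sort _ fun t : ℕ × ℕ => cut t.1 t.2 (incl K V n x)]
  refine Finset.sum_congr rfl fun t _ => ?_
  rw [← incl_cast (Finset.HasAntidiagonal.mem_antidiagonal.1 t.2).symm, cut_incl]; rfl

theorem degProj_comp_incl (n : ℕ) : degProj K V n ∘ₗ incl K V n = incl K V n :=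
  LinearMap.ext fun x => degProj_incl n x

theorem degProj_comp_incl_of_ne {m n : ℕ} (h : m ≠ n) : degProj K V n ∘ₗ incl K V m = 0 :=
  LinearMap.ext fun x => degProj_incl_of_ne h x

theorem map_degProj_incl₂ (i j : ℕ) (z : (⨂[K]^i V) ⊗[K] (⨂[K]^j V)) :
    TensorProduct.map (degProj K V i) (degProj K V j) (incl₂ K V i j z) = incl₂ K V i j z := by
  rw [← LinearMap.comp_apply, ← TensorProduct.map_comp, degProj_comp_incl, degProj_comp_incl]

theorem map_degProj_incl₂_of_ne {i j p q : ℕ} (h : (p, q) ≠ (i, j))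
    (z : (⨂[K]^p V) ⊗[K] (⨂[K]^q V)) :
    TensorProduct.map (degProj K V i) (degProj K V j) (incl₂ K V p q z) = 0 := by
  rw [← LinearMap.comp_apply, ← TensorProduct.map_comp]
  by_cases hp : p = i
  · have hq : q ≠ j := fun hq => h (by rw [hp, hq])
    rw [degProj_comp_incl_of_ne hq, TensorProduct.map_zero_right, LinearMap.zero_apply]
  · rw [degProj_comp_incl_of_ne hp, TensorProduct.map_zero_left, LinearMap.zero_apply]

theorem map_degProj_deconc (i j : ℕ) :
    TensorProduct.map (degProj K V i) (degProj K V j) ∘ₗ deconc K V = cut i j := by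
  refine tv_ext fun n x => ?_
  rw [LinearMap.comp_apply, deconc_incl, map_sum]
  have h0 : ∀ t : ℕ × ℕ, t ≠ (i, j) → TensorProduct.map (degProj K V i) (degProj K V j)
      (cut t.1 t.2 (incl K V n x)) = 0 := fun t ht =>
    map_degProj_incl₂_of_ne ht _
  rw [Finset.sum_eq_single (i, j) (fun t _ ht => h0 t ht)]
  · exact map_degProj_incl₂ _ _ _
  · intro h
    rw [Finset.HasAntidiagonal.mem_antidiagonal] at h
    rw [cut_incl_of_ne (Ne.symm h), map_zero]

theorem deconc_degProj (n : ℕ) : deconc K V ∘ₗ degProj K V n =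
    ∑ t ∈ Finset.HasAntidiagonal.antidiagonal n,
      TensorProduct.map (degProj K V t.1) (degProj K V t.2) ∘ₗ deconc K V := by
  refine tv_ext fun m x => ?_
  simp only [LinearMap.comp_apply, LinearMap.sum_apply]
  simp only [← LinearMap.comp_apply (TensorProduct.map _ _), map_degProj_deconc]
  by_cases h : m = n
  · subst h; rw [degProj_incl, deconc_incl]
  · rw [degProj_incl_of_ne h, map_zero, Finset.sum_eq_zero]
    intro t ht
    rw [cut_incl_of_ne]
    rw [Finset.HasAntidiagonal.mem_antidiagonal] at ht
    rwa [ht]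

theorem mul'_incl₂ (i j : ℕ) (z : (⨂[K]^i V) ⊗[K] (⨂[K]^j V)) :
    LinearMap.mul' K (TV K V) (incl₂ K V i j z) = incl K V (i + j) (TensorPower.mulEquiv z) := by
  induction z using TensorProduct.induction_on with
  | zero => simp
  | add x y hx hy => simp only [map_add, hx, hy]
  | tmul x y => exact incl_mul_incl i j x y

theorem mul'_cut (i j : ℕ) : LinearMap.mul' K (TV K V) ∘ₗ cut i j = degProj K V (i + j) := by
  refine LinearMap.ext fun x => ?_
  rw [LinearMap.comp_apply, cut, LinearMap.comp_apply, mul'_incl₂]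
  simp [degProj]

theorem cut_mul' (i j : ℕ) (z : (⨂[K]^i V) ⊗[K] (⨂[K]^j V)) :
    cut i j (LinearMap.mul' K (TV K V) (incl₂ K V i j z)) = incl₂ K V i j z := by
  rw [mul'_incl₂, cut_incl, LinearEquiv.symm_apply_apply]

theorem range_map_degProj (i j : ℕ) (z : TV K V ⊗[K] TV K V) :
    ∃ y, TensorProduct.map (degProj K V i) (degProj K V j) z = incl₂ K V i j y := by
  rw [degProj, degProj, TensorProduct.map_comp]
  exact ⟨_, rfl⟩

theorem deconc_one : deconc K V 1 = 1 ⊗ₜ 1 := by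
  rw [one_eq_incl, deconc_incl, Finset.Nat.antidiagonal_zero, Finset.sum_singleton]
  have h : incl K V 0 (TensorPower.algebraMap₀ 1) =
      LinearMap.mul' K (TV K V) (incl₂ K V 0 0
        (TensorPower.algebraMap₀ (1 : K) ⊗ₜ TensorPower.algebraMap₀ (1 : K))) := by
    simp only [incl₂, TensorProduct.map_tmul, LinearMap.mul'_apply]
    rw [← one_eq_incl, mul_one]
  conv_lhs => rw [h]
  rw [cut_mul']; rfl

/-- The inclusion `V ⊆ T(V)`. -/
def incl₁ : V →ₗ[K] TV K V := incl K V 1 ∘ₗ (toPowOne K V).toLinearMap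

theorem incl_snoc (n : ℕ) (x : ⨂[K]^n V) (v : V) :
    incl K V (n + 1) (snoc K V n (x ⊗ₜ v)) = incl K V n x * incl₁ v :=
  (incl_mul_incl n 1 x (toPowOne K V v)).symm

theorem degProj_one : degProj K V 1 = incl₁ ∘ₗ projV K V := by
  refine LinearMap.ext fun x => ?_
  simp [degProj, incl₁, projV]

theorem projV_incl₁ (v : V) : projV K V (incl₁ v) = v := by
  rw [projV, incl₁, LinearMap.comp_apply, LinearMap.comp_apply, component_incl]; simp

theorem ofBidegrees_incl₂ {W : Type*} [AddCommMonoid W] [Module K W]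
    (f : ∀ p q : ℕ, (⨂[K]^p V) ⊗[K] (⨂[K]^q V) →ₗ[K] W) (p q : ℕ)
    (z : (⨂[K]^p V) ⊗[K] (⨂[K]^q V)) : ofBidegrees f (incl₂ K V p q z) = f p q z := by
  induction z using TensorProduct.induction_on with
  | zero => simp
  | add x y hx hy => simp only [map_add, hx, hy]
  | tmul x y =>
    rw [ofBidegrees, LinearMap.comp_apply, TensorProduct.map_tmul]
    erw [TensorProduct.directSum_lof_tmul_lof, DirectSum.toModule_lof]

theorem tv_snoc_ext {W : Type*} [AddCommMonoid W] [Module K W] {n : ℕ} {f g : TV K V →ₗ[K] W}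
    (h : ∀ x v, f (incl K V n x * incl₁ v) = g (incl K V n x * incl₁ v)) (y : ⨂[K]^(n + 1) V) :
    f (incl K V (n + 1) y) = g (incl K V (n + 1) y) := by
  have h1 : f ∘ₗ incl K V (n + 1) ∘ₗ (snoc K V n).toLinearMap =
      g ∘ₗ incl K V (n + 1) ∘ₗ (snoc K V n).toLinearMap :=
    TensorProduct.ext' fun x v => by
      simpa only [LinearMap.comp_apply, LinearEquiv.coe_coe, incl_snoc] using h x v
  simpa using LinearMap.congr_fun h1 ((snoc K V n).symm y)

end TensorSpaceLemmas

/-! ### The operators of words and the braiding of `T(V)` -/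

section BraidLemmas

variable {K V : Type*} [Field K] [AddCommGroup V] [Module K V]
  (σ : V ⊗[K] V →ₗ[K] V ⊗[K] V)

theorem sigmaAt_snoc {n k : ℕ} (h : k + 2 ≤ n) (x : ⨂[K]^n V) (v : V) :
    sigmaAt σ (n + 1) k (snoc K V n (x ⊗ₜ v)) = snoc K V n (sigmaAt σ n k x ⊗ₜ v) := by
  obtain ⟨n, rfl⟩ : ∃ n', n = n' + 1 := ⟨n - 1, by omega⟩
  rw [sigmaAt, if_neg (by omega)]
  simp

theorem sigmaAt_of_lt {n k : ℕ} (h : n < k + 2) : sigmaAt σ n k = LinearMap.id := by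
  induction n with
  | zero => rfl
  | succ n ih =>
    cases n with
    | zero => rfl
    | succ n =>
      rw [sigmaAt, if_neg (by omega), ih (by omega)]
      ext1
      simp

/-- The operators `id^{⊗k} ⊗ σ ⊗ id^{⊗(n-k-2)}`, together for all `n`. -/
def sigmaOp (k : ℕ) : TV K V →ₗ[K] TV K V :=
  DirectSum.toModule K ℕ _ fun n => incl K V n ∘ₗ sigmaAt σ n k

theorem sigmaOp_incl (n k : ℕ) (x : ⨂[K]^n V) :
    sigmaOp σ k (incl K V n x) = incl K V n (sigmaAt σ n k x) := by
  rw [sigmaOp, DirectSum.toModule_lof]; rfl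

theorem sigmaOp_mul_incl₁ {n k : ℕ} (h : k + 2 ≤ n) (x : ⨂[K]^n V) (v : V) :
    sigmaOp σ k (incl K V n x * incl₁ v) = sigmaOp σ k (incl K V n x) * incl₁ v := by
  rw [← incl_snoc, sigmaOp_incl, sigmaAt_snoc σ h, incl_snoc, sigmaOp_incl]

theorem sigmaOp_mul_mul (n : ℕ) (x : ⨂[K]^n V) (u v : V) :
    sigmaOp σ n (incl K V n x * incl₁ u * incl₁ v) = incl K V n x *
      LinearMap.mul' K (TV K V) (TensorProduct.map incl₁ incl₁ (σ (u ⊗ₜ v))) := by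
  rw [← incl_snoc, ← incl_snoc, sigmaOp_incl, sigmaAt, if_pos rfl]
  simp only [LinearMap.comp_apply, LinearEquiv.coe_coe, LinearEquiv.trans_symm,
    LinearEquiv.trans_apply, LinearEquiv.symm_apply_apply]
  have h1 : ((snoc K V n).rTensor V).symm (snoc K V n (x ⊗ₜ[K] u) ⊗ₜ[K] v) =
      (x ⊗ₜ[K] u) ⊗ₜ[K] v := by
    rw [LinearEquiv.symm_apply_eq]; rfl
  rw [h1, TensorProduct.assoc_tmul, LinearMap.lTensor_tmul]
  induction σ (u ⊗ₜ v) using TensorProduct.induction_on with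
  | zero => simp
  | add y z hy hz => simp only [TensorProduct.tmul_add, map_add, hy, hz, mul_add]
  | tmul a b =>
    have h2 : (snoc K V n).rTensor V ((x ⊗ₜ[K] a) ⊗ₜ[K] b) = snoc K V n (x ⊗ₜ a) ⊗ₜ b := rfl
    rw [TensorProduct.assoc_symm_tmul, h2, incl_snoc, incl_snoc, TensorProduct.map_tmul,
      LinearMap.mul'_apply, mul_assoc]

theorem sigmaOp_of_lt {n k : ℕ} (h : n < k + 2) (x : ⨂[K]^n V) :
    sigmaOp σ k (incl K V n x) = incl K V n x := by
  rw [sigmaOp_incl, sigmaAt_of_lt σ h]; rfl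

/-- An operator acting after the first `j` places does not see the first `j` letters. -/
theorem sigmaOp_incl_mul (j k : ℕ) (y : ⨂[K]^j V) (t : TV K V) :
    sigmaOp σ (j + k) (incl K V j y * t) = incl K V j y * sigmaOp σ k t := by
  have h1 : sigmaOp σ (j + k) ∘ₗ LinearMap.mulLeft K (incl K V j y) =
      LinearMap.mulLeft K (incl K V j y) ∘ₗ sigmaOp σ k := by
    refine tv_ext fun n x => ?_
    simp only [LinearMap.comp_apply, LinearMap.mulLeft_apply]
    rcases Nat.lt_or_ge n (k + 2) with h | h
    · rw [sigmaOp_of_lt σ h, incl_mul_incl, sigmaOp_of_lt σ (by omega)]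
    · obtain ⟨r, rfl⟩ := Nat.exists_eq_add_of_le h
      induction r with
      | zero =>
        refine tv_snoc_ext (n := k + 1) (f := sigmaOp σ (j + k) ∘ₗ LinearMap.mulLeft K (incl K V j y))
          (g := LinearMap.mulLeft K (incl K V j y) ∘ₗ sigmaOp σ k) (fun x v => ?_) x
        refine tv_snoc_ext (n := k) (f := sigmaOp σ (j + k) ∘ₗ LinearMap.mulLeft K (incl K V j y) ∘ₗ
            LinearMap.mulRight K (incl₁ v))
          (g := LinearMap.mulLeft K (incl K V j y) ∘ₗ sigmaOp σ k ∘ₗ LinearMap.mulRight K (incl₁ v))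
          (fun x u => ?_) x
        simp only [LinearMap.comp_apply, LinearMap.mulLeft_apply, LinearMap.mulRight_apply]
        rw [sigmaOp_mul_mul, ← mul_assoc, ← mul_assoc, ← mul_assoc, incl_mul_incl, sigmaOp_mul_mul]
      | succ r ih =>
        refine tv_snoc_ext (n := k + 2 + r)
          (f := sigmaOp σ (j + k) ∘ₗ LinearMap.mulLeft K (incl K V j y))
          (g := LinearMap.mulLeft K (incl K V j y) ∘ₗ sigmaOp σ k) (fun x v => ?_) x
        simp only [LinearMap.comp_apply, LinearMap.mulLeft_apply]
        rw [sigmaOp_mul_incl₁ σ (by omega), ← mul_assoc, ← mul_assoc, ← ih x (by omega),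
          incl_mul_incl, sigmaOp_mul_incl₁ σ (by omega)]
  exact LinearMap.congr_fun h1 t

/-- The operator `σ_{i₁} ⋯ σ_{iₗ}` on all tensor powers together. -/
def wordOp (l : List ℕ) : Module.End K (TV K V) := (l.map (sigmaOp σ)).prod

theorem wordOp_cons (k : ℕ) (l : List ℕ) (t : TV K V) :
    wordOp σ (k :: l) t = sigmaOp σ k (wordOp σ l t) := by
  simp [wordOp]

theorem wordOp_append (l l' : List ℕ) (t : TV K V) :
    wordOp σ (l ++ l') t = wordOp σ l (wordOp σ l' t) := by
  simp [wordOp]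

theorem wordOp_incl (l : List ℕ) (n : ℕ) (x : ⨂[K]^n V) :
    wordOp σ l (incl K V n x) = incl K V n (wordAct σ n l x) := by
  induction l with
  | nil => rfl
  | cons k l ih => rw [wordOp_cons, ih, sigmaOp_incl]; simp [wordAct]

theorem wordOp_incl_mul (l : List ℕ) (j : ℕ) (y : ⨂[K]^j V) (t : TV K V) :
    wordOp σ (l.map (j + ·)) (incl K V j y * t) = incl K V j y * wordOp σ l t := by
  induction l with
  | nil => rfl
  | cons k l ih => rw [List.map_cons, wordOp_cons, ih, sigmaOp_incl_mul, wordOp_cons]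

theorem wordOp_mul_incl₁ {l : List ℕ} {n : ℕ} (h : ∀ k ∈ l, k + 2 ≤ n) (x : ⨂[K]^n V) (v : V) :
    wordOp σ l (incl K V n x * incl₁ v) = wordOp σ l (incl K V n x) * incl₁ v := by
  induction l with
  | nil => rfl
  | cons k l ih =>
    rw [wordOp_cons, ih fun k hk => h k (List.mem_cons_of_mem _ hk), wordOp_incl,
      sigmaOp_mul_incl₁ σ (h k List.mem_cons_self), ← wordOp_incl, wordOp_cons]

theorem chiWord_succ (i j : ℕ) :
    chiWord i (j + 1) = (List.range i).map (j + ·) ++ chiWord i j := by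
  simp [chiWord, List.range_succ]

theorem chiWord_one (i : ℕ) : chiWord i 1 = List.range i := by
  simp [chiWord]

theorem lt_of_mem_chiWord {i j k : ℕ} (h : k ∈ chiWord i j) : k + 2 ≤ i + j := by
  simp only [chiWord, List.mem_flatMap, List.mem_reverse, List.mem_range, List.mem_map] at h
  obtain ⟨t, ht, s, hs, rfl⟩ := h
  omega

theorem beta_incl₂ (i j : ℕ) (z : (⨂[K]^i V) ⊗[K] (⨂[K]^j V)) :
    beta σ (incl₂ K V i j z) = incl₂ K V j i (betaAt σ i j z) :=
  ofBidegrees_incl₂ _ i j z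

/-- The braiding becomes the action of a word after multiplication. -/
theorem mul'_beta_incl₂ (i j : ℕ) (z : (⨂[K]^i V) ⊗[K] (⨂[K]^j V)) :
    LinearMap.mul' K (TV K V) (beta σ (incl₂ K V i j z)) =
      wordOp σ (chiWord i j) (LinearMap.mul' K (TV K V) (incl₂ K V i j z)) := by
  rw [beta_incl₂, mul'_incl₂, mul'_incl₂, wordOp_incl, betaAt]
  simp [incl_cast]

theorem mul'_beta_tmul (i j : ℕ) (x : ⨂[K]^i V) (y : ⨂[K]^j V) :
    LinearMap.mul' K (TV K V) (beta σ (incl K V i x ⊗ₜ incl K V j y)) =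
      wordOp σ (chiWord i j) (incl K V i x * incl K V j y) :=
  mul'_beta_incl₂ σ i j (x ⊗ₜ y)

/-- In fixed degrees, an element of `T(V) ⊗ T(V)` is determined by its product. -/
theorem incl₂_ext {i j : ℕ} {y z : (⨂[K]^i V) ⊗[K] (⨂[K]^j V)}
    (h : LinearMap.mul' K (TV K V) (incl₂ K V i j y) =
      LinearMap.mul' K (TV K V) (incl₂ K V i j z)) : incl₂ K V i j y = incl₂ K V i j z := by
  rw [← cut_mul', h, cut_mul']

/-- On `V ⊗ V` the braiding of `T(V)` is the given one. -/
theorem beta_map_incl₁ (t : V ⊗[K] V) :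
    beta σ (TensorProduct.map incl₁ incl₁ t) = TensorProduct.map incl₁ incl₁ (σ t) := by
  induction t using TensorProduct.induction_on with
  | zero => simp
  | add y z hy hz => simp only [map_add, hy, hz]
  | tmul u v =>
    have h1 : ∀ t : V ⊗[K] V, TensorProduct.map incl₁ incl₁ t = incl₂ K V 1 1
        (TensorProduct.map (toPowOne K V).toLinearMap (toPowOne K V).toLinearMap t) := fun t => by
      rw [← LinearMap.comp_apply (incl₂ K V 1 1), ← TensorProduct.map_comp]; rfl
    rw [h1 (σ _), h1, beta_incl₂]
    refine incl₂_ext ?_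
    rw [← beta_incl₂, mul'_beta_incl₂, ← h1, ← h1, TensorProduct.map_tmul, LinearMap.mul'_apply]
    have h2 := sigmaOp_mul_mul σ 0 (TensorPower.algebraMap₀ (1 : K)) u v
    rw [← one_eq_incl, one_mul, one_mul] at h2
    rw [chiWord_one]
    simpa [wordOp] using h2

/-- The braiding with `y v`, where `v` is a letter: the word of `χ_{i,j+1}` extends the word of
`χ_{ij}`. -/
theorem mul'_beta_mul_incl₁ (i j : ℕ) (x : ⨂[K]^i V) (y : ⨂[K]^j V) (v : V) :
    LinearMap.mul' K (TV K V) (beta σ (incl K V i x ⊗ₜ (incl K V j y * incl₁ v))) =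
      wordOp σ ((List.range i).map (j + ·))
        (LinearMap.mul' K (TV K V) (beta σ (incl K V i x ⊗ₜ incl K V j y)) * incl₁ v) := by
  rw [← incl_snoc, mul'_beta_tmul, chiWord_succ, wordOp_append, incl_snoc, ← mul_assoc,
    incl_mul_incl, wordOp_mul_incl₁ σ fun k hk => lt_of_mem_chiWord hk, ← incl_mul_incl,
    ← mul'_beta_tmul]

section Bijective

variable {σ}

theorem sigmaAt_bijective (h : Function.Bijective σ) (n k : ℕ) :
    Function.Bijective (sigmaAt σ n k) := by
  induction n with
  | zero => exact Function.bijective_id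
  | succ n ih =>
    cases n with
    | zero => exact Function.bijective_id
    | succ n =>
      rw [sigmaAt]
      split_ifs with hk
      · have h1 : Function.Bijective (σ.lTensor (⨂[K]^n V)) :=
          ((LinearEquiv.ofBijective σ h).lTensor (⨂[K]^n V)).bijective
        simp only [LinearMap.coe_comp, LinearEquiv.coe_coe]
        exact (LinearEquiv.bijective _).comp ((LinearEquiv.bijective _).comp
          (h1.comp ((LinearEquiv.bijective _).comp (LinearEquiv.bijective _))))
      · have h1 : Function.Bijective ((sigmaAt σ (n + 1) k).rTensor V) :=
          ((LinearEquiv.ofBijective _ ih).rTensor V).bijective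
        simp only [LinearMap.coe_comp, LinearEquiv.coe_coe]
        exact (LinearEquiv.bijective _).comp (h1.comp (LinearEquiv.bijective _))

theorem wordAct_bijective (h : Function.Bijective σ) (n : ℕ) (l : List ℕ) :
    Function.Bijective (wordAct σ n l) := by
  induction l with
  | nil => exact Function.bijective_id
  | cons k l ih =>
    have h1 : wordAct σ n (k :: l) = sigmaAt σ n k ∘ₗ wordAct σ n l := by
      simp [wordAct, Module.End.mul_eq_comp]
    rw [h1, LinearMap.coe_comp]
    exact (sigmaAt_bijective h n k).comp ih

theorem betaAt_bijective (h : Function.Bijective σ) (i j : ℕ) :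
    Function.Bijective (betaAt σ i j) := by
  rw [betaAt]
  simp only [LinearMap.coe_comp, LinearEquiv.coe_coe]
  exact (LinearEquiv.bijective _).comp ((LinearEquiv.bijective _).comp
    ((wordAct_bijective h _ _).comp (LinearEquiv.bijective _)))

theorem beta_bijective (h : Function.Bijective σ) : Function.Bijective (beta σ) := by
  let γ : TV K V ⊗[K] TV K V →ₗ[K] TV K V ⊗[K] TV K V := ofBidegrees fun i j =>
    incl₂ K V j i ∘ₗ (LinearEquiv.ofBijective _ (betaAt_bijective h j i)).symm.toLinearMap
  have hγ : ∀ i j z, γ (incl₂ K V i j z) = incl₂ K V j i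
      ((LinearEquiv.ofBijective _ (betaAt_bijective h j i)).symm z) := fun i j z =>
    ofBidegrees_incl₂ _ i j z
  have h1 : γ ∘ₗ beta σ = LinearMap.id := tv_ext₂ fun p q x y => by
    have h2 : (incl K V p x ⊗ₜ[K] incl K V q y) = incl₂ K V p q (x ⊗ₜ y) := rfl
    rw [h2, LinearMap.comp_apply, beta_incl₂, hγ]
    exact congrArg (incl₂ K V p q)
      ((LinearEquiv.ofBijective _ (betaAt_bijective h p q)).symm_apply_apply _)
  have h2 : beta σ ∘ₗ γ = LinearMap.id := tv_ext₂ fun p q x y => by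
    have h2 : (incl K V p x ⊗ₜ[K] incl K V q y) = incl₂ K V p q (x ⊗ₜ y) := rfl
    rw [h2, LinearMap.comp_apply, hγ, beta_incl₂]
    exact congrArg (incl₂ K V p q)
      ((LinearEquiv.ofBijective _ (betaAt_bijective h q p)).apply_symm_apply _)
  exact Function.bijective_iff_has_inverse.2 ⟨γ, LinearMap.congr_fun h1, LinearMap.congr_fun h2⟩

end Bijective

end BraidLemmas

/-! ### The operations of `T(V)` as words -/

section Translation

open Strand

variable (K V W : Type*) [Field K] [AddCommGroup V] [Module K V] [AddCommGroup W] [Module K W]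
  [Strand K W (TV K V)]

theorem letter_op {A B : Type*} [AddCommMonoid A] [Module K A] [AddCommMonoid B] [Module K B]
    [Strand K W A] [Strand K W B] {w : Module.End K W →+* Module.End K W} {a b r : ℕ}
    (f : A →ₗ[K] B) (hA : ∀ x, wh K W A x = sh w a x) (hB : ∀ x, wh K W B x = sh w b x) :
    Letter w (op W f) a b r :=
  ⟨fun y => by rw [← hA, ← hB, op_mul_wh]⟩

variable {K V W}

theorem sh_zero (w : Module.End K W →+* Module.End K W) (x : Module.End K W) : sh w 0 x = x := rfl

theorem wh_TV (x : Module.End K W) : wh K W (TV K V) x = sh (wh K W (TV K V)) 1 x := by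
  rw [sh, pow_one]

theorem wh_unit' (x : Module.End K W) : wh K W K x = sh (wh K W (TV K V)) 0 x := wh_unit x

theorem wh_TV₂ (x : Module.End K W) :
    wh K W (TV K V ⊗[K] TV K V) x = sh (wh K W (TV K V)) 2 x := by
  rw [wh_tensor, wh_TV, wh_TV, sh_sh]

/-- The operation `f ⊗ g`, with `f` performed last. -/
theorem op_map' {A B C D : Type*} [AddCommMonoid A] [Module K A] [AddCommMonoid B] [Module K B]
    [AddCommMonoid C] [Module K C] [AddCommMonoid D] [Module K D]
    [Strand K W A] [Strand K W B] [Strand K W C] [Strand K W D] (f : A →ₗ[K] B) (g : C →ₗ[K] D) :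
    op W (TensorProduct.map f g) = wh K W D (op W f) * op W g := by
  rw [op_map, op_mul_wh]

variable (K V W)

/-- The unit of `T(V)` as an operation. -/
def opU : Module.End K W := op W (Algebra.linearMap K (TV K V))

/-- The concatenation product of `T(V)` as an operation. -/
def opC : Module.End K W := op W (LinearMap.mul' K (TV K V))

/-- The counit of `T^c(V)` as an operation. -/
def opE : Module.End K W := op W (counit K V)

/-- The deconcatenation as an operation. -/
def opD : Module.End K W := op W (deconc K V)

/-- The projection onto `V^{⊗n}` as an operation. -/
def opQ (n : ℕ) : Module.End K W := op W (degProj K V n)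

variable {V} in
/-- The braiding of `T(V)` as an operation. -/
def opB (σ : V ⊗[K] V →ₗ[K] V ⊗[K] V) : Module.End K W := op W (beta σ)

instance : Letter (wh K W (TV K V)) (opU K V W) 0 1 0 := letter_op K W _ wh_unit' wh_TV
instance : Letter (wh K W (TV K V)) (opC K V W) 2 1 1 := letter_op K W _ wh_TV₂ wh_TV
instance : Letter (wh K W (TV K V)) (opE K V W) 1 0 4 := letter_op K W _ wh_TV wh_unit'
instance : Letter (wh K W (TV K V)) (opD K V W) 1 2 3 := letter_op K W _ wh_TV wh_TV₂
instance (n : ℕ) : Letter (wh K W (TV K V)) (opQ K V W n) 1 1 2 := letter_op K W _ wh_TV wh_TV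
instance (σ : V ⊗[K] V →ₗ[K] V ⊗[K] V) : Letter (wh K W (TV K V)) (opB K W σ) 2 2 2 :=
  letter_op K W _ wh_TV₂ wh_TV₂

variable {K V W}

/-- The projections onto the degrees of any one strand span. -/
theorem iSup_range_opQ (k : ℕ) :
    ⨆ n, LinearMap.range (sh (wh K W (TV K V)) k (opQ K V W n)) = ⊤ := by
  induction k with
  | zero =>
    rw [eq_top_iff]
    intro t _
    obtain ⟨t, rfl⟩ := (absorb (K := K) (W := W) (A := TV K V)).surjective t
    induction t using TensorProduct.induction_on with
    | zero => simp
    | add x y hx hy => rw [map_add]; exact add_mem (hx trivial) (hy trivial)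
    | tmul s x =>
      induction x using DirectSum.induction_on with
      | zero => simp
      | add x y hx hy =>
        rw [TensorProduct.tmul_add, map_add]; exact add_mem (hx trivial) (hy trivial)
      | of n x =>
        refine Submodule.mem_iSup_of_mem n ⟨absorb (s ⊗ₜ[K] incl K V n x), ?_⟩
        rw [sh_zero, opQ, op_apply, LinearMap.lTensor_tmul]
        exact congrArg (fun y => absorb (s ⊗ₜ[K] y)) (degProj_incl n x)
  | succ k ih =>
    have hs : ∀ n, sh (wh K W (TV K V)) (k + 1) (opQ K V W n) =
        wh K W (TV K V) (sh (wh K W (TV K V)) k (opQ K V W n)) := fun n => by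
      rw [wh_TV, sh_sh, Nat.add_comm]
    rw [eq_top_iff]
    intro t _
    obtain ⟨t, rfl⟩ := (absorb (K := K) (W := W) (A := TV K V)).surjective t
    induction t using TensorProduct.induction_on with
    | zero => simp
    | add x y hx hy => rw [map_add]; exact add_mem (hx trivial) (hy trivial)
    | tmul s x =>
      have h1 : s ∈ ⨆ n, LinearMap.range (sh (wh K W (TV K V)) k (opQ K V W n)) := ih ▸ trivial
      induction h1 using Submodule.iSup_induction' with
      | mem n s hs' =>
        obtain ⟨s, rfl⟩ := hs'
        refine Submodule.mem_iSup_of_mem n ⟨absorb (s ⊗ₜ[K] x), ?_⟩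
        rw [hs, wh_apply, LinearMap.rTensor_tmul]
      | zero => simp
      | add y z _ _ hy hz =>
        rw [TensorProduct.add_tmul, map_add]; exact add_mem (hy trivial) (hz trivial)

theorem faithful_opQ (k : ℕ) (X : Module.End K W)
    (h : ∀ n, X * sh (wh K W (TV K V)) k (opQ K V W n) = 0) : X = 0 := by
  rw [← LinearMap.ker_eq_top, eq_top_iff, ← iSup_range_opQ (K := K) (V := V) (W := W) k]
  refine iSup_le fun n => ?_
  rintro _ ⟨t, rfl⟩
  exact LinearMap.congr_fun (h n) t

variable (K V W) in
theorem tensorRel : TensorRel (wh K W (TV K V)) (opU K V W) (opC K V W) (opE K V W) (opD K V W)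
    (opQ K V W) where
  faithful := faithful_opQ
  c_c := by
    have h : LinearMap.mul' K (TV K V) ∘ₗ (LinearMap.mul' K (TV K V)).lTensor (TV K V) ∘ₗ
        (TensorProduct.assoc K _ _ _).toLinearMap =
        LinearMap.mul' K (TV K V) ∘ₗ (LinearMap.mul' K (TV K V)).rTensor (TV K V) :=
      TensorProduct.ext_threefold fun x y z => (mul_assoc x y z).symm
    simpa only [sh_zero, opU, opC, opE, opD, opQ, op_comp, op_lTensor, op_rTensor, op_assoc,
      mul_one, wh_TV] using congrArg (op W) h
  c_u := by
    have h : LinearMap.mul' K (TV K V) ∘ₗ (Algebra.linearMap K (TV K V)).lTensor (TV K V) ∘ₗ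
        (TensorProduct.rid K _).symm.toLinearMap = LinearMap.id :=
      LinearMap.ext fun x => by simp
    simpa only [sh_zero, opU, opC, opE, opD, opQ, op_comp, op_lTensor, op_rid_symm, mul_one,
      op_id] using congrArg (op W) h
  c_wu := by
    have h : LinearMap.mul' K (TV K V) ∘ₗ (Algebra.linearMap K (TV K V)).rTensor (TV K V) ∘ₗ
        (TensorProduct.lid K _).symm.toLinearMap = LinearMap.id :=
      LinearMap.ext fun x => by simp
    simpa only [sh_zero, opU, opC, opE, opD, opQ, op_comp, op_rTensor, op_lid_symm, mul_one, op_id,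
      wh_TV] using congrArg (op W) h
  e_u := by
    have h : counit K V ∘ₗ Algebra.linearMap K (TV K V) = LinearMap.id :=
      LinearMap.ext fun x => counit_incl_zero x
    simpa only [sh_zero, opU, opC, opE, opD, opQ, op_comp, op_id] using congrArg (op W) h
  q_zero := by
    simpa only [sh_zero, opU, opC, opE, opD, opQ, op_comp] using congrArg (op W) (degProj_zero (K := K) (V := V))
  q_mul_self i := by
    have h : degProj K V i ∘ₗ degProj K V i = degProj K V i :=
      LinearMap.ext fun x => degProj_incl i _
    simpa only [sh_zero, opU, opC, opE, opD, opQ, op_comp] using congrArg (op W) h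
  q_mul_ne i j hij := by
    have h : degProj K V i ∘ₗ degProj K V j = 0 :=
      LinearMap.ext fun x => degProj_incl_of_ne hij.symm _
    simpa only [sh_zero, opU, opC, opE, opD, opQ, op_comp, op_zero] using congrArg (op W) h
  d_u := by
    have h : deconc K V ∘ₗ Algebra.linearMap K (TV K V) =
        TensorProduct.map (Algebra.linearMap K (TV K V)) (Algebra.linearMap K (TV K V)) ∘ₗ
        (TensorProduct.lid K K).symm.toLinearMap := by
      ext
      simpa using deconc_one
    simpa only [sh_zero, opU, opC, opE, opD, opQ, op_comp, op_map, op_lid_symm, mul_one,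
      wh_unit] using congrArg (op W) h
  d_q n := by
    simpa only [sh_zero, opU, opC, opE, opD, opQ, op_comp, op_sum, op_map', mul_assoc, wh_TV] using
      congrArg (op W) (deconc_degProj (K := K) (V := V) n)
  c_qq_d i j := by
    have h := mul'_cut (K := K) (V := V) i j
    rw [← map_degProj_deconc] at h
    simpa only [sh_zero, opU, opC, opE, opD, opQ, op_comp, op_map', mul_assoc, wh_TV] using congrArg (op W) h
  qq_d_c_qq i j := by
    have h : cut i j ∘ₗ LinearMap.mul' K (TV K V) ∘ₗ
        TensorProduct.map (degProj K V i) (degProj K V j) =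
        TensorProduct.map (degProj K V i) (degProj K V j) := by
      refine LinearMap.ext fun z => ?_
      obtain ⟨y, hy⟩ := range_map_degProj i j z
      rw [LinearMap.comp_apply, LinearMap.comp_apply, hy, cut_mul']
    rw [← map_degProj_deconc] at h
    simpa only [sh_zero, opU, opC, opE, opD, opQ, op_comp, op_map', mul_assoc, wh_TV] using congrArg (op W) h

end Translation

/-! ### The braiding of `T(V)` as a word -/

section BraidTranslation

variable {K V W : Type*} [Field K] [AddCommGroup V] [Module K V] [AddCommGroup W] [Module K W]
  [Strand K W (TV K V)] (σ : V ⊗[K] V →ₗ[K] V ⊗[K] V)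

theorem beta_rTensor_degProj (n : ℕ) :
    beta σ ∘ₗ (degProj K V n).rTensor (TV K V) = (degProj K V n).lTensor (TV K V) ∘ₗ beta σ := by
  refine tv_ext₂ fun p q x y => ?_
  have h1 : (incl K V p x ⊗ₜ[K] incl K V q y) = incl₂ K V p q (x ⊗ₜ y) := rfl
  simp only [LinearMap.comp_apply, LinearMap.rTensor_tmul]
  rw [h1, beta_incl₂, ← LinearMap.comp_apply (LinearMap.lTensor _ _), LinearMap.lTensor_comp_map]
  by_cases h : p = n
  · subst h
    rw [degProj_incl, degProj_comp_incl, h1, beta_incl₂]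
  · rw [degProj_incl_of_ne h, degProj_comp_incl_of_ne h]
    simp

theorem beta_lTensor_degProj (n : ℕ) :
    beta σ ∘ₗ (degProj K V n).lTensor (TV K V) = (degProj K V n).rTensor (TV K V) ∘ₗ beta σ := by
  refine tv_ext₂ fun p q x y => ?_
  have h1 : (incl K V p x ⊗ₜ[K] incl K V q y) = incl₂ K V p q (x ⊗ₜ y) := rfl
  simp only [LinearMap.comp_apply, LinearMap.lTensor_tmul]
  rw [h1, beta_incl₂, ← LinearMap.comp_apply (LinearMap.rTensor _ _), LinearMap.rTensor_comp_map]
  by_cases h : q = n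
  · subst h
    rw [degProj_incl, degProj_comp_incl, h1, beta_incl₂]
  · rw [degProj_incl_of_ne h, degProj_comp_incl_of_ne h]
    simp

theorem beta_tmul_one (x : TV K V) : beta σ (x ⊗ₜ 1) = 1 ⊗ₜ x := by
  have h : beta σ ∘ₗ (TensorProduct.mk K _ _).flip 1 = TensorProduct.mk K _ (TV K V) 1 := by
    refine tv_ext fun n x => ?_
    have h1 : (1 : TV K V) ⊗ₜ[K] incl K V n x = incl₂ K V 0 n (TensorPower.algebraMap₀ 1 ⊗ₜ x) := by
      rw [TensorProduct.map_tmul, ← one_eq_incl]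
    have h2 : incl K V n x ⊗ₜ[K] (1 : TV K V) = incl₂ K V n 0 (x ⊗ₜ TensorPower.algebraMap₀ 1) := by
      rw [TensorProduct.map_tmul, ← one_eq_incl]
    simp only [LinearMap.comp_apply, LinearMap.flip_apply, TensorProduct.mk_apply]
    rw [h1, h2, beta_incl₂]
    refine incl₂_ext ?_
    rw [← beta_incl₂, mul'_beta_incl₂, ← h1, ← h2]
    simp [chiWord, wordOp]
  exact LinearMap.congr_fun h x

theorem chiWord_zero_left (j : ℕ) : chiWord 0 j = [] :=
  List.eq_nil_of_length_eq_zero (by rw [length_chiWord, zero_mul])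

theorem beta_one_tmul (x : TV K V) : beta σ (1 ⊗ₜ x) = x ⊗ₜ 1 := by
  have h : beta σ ∘ₗ TensorProduct.mk K _ (TV K V) 1 = (TensorProduct.mk K _ _).flip 1 := by
    refine tv_ext fun n x => ?_
    have h1 : (1 : TV K V) ⊗ₜ[K] incl K V n x = incl₂ K V 0 n (TensorPower.algebraMap₀ 1 ⊗ₜ x) := by
      rw [TensorProduct.map_tmul, ← one_eq_incl]
    have h2 : incl K V n x ⊗ₜ[K] (1 : TV K V) = incl₂ K V n 0 (x ⊗ₜ TensorPower.algebraMap₀ 1) := by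
      rw [TensorProduct.map_tmul, ← one_eq_incl]
    simp only [LinearMap.comp_apply, LinearMap.flip_apply, TensorProduct.mk_apply]
    rw [h1, h2, beta_incl₂]
    refine incl₂_ext ?_
    rw [← beta_incl₂, mul'_beta_incl₂, ← h1, ← h2]
    simp [chiWord_zero_left, wordOp]
  exact LinearMap.congr_fun h x

variable (K V) in
/-- The map `x ⊗ y ↦ x y₁`, where `y₁` is the part of `y` of degree one. -/
def snocMul : TV K V ⊗[K] TV K V →ₗ[K] TV K V :=
  LinearMap.mul' K (TV K V) ∘ₗ (degProj K V 1).lTensor (TV K V)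

theorem snocMul_tmul (x y : TV K V) : snocMul K V (x ⊗ₜ y) = x * degProj K V 1 y := rfl

/-- Moving `x` past `y v` is moving it past `y` and then past the letter `v`, by the recursion for the
words of `χ_{ij}`. -/
theorem mul'_beta_snocMul (i j : ℕ) (x y z : TV K V) :
    LinearMap.mul' K (TV K V) (beta σ (degProj K V i x ⊗ₜ snocMul K V (degProj K V j y ⊗ₜ z))) =
      LinearMap.mul' K (TV K V) ((snocMul K V).rTensor (TV K V)
        ((TensorProduct.assoc K _ _ _).symm ((beta σ).lTensor (TV K V)
          (TensorProduct.assoc K _ _ _ (beta σ (degProj K V i x ⊗ₜ degProj K V j y) ⊗ₜ z))))) := by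
  obtain ⟨x', hx⟩ : ∃ x', degProj K V i x = incl K V i x' := ⟨_, rfl⟩
  obtain ⟨y', hy⟩ : ∃ y', degProj K V j y = incl K V j y' := ⟨_, rfl⟩
  obtain ⟨v, hv⟩ : ∃ v, degProj K V 1 z = incl₁ v := ⟨projV K V z, by rw [degProj_one]; rfl⟩
  have h1 : ∀ (a : TV K V) (t : TV K V ⊗[K] TV K V), LinearMap.mul' K (TV K V)
      ((snocMul K V).rTensor (TV K V) ((TensorProduct.assoc K _ _ _).symm (a ⊗ₜ t))) =
      a * LinearMap.mul' K (TV K V) ((degProj K V 1).rTensor (TV K V) t) := by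
    intro a t
    induction t using TensorProduct.induction_on with
    | zero => simp
    | add s t hs ht => simp only [TensorProduct.tmul_add, map_add, hs, ht, mul_add]
    | tmul s t => simp [snocMul_tmul, mul_assoc]
  have h2 : ∀ p : (⨂[K]^j V) ⊗[K] (⨂[K]^i V), LinearMap.mul' K (TV K V)
      ((snocMul K V).rTensor (TV K V) ((TensorProduct.assoc K _ _ _).symm
        ((beta σ).lTensor (TV K V) (TensorProduct.assoc K _ _ _ (incl₂ K V j i p ⊗ₜ z))))) =
      wordOp σ ((List.range i).map (j + ·))
        (LinearMap.mul' K (TV K V) (incl₂ K V j i p) * incl₁ v) := by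
    intro p
    induction p using TensorProduct.induction_on with
    | zero => simp
    | add s t hs ht => simp only [TensorProduct.add_tmul, map_add, hs, ht, add_mul]
    | tmul s t =>
      have h3 := LinearMap.congr_fun (beta_lTensor_degProj σ 1) (incl K V i t ⊗ₜ z)
      simp only [LinearMap.comp_apply, LinearMap.lTensor_tmul] at h3
      rw [TensorProduct.map_tmul, TensorProduct.assoc_tmul, LinearMap.lTensor_tmul, h1, ← h3, hv,
        incl₁, LinearMap.comp_apply, mul'_beta_tmul, chiWord_one, ← wordOp_incl_mul,
        LinearMap.mul'_apply, mul_assoc]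
  rw [snocMul_tmul, hx, hy, hv, mul'_beta_mul_incl₁]
  have h4 : incl K V i x' ⊗ₜ[K] incl K V j y' = incl₂ K V i j (x' ⊗ₜ y') := rfl
  rw [h4, beta_incl₂, h2]

/-- Moving `x v`, with a letter `v`, past a further letter is moving first `v` and then `x` past it. -/
theorem mul'_beta_snocMul_tmul (i : ℕ) (x y z : TV K V) :
    LinearMap.mul' K (TV K V) (beta σ (snocMul K V (degProj K V i x ⊗ₜ y) ⊗ₜ degProj K V 1 z)) =
      LinearMap.mul' K (TV K V) ((snocMul K V).lTensor (TV K V) (TensorProduct.assoc K _ _ _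
        ((beta σ).rTensor (TV K V) ((TensorProduct.assoc K _ _ _).symm
          (degProj K V i x ⊗ₜ beta σ (y ⊗ₜ degProj K V 1 z)))))) := by
  obtain ⟨x', hx⟩ : ∃ x', degProj K V i x = incl K V i x' := ⟨_, rfl⟩
  obtain ⟨u, hu⟩ : ∃ v, degProj K V 1 y = incl₁ v := ⟨projV K V y, by rw [degProj_one]; rfl⟩
  obtain ⟨v, hv⟩ : ∃ v, degProj K V 1 z = incl₁ v := ⟨projV K V z, by rw [degProj_one]; rfl⟩
  have h0 : ∀ (t : TV K V ⊗[K] TV K V) (b : TV K V), LinearMap.mul' K (TV K V)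
      ((snocMul K V).lTensor (TV K V) (TensorProduct.assoc K _ _ _ (t ⊗ₜ b))) =
      LinearMap.mul' K (TV K V) t * degProj K V 1 b := by
    intro t b
    induction t using TensorProduct.induction_on with
    | zero => simp
    | add s t hs ht => simp only [TensorProduct.add_tmul, map_add, hs, ht, add_mul]
    | tmul s t => simp [snocMul_tmul, mul_assoc]
  have h1 : ∀ a b : TV K V, LinearMap.mul' K (TV K V) ((snocMul K V).lTensor (TV K V)
      (TensorProduct.assoc K _ _ _ ((beta σ).rTensor (TV K V) ((TensorProduct.assoc K _ _ _).symm
        (incl K V i x' ⊗ₜ (a ⊗ₜ b)))))) =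
      LinearMap.mul' K (TV K V) (beta σ (incl K V i x' ⊗ₜ a)) * degProj K V 1 b := fun a b => by
    rw [TensorProduct.assoc_symm_tmul, LinearMap.rTensor_tmul, h0]
  have h2 : ∀ t : TV K V ⊗[K] TV K V, LinearMap.mul' K (TV K V) ((snocMul K V).lTensor (TV K V)
      (TensorProduct.assoc K _ _ _ ((beta σ).rTensor (TV K V) ((TensorProduct.assoc K _ _ _).symm
        (incl K V i x' ⊗ₜ t))))) = LinearMap.mul' K (TV K V) ((snocMul K V).lTensor (TV K V)
      (TensorProduct.assoc K _ _ _ ((beta σ).rTensor (TV K V) ((TensorProduct.assoc K _ _ _).symm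
        (incl K V i x' ⊗ₜ (degProj K V 1).lTensor (TV K V) t))))) := by
    intro t
    induction t using TensorProduct.induction_on with
    | zero => simp
    | add s t hs ht => simp only [TensorProduct.tmul_add, map_add, hs, ht]
    | tmul s t =>
      rw [LinearMap.lTensor_tmul, h1, h1]
      exact congrArg _ (degProj_incl 1 _).symm
  have h3 := LinearMap.congr_fun (beta_rTensor_degProj σ 1) (y ⊗ₜ incl₁ v)
  simp only [LinearMap.comp_apply, LinearMap.rTensor_tmul] at h3
  have h4 : ∀ t : V ⊗[K] V, LinearMap.mul' K (TV K V) ((snocMul K V).lTensor (TV K V)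
      (TensorProduct.assoc K _ _ _ ((beta σ).rTensor (TV K V) ((TensorProduct.assoc K _ _ _).symm
        (incl K V i x' ⊗ₜ TensorProduct.map incl₁ incl₁ t))))) = wordOp σ (List.range i)
        (incl K V i x' * LinearMap.mul' K (TV K V) (TensorProduct.map incl₁ incl₁ t)) := by
    intro t
    induction t using TensorProduct.induction_on with
    | zero => simp
    | add s t hs ht => simp only [TensorProduct.tmul_add, map_add, hs, ht, mul_add]
    | tmul a b =>
      have h5 : degProj K V 1 (incl₁ b) = incl₁ b := degProj_incl 1 _
      rw [TensorProduct.map_tmul, h1, h5, LinearMap.mul'_apply, ← mul_assoc, ← incl_snoc,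
        wordOp_mul_incl₁ σ fun k hk => by have := List.mem_range.1 hk; omega]
      rw [incl₁, LinearMap.comp_apply, mul'_beta_tmul, chiWord_one, incl_snoc]
      rfl
  have h5 : ∀ t : TV K V, wordOp σ [i] t = sigmaOp σ i t := fun t => by simp [wordOp]
  rw [snocMul_tmul, hx, hu, hv, h2, ← h3, hu, ← TensorProduct.map_tmul incl₁ incl₁,
    beta_map_incl₁, h4, ← sigmaOp_mul_mul, ← h5, ← wordOp_append, ← List.range_succ,
    ← chiWord_one, ← incl_snoc]
  exact mul'_beta_tmul σ (i + 1) 1 _ _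

/-- The braiding of `T(V)` satisfies the Yang-Baxter equation in degree one. -/
theorem beta_yang_baxter (h : IsBraiding σ) (t : (V ⊗[K] V) ⊗[K] V) :
    act₂ (beta σ) (act₁ (beta σ) (act₂ (beta σ)
        (TensorProduct.map (TensorProduct.map incl₁ incl₁) incl₁ t))) =
      act₁ (beta σ) (act₂ (beta σ) (act₁ (beta σ)
        (TensorProduct.map (TensorProduct.map incl₁ incl₁) incl₁ t))) := by
  have h1 : ∀ t : (V ⊗[K] V) ⊗[K] V,
      act₁ (beta σ) (TensorProduct.map (TensorProduct.map incl₁ incl₁) incl₁ t) =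
        TensorProduct.map (TensorProduct.map incl₁ incl₁) incl₁ (act₁ σ t) := by
    intro t
    have : act₁ (beta σ) ∘ₗ TensorProduct.map (TensorProduct.map incl₁ incl₁) incl₁ =
        TensorProduct.map (TensorProduct.map incl₁ incl₁) incl₁ ∘ₗ act₁ σ :=
      TensorProduct.ext' fun s v => by simp [act₁, beta_map_incl₁]
    exact LinearMap.congr_fun this t
  have h2 : ∀ t : (V ⊗[K] V) ⊗[K] V,
      act₂ (beta σ) (TensorProduct.map (TensorProduct.map incl₁ incl₁) incl₁ t) =
        TensorProduct.map (TensorProduct.map incl₁ incl₁) incl₁ (act₂ σ t) := by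
    intro t
    have h3 : ∀ t : V ⊗[K] (V ⊗[K] V), (TensorProduct.assoc K _ _ _).symm
        (TensorProduct.map incl₁ (TensorProduct.map incl₁ incl₁) t) =
        TensorProduct.map (TensorProduct.map incl₁ incl₁) incl₁
          ((TensorProduct.assoc K _ _ _).symm t) := fun t => by
      rw [LinearEquiv.symm_apply_eq]
      obtain ⟨t, rfl⟩ := (TensorProduct.assoc K V V V).surjective t
      rw [LinearEquiv.symm_apply_apply]
      have : TensorProduct.map incl₁ (TensorProduct.map incl₁ incl₁) ∘ₗ
          (TensorProduct.assoc K V V V).toLinearMap =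
          (TensorProduct.assoc K (TV K V) (TV K V) (TV K V)).toLinearMap ∘ₗ
            TensorProduct.map (TensorProduct.map incl₁ incl₁) incl₁ :=
        TensorProduct.ext_threefold fun x y z => by simp
      exact LinearMap.congr_fun this t
    have : act₂ (beta σ) ∘ₗ TensorProduct.map (TensorProduct.map incl₁ incl₁) incl₁ =
        TensorProduct.map (TensorProduct.map incl₁ incl₁) incl₁ ∘ₗ act₂ σ :=
      TensorProduct.ext_threefold fun x y z => by
        have h4 := beta_map_incl₁ σ (y ⊗ₜ z)
        rw [TensorProduct.map_tmul] at h4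
        simp only [act₂, LinearMap.comp_apply, LinearEquiv.coe_coe, TensorProduct.map_tmul,
          TensorProduct.assoc_tmul, LinearMap.lTensor_tmul, h4]
        rw [← h3, TensorProduct.map_tmul]
    exact LinearMap.congr_fun this t
  have h3 := LinearMap.congr_fun h.yang_baxter t
  simp only [LinearMap.comp_apply] at h3
  rw [h2, h1, h2, h1, h2, h1, h3]

theorem op_act₁ (τ : TV K V ⊗[K] TV K V →ₗ[K] TV K V ⊗[K] TV K V) :
    op W (act₁ τ) = sh (wh K W (TV K V)) 1 (op W τ) := by
  rw [act₁, op_rTensor, wh_TV]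

theorem op_act₂ (τ : TV K V ⊗[K] TV K V →ₗ[K] TV K V ⊗[K] TV K V) : op W (act₂ τ) = op W τ := by
  simp only [act₂, op_comp, op_lTensor, op_assoc, op_assoc_symm, mul_one, one_mul]

variable (W) in
theorem op_snocMul : op W (snocMul K V) = snocOp (opC K V W) (opQ K V W) := by
  rw [snocMul, op_comp, op_lTensor]; rfl

variable (W) {σ} in
/-- The relations of the braiding of `T(V)`. -/
theorem braidRel (h : IsBraiding σ) :
    BraidRel (wh K W (TV K V)) (opU K V W) (opC K V W) (opB K W σ) (opQ K V W) := by
  have hwq : ∀ n, opB K W σ * sh (wh K W (TV K V)) 1 (opQ K V W n) = opQ K V W n * opB K W σ :=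
    fun n => by
      simpa only [opB, opQ, op_comp, op_rTensor, op_lTensor, wh_TV] using
        congrArg (op W) (beta_rTensor_degProj σ n)
  have hq : ∀ n, opB K W σ * opQ K V W n = sh (wh K W (TV K V)) 1 (opQ K V W n) * opB K W σ :=
    fun n => by
      simpa only [opB, opQ, op_comp, op_rTensor, op_lTensor, wh_TV] using
        congrArg (op W) (beta_lTensor_degProj σ n)
  have H := tensorRel K V W
  refine ⟨hwq, hq, ?_, ?_, H.b_snocOp_of_c hwq hq fun i j => ?_,
    H.b_wsnocOp_of_c hwq hq fun i => ?_, ?_⟩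
  · have h : beta σ ∘ₗ (Algebra.linearMap K (TV K V)).lTensor (TV K V) ∘ₗ
        (TensorProduct.rid K _).symm.toLinearMap =
        (Algebra.linearMap K (TV K V)).rTensor (TV K V) ∘ₗ
        (TensorProduct.lid K _).symm.toLinearMap :=
      LinearMap.ext fun x => by simp [beta_tmul_one]
    simpa only [sh_zero, opU, opB, op_comp, op_lTensor, op_rTensor, op_rid_symm, op_lid_symm,
      mul_one, wh_TV] using congrArg (op W) h
  · have h : beta σ ∘ₗ (Algebra.linearMap K (TV K V)).rTensor (TV K V) ∘ₗ
        (TensorProduct.lid K _).symm.toLinearMap =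
        (Algebra.linearMap K (TV K V)).lTensor (TV K V) ∘ₗ
        (TensorProduct.rid K _).symm.toLinearMap :=
      LinearMap.ext fun x => by simp [beta_one_tmul]
    simpa only [sh_zero, opU, opB, op_comp, op_lTensor, op_rTensor, op_rid_symm, op_lid_symm,
      mul_one, wh_TV] using congrArg (op W) h
  · have h : LinearMap.mul' K (TV K V) ∘ₗ beta σ ∘ₗ (snocMul K V).lTensor (TV K V) ∘ₗ
        (TensorProduct.assoc K _ _ _).toLinearMap ∘ₗ
        (TensorProduct.map (degProj K V i) (degProj K V j)).rTensor (TV K V) =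
        LinearMap.mul' K (TV K V) ∘ₗ (snocMul K V).rTensor (TV K V) ∘ₗ
        (TensorProduct.assoc K _ _ _).symm.toLinearMap ∘ₗ (beta σ).lTensor (TV K V) ∘ₗ
        (TensorProduct.assoc K _ _ _).toLinearMap ∘ₗ (beta σ).rTensor (TV K V) ∘ₗ
        (TensorProduct.map (degProj K V i) (degProj K V j)).rTensor (TV K V) :=
      TensorProduct.ext_threefold fun x y z => mul'_beta_snocMul σ i j x y z
    have h1 := congrArg (op W) h
    simp only [op_comp, op_lTensor, op_rTensor, op_assoc, op_assoc_symm, one_mul, wh_TV,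
      op_map', map_mul, sh_sh, op_snocMul] at h1
    exact h1
  · have h : LinearMap.mul' K (TV K V) ∘ₗ beta σ ∘ₗ (snocMul K V).rTensor (TV K V) ∘ₗ
        TensorProduct.map ((degProj K V i).rTensor (TV K V)) (degProj K V 1) =
        LinearMap.mul' K (TV K V) ∘ₗ (snocMul K V).lTensor (TV K V) ∘ₗ
        (TensorProduct.assoc K _ _ _).toLinearMap ∘ₗ (beta σ).rTensor (TV K V) ∘ₗ
        (TensorProduct.assoc K _ _ _).symm.toLinearMap ∘ₗ (beta σ).lTensor (TV K V) ∘ₗ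
        (TensorProduct.assoc K _ _ _).toLinearMap ∘ₗ
        TensorProduct.map ((degProj K V i).rTensor (TV K V)) (degProj K V 1) :=
      TensorProduct.ext_threefold fun x y z => mul'_beta_snocMul_tmul σ i x y z
    have h1 := congrArg (op W) h
    simp only [op_comp, op_lTensor, op_rTensor, op_assoc, op_assoc_symm, one_mul, wh_TV,
      op_map', sh_sh, op_snocMul] at h1
    exact h1
  · have h2 : TensorProduct.map (TensorProduct.map (degProj K V 1) (degProj K V 1)) (degProj K V 1) =
        TensorProduct.map (TensorProduct.map incl₁ incl₁) incl₁ ∘ₗ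
        TensorProduct.map (TensorProduct.map (projV K V) (projV K V)) (projV K V) := by
      rw [← TensorProduct.map_comp, ← TensorProduct.map_comp, degProj_one]
    have h3 : act₂ (beta σ) ∘ₗ act₁ (beta σ) ∘ₗ act₂ (beta σ) ∘ₗ
        TensorProduct.map (TensorProduct.map (degProj K V 1) (degProj K V 1)) (degProj K V 1) =
        act₁ (beta σ) ∘ₗ act₂ (beta σ) ∘ₗ act₁ (beta σ) ∘ₗ
        TensorProduct.map (TensorProduct.map (degProj K V 1) (degProj K V 1)) (degProj K V 1) := by
      rw [h2]
      exact LinearMap.ext fun t => beta_yang_baxter σ h _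
    have h1 := congrArg (op W) h3
    simp only [op_comp, op_act₁, op_act₂, op_map', wh_TV, map_mul, sh_sh, mul_assoc,
      Nat.reduceAdd] at h1
    exact H.yang_baxter_of hwq hq h1

end BraidTranslation

/-! ### The maps of a quantum `B_∞`-algebra -/

section StarTranslation

variable {K V W : Type*} [Field K] [AddCommGroup V] [Module K V] [AddCommGroup W] [Module K W]
  [Strand K W (TV K V)] (σ : V ⊗[K] V →ₗ[K] V ⊗[K] V)
  (M : ∀ p q : ℕ, (⨂[K]^p V) ⊗[K] (⨂[K]^q V) →ₗ[K] V)

variable (W) in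
/-- The map `M : T(V) ⊗ T(V) → V ⊆ T(V)` as an operation. -/
def opM : Module.End K W := op W (incl₁ ∘ₗ ofBidegrees M)

variable (W) in
/-- The product `∗` as an operation. -/
def opS : Module.End K W := op W (star σ M)

variable (W) in
/-- The map `M^{⊗(n+1)} ∘ \bar Δ_β^{(n)}` as an operation. -/
def opN (n : ℕ) : Module.End K W := op W (incl K V (n + 1) ∘ₗ starPow σ M n)

instance : Letter (wh K W (TV K V)) (opM W M) 2 1 1 := letter_op K W _ wh_TV₂ wh_TV
instance : Letter (wh K W (TV K V)) (opS W σ M) 2 1 1 := letter_op K W _ wh_TV₂ wh_TV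

variable {σ M}

/-- Multiplying by the unit, `M` becomes the projection onto the degree one. -/
theorem incl₁_ofBidegrees_one (h : IsQuantumBInfty σ M) (x : TV K V) :
    incl₁ (ofBidegrees M (x ⊗ₜ 1)) = degProj K V 1 x := by
  have h1 : incl₁ ∘ₗ ofBidegrees M ∘ₗ (TensorProduct.mk K _ _).flip 1 = degProj K V 1 := by
    refine tv_ext fun n x => ?_
    have h2 : incl K V n x ⊗ₜ[K] (1 : TV K V) = incl₂ K V n 0 (x ⊗ₜ TensorPower.algebraMap₀ 1) := by
      rw [TensorProduct.map_tmul, ← one_eq_incl]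
    simp only [LinearMap.comp_apply, LinearMap.flip_apply, TensorProduct.mk_apply]
    rw [h2, ofBidegrees_incl₂]
    match n, x with
    | 0, x => rw [h.zero_zero, degProj_incl_of_ne (by norm_num), LinearMap.zero_apply, map_zero]
    | 1, x =>
      obtain ⟨v, rfl⟩ := (toPowOne K V).surjective x
      rw [h.one_zero, degProj_incl]; rfl
    | n + 2, x =>
      rw [h.left_zero _ (by omega), degProj_incl_of_ne (by omega), LinearMap.zero_apply, map_zero]
  exact LinearMap.congr_fun h1 x

theorem incl₁_ofBidegrees_one_left (h : IsQuantumBInfty σ M) (x : TV K V) :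
    incl₁ (ofBidegrees M (1 ⊗ₜ x)) = degProj K V 1 x := by
  have h1 : incl₁ ∘ₗ ofBidegrees M ∘ₗ TensorProduct.mk K _ _ 1 = degProj K V 1 := by
    refine tv_ext fun n x => ?_
    have h2 : (1 : TV K V) ⊗ₜ[K] incl K V n x = incl₂ K V 0 n (TensorPower.algebraMap₀ 1 ⊗ₜ x) := by
      rw [TensorProduct.map_tmul, ← one_eq_incl]
    simp only [LinearMap.comp_apply, TensorProduct.mk_apply]
    rw [h2, ofBidegrees_incl₂]
    match n, x with
    | 0, x => rw [h.zero_zero, degProj_incl_of_ne (by norm_num), LinearMap.zero_apply, map_zero]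
    | 1, x =>
      obtain ⟨v, rfl⟩ := (toPowOne K V).surjective x
      rw [h.zero_one, degProj_incl]; rfl
    | n + 2, x =>
      rw [h.right_zero _ (by omega), degProj_incl_of_ne (by omega), LinearMap.zero_apply, map_zero]
  exact LinearMap.congr_fun h1 x

variable (M) in
theorem ofBidegrees_cut_comp_incl (i j : ℕ) :
    incl₁ ∘ₗ ofBidegrees M ∘ₗ cut i j ∘ₗ incl K V (i + j) =
      incl K V 1 ∘ₗ (toPowOne K V).toLinearMap ∘ₗ M i j ∘ₗ TensorPower.mulEquiv.symm.toLinearMap :=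
  LinearMap.ext fun x => by
    simp only [LinearMap.comp_apply]
    rw [cut_incl, ofBidegrees_incl₂]; rfl

/-- The first braid relation of a quantum `B_∞`-algebra, inside `T(V)`. -/
theorem beta_rTensor_ofBidegrees (h : IsQuantumBInfty σ M) {i j k : ℕ} (hi : 1 ≤ i) (hj : 1 ≤ j)
    (hk : 1 ≤ k) :
    beta σ ∘ₗ (incl₁ ∘ₗ ofBidegrees M).rTensor (TV K V) ∘ₗ
        TensorProduct.map (TensorProduct.map (degProj K V i) (degProj K V j)) (degProj K V k) =
      (incl₁ ∘ₗ ofBidegrees M ∘ₗ cut i j).lTensor (TV K V) ∘ₗ beta σ ∘ₗ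
        (LinearMap.mul' K (TV K V)).rTensor (TV K V) ∘ₗ
        TensorProduct.map (TensorProduct.map (degProj K V i) (degProj K V j)) (degProj K V k) := by
  refine TensorProduct.ext_threefold fun x y z => ?_
  obtain ⟨x', hx⟩ : ∃ x', degProj K V i x = incl K V i x' := ⟨_, rfl⟩
  obtain ⟨y', hy⟩ : ∃ y', degProj K V j y = incl K V j y' := ⟨_, rfl⟩
  obtain ⟨z', hz⟩ : ∃ z', degProj K V k z = incl K V k z' := ⟨_, rfl⟩
  have h1 : incl₁ (ofBidegrees M (incl K V i x' ⊗ₜ incl K V j y')) ⊗ₜ[K] incl K V k z' =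
      incl₂ K V 1 k (toPowOne K V (M i j (x' ⊗ₜ y')) ⊗ₜ z') := by
    rw [← TensorProduct.map_tmul (incl K V i), ofBidegrees_incl₂]; rfl
  have h2 : incl K V (i + j) (TensorPower.mulEquiv (x' ⊗ₜ[K] y')) ⊗ₜ[K] incl K V k z' =
      incl₂ K V (i + j) k (TensorPower.mulEquiv (x' ⊗ₜ y') ⊗ₜ z') := rfl
  have h3 := LinearMap.congr_fun (h.yang_baxter_left i j k hi hj hk) ((x' ⊗ₜ y') ⊗ₜ z')
  simp only [LinearMap.comp_apply, LinearMap.rTensor_tmul, LinearEquiv.coe_coe] at h3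
  simp only [LinearMap.comp_apply, TensorProduct.map_tmul, LinearMap.rTensor_tmul,
    LinearMap.mul'_apply, hx, hy, hz]
  rw [h1, incl_mul_incl, h2, beta_incl₂, beta_incl₂, h3, ← LinearMap.comp_apply (incl₂ K V k 1),
    LinearMap.map_comp_lTensor, ← LinearMap.comp_apply (LinearMap.lTensor _ _),
    LinearMap.lTensor_comp_map, ← ofBidegrees_cut_comp_incl]
  rfl

/-- The second braid relation of a quantum `B_∞`-algebra, inside `T(V)`. -/
theorem beta_lTensor_ofBidegrees (h : IsQuantumBInfty σ M) {i j k : ℕ} (hi : 1 ≤ i) (hj : 1 ≤ j)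
    (hk : 1 ≤ k) :
    beta σ ∘ₗ (incl₁ ∘ₗ ofBidegrees M).lTensor (TV K V) ∘ₗ (TensorProduct.assoc K _ _ _).toLinearMap ∘ₗ
        TensorProduct.map (TensorProduct.map (degProj K V i) (degProj K V j)) (degProj K V k) =
      (incl₁ ∘ₗ ofBidegrees M ∘ₗ cut j k).rTensor (TV K V) ∘ₗ beta σ ∘ₗ
        (LinearMap.mul' K (TV K V)).lTensor (TV K V) ∘ₗ (TensorProduct.assoc K _ _ _).toLinearMap ∘ₗ
        TensorProduct.map (TensorProduct.map (degProj K V i) (degProj K V j)) (degProj K V k) := by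
  refine TensorProduct.ext_threefold fun x y z => ?_
  obtain ⟨x', hx⟩ : ∃ x', degProj K V i x = incl K V i x' := ⟨_, rfl⟩
  obtain ⟨y', hy⟩ : ∃ y', degProj K V j y = incl K V j y' := ⟨_, rfl⟩
  obtain ⟨z', hz⟩ : ∃ z', degProj K V k z = incl K V k z' := ⟨_, rfl⟩
  have h1 : incl K V i x' ⊗ₜ[K] incl₁ (ofBidegrees M (incl K V j y' ⊗ₜ incl K V k z')) =
      incl₂ K V i 1 (x' ⊗ₜ toPowOne K V (M j k (y' ⊗ₜ z'))) := by
    rw [← TensorProduct.map_tmul (incl K V j), ofBidegrees_incl₂]; rfl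
  have h2 : incl K V i x' ⊗ₜ[K] incl K V (j + k) (TensorPower.mulEquiv (y' ⊗ₜ[K] z')) =
      incl₂ K V i (j + k) (x' ⊗ₜ TensorPower.mulEquiv (y' ⊗ₜ z')) := rfl
  have h3 := LinearMap.congr_fun (h.yang_baxter_right i j k hi hj hk) (x' ⊗ₜ (y' ⊗ₜ z'))
  simp only [LinearMap.comp_apply, LinearMap.lTensor_tmul, LinearEquiv.coe_coe] at h3
  simp only [LinearMap.comp_apply, TensorProduct.map_tmul, LinearMap.lTensor_tmul,
    LinearEquiv.coe_coe, TensorProduct.assoc_tmul, LinearMap.mul'_apply, hx, hy, hz]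
  rw [h1, incl_mul_incl, h2, beta_incl₂, beta_incl₂, h3, ← LinearMap.comp_apply (incl₂ K V 1 i),
    LinearMap.map_comp_rTensor, ← LinearMap.comp_apply (LinearMap.rTensor _ _),
    LinearMap.rTensor_comp_map, ← ofBidegrees_cut_comp_incl]
  rfl

variable (W) in
theorem mulRel (h : IsQuantumBInfty σ M) :
    MulRel (wh K W (TV K V)) (opU K V W) (opB K W σ) (opM W M) (opQ K V W) := by
  have hu : sh (wh K W (TV K V)) 0 (opM W M) * sh (wh K W (TV K V)) 0 (opU K V W) =
      sh (wh K W (TV K V)) 0 (opQ K V W 1) := by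
    have h1 : (incl₁ ∘ₗ ofBidegrees M) ∘ₗ (Algebra.linearMap K (TV K V)).lTensor (TV K V) ∘ₗ
        (TensorProduct.rid K _).symm.toLinearMap = degProj K V 1 :=
      LinearMap.ext fun x => by simpa using incl₁_ofBidegrees_one h x
    simpa only [sh_zero, opU, opM, opQ, op_comp, op_lTensor, op_rid_symm, mul_one] using
      congrArg (op W) h1
  have hwu : sh (wh K W (TV K V)) 0 (opM W M) * sh (wh K W (TV K V)) 1 (opU K V W) =
      sh (wh K W (TV K V)) 0 (opQ K V W 1) := by
    have h1 : (incl₁ ∘ₗ ofBidegrees M) ∘ₗ (Algebra.linearMap K (TV K V)).rTensor (TV K V) ∘ₗ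
        (TensorProduct.lid K _).symm.toLinearMap = degProj K V 1 :=
      LinearMap.ext fun x => by simpa using incl₁_ofBidegrees_one_left h x
    simpa only [sh_zero, opU, opM, opQ, op_comp, op_rTensor, op_lid_symm, mul_one, wh_TV] using
      congrArg (op W) h1
  have H := tensorRel K V W
  have B := braidRel W h.braiding
  refine ⟨?_, hu, hwu, MulRel.b_wm_of_pos H B hu hwu fun i j k hi hj hk => ?_,
    MulRel.b_m_of_pos H B hu hwu fun i j k hi hj hk => ?_⟩
  · have h1 : degProj K V 1 ∘ₗ incl₁ ∘ₗ ofBidegrees M = incl₁ ∘ₗ ofBidegrees M :=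
      LinearMap.ext fun x => degProj_incl 1 _
    have h2 := congrArg (op W) h1
    rwa [op_comp] at h2
  · have h1 := congrArg (op W) (beta_rTensor_ofBidegrees h hi hj hk)
    rw [← map_degProj_deconc, ← LinearMap.comp_assoc _ _ incl₁] at h1
    simp only [op_comp (W := W) (beta σ), op_comp (W := W) (incl₁ ∘ₗ ofBidegrees M),
      op_comp (W := W) (LinearMap.lTensor _ _),
      op_comp (W := W) (LinearMap.rTensor _ _), op_comp (W := W) (TensorProduct.map _ _),
      op_lTensor, op_rTensor, op_map', wh_TV, map_mul, sh_sh, mul_assoc, Nat.reduceAdd] at h1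
    exact h1
  · have h1 := congrArg (op W) (beta_lTensor_ofBidegrees h hi hj hk)
    rw [← map_degProj_deconc, ← LinearMap.comp_assoc _ _ incl₁] at h1
    simp only [op_comp (W := W) (beta σ), op_comp (W := W) (incl₁ ∘ₗ ofBidegrees M),
      op_comp (W := W) (LinearMap.lTensor _ _), op_comp (W := W) (LinearEquiv.toLinearMap _),
      op_comp (W := W) (LinearMap.rTensor _ _), op_comp (W := W) (TensorProduct.map _ _), op_assoc,
      one_mul, op_lTensor, op_rTensor, op_map', wh_TV, map_mul, sh_sh, mul_assoc, Nat.reduceAdd] at h1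
    exact h1

end StarTranslation

/-! ### Iterated coproducts -/

section Iterates

variable {K C A : Type*} [Field K] [AddCommGroup C] [Module K C] [AddCommGroup A] [Module K A]

theorem toPowOne_apply (x : C) : toPowOne K C x = PiTensorProduct.tprod K fun _ => x := by
  rw [toPowOne, LinearEquiv.symm_apply_eq]
  simp

theorem mulEquiv_tprod_tprod {m n : ℕ} (x : Fin m → C) (y : Fin n → C) :
    TensorPower.mulEquiv (PiTensorProduct.tprod K x ⊗ₜ[K] PiTensorProduct.tprod K y) =
      PiTensorProduct.tprod K (Fin.append x y) :=
  TensorPower.tprod_mul_tprod K x y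

theorem piMap_toPowOne (g : C →ₗ[K] A) (x : C) :
    PiTensorProduct.map (fun _ : Fin 1 => g) (toPowOne K C x) = toPowOne K A (g x) := by
  rw [toPowOne_apply, toPowOne_apply, PiTensorProduct.map_tprod]

theorem piMap_mulEquiv (g : C →ₗ[K] A) (m n : ℕ) (z : (⨂[K]^m C) ⊗[K] (⨂[K]^n C)) :
    PiTensorProduct.map (fun _ : Fin (m + n) => g) (TensorPower.mulEquiv z) =
      TensorPower.mulEquiv (TensorProduct.map (PiTensorProduct.map fun _ => g)
        (PiTensorProduct.map fun _ => g) z) := by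
  have h : PiTensorProduct.map (fun _ : Fin (m + n) => g) ∘ₗ TensorPower.mulEquiv.toLinearMap =
      TensorPower.mulEquiv.toLinearMap ∘ₗ TensorProduct.map (PiTensorProduct.map fun _ => g)
        (PiTensorProduct.map fun _ => g) := by
    refine TensorProduct.ext (PiTensorProduct.ext ?_)
    ext x : 1
    refine PiTensorProduct.ext ?_
    ext y
    change PiTensorProduct.map (fun _ : Fin (m + n) => g) (TensorPower.mulEquiv
      (PiTensorProduct.tprod K x ⊗ₜ[K] PiTensorProduct.tprod K y)) = TensorPower.mulEquiv
        (PiTensorProduct.map (fun _ => g) (PiTensorProduct.tprod K x) ⊗ₜ[K]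
          PiTensorProduct.map (fun _ => g) (PiTensorProduct.tprod K y))
    rw [mulEquiv_tprod_tprod, PiTensorProduct.map_tprod, PiTensorProduct.map_tprod,
      PiTensorProduct.map_tprod, mulEquiv_tprod_tprod]
    congr 1
    funext i
    refine Fin.addCases (fun i => ?_) (fun i => ?_) i <;> simp
  exact LinearMap.congr_fun h z

theorem piMap_snoc (g : C →ₗ[K] A) (n : ℕ) (z : (⨂[K]^n C) ⊗[K] C) :
    PiTensorProduct.map (fun _ : Fin (n + 1) => g) (snoc K C n z) =
      snoc K A n (TensorProduct.map (PiTensorProduct.map fun _ => g) g z) := by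
  induction z using TensorProduct.induction_on with
  | zero => simp
  | add x y hx hy => simp only [map_add, hx, hy]
  | tmul x y =>
    simp only [snoc, LinearEquiv.trans_apply, TensorProduct.congr_tmul, LinearEquiv.refl_apply,
      TensorProduct.map_tmul]
    rw [piMap_mulEquiv, TensorProduct.map_tmul, piMap_toPowOne]

/-- Applying `g` to all factors of the iterates `D^{(n)}` gives a recursion. The coalgebra is taken to
be a tensor square, so that only the instances on `T` are unified when the lemma is applied. -/
theorem piMap_iter_succ {T : Type*} [AddCommGroup T] [Module K T] (g : T ⊗[K] T →ₗ[K] A)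
    (D : T ⊗[K] T →ₗ[K] (T ⊗[K] T) ⊗[K] (T ⊗[K] T)) (n : ℕ) :
    PiTensorProduct.map (fun _ : Fin (n + 1 + 1) => g) ∘ₗ iter D (n + 1) =
      (snoc K A (n + 1)).toLinearMap ∘ₗ TensorProduct.map
        (PiTensorProduct.map (fun _ : Fin (n + 1) => g) ∘ₗ iter D n) g ∘ₗ D := by
  refine LinearMap.ext fun x => ?_
  simp only [iter, LinearMap.comp_apply, LinearEquiv.coe_coe]
  rw [piMap_snoc, ← LinearMap.comp_apply (TensorProduct.map _ _), LinearMap.map_comp_rTensor]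

/-- The reduced coproduct and the two terms removed from the coproduct. -/
theorem eq_reduced_add {T : Type*} [AddCommGroup T] [Module K T]
    (Δ : T ⊗[K] T →ₗ[K] (T ⊗[K] T) ⊗[K] (T ⊗[K] T)) (e : T ⊗[K] T) :
    Δ = reduced Δ e + (TensorProduct.mk K _ _).flip e + TensorProduct.mk K _ _ e := by
  rw [reduced]; abel

end Iterates

/-! ### The product `∗` as a word -/

section StarIterates

variable {K V W : Type*} [Field K] [AddCommGroup V] [Module K V] [AddCommGroup W] [Module K W]
  [Strand K W (TV K V)] (σ : V ⊗[K] V →ₗ[K] V ⊗[K] V)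
  (M : ∀ p q : ℕ, (⨂[K]^p V) ⊗[K] (⨂[K]^q V) →ₗ[K] V)

theorem starPow_succ (n : ℕ) : starPow σ M (n + 1) = (snoc K V (n + 1)).toLinearMap ∘ₗ
    TensorProduct.map (starPow σ M n) (ofBidegrees M) ∘ₗ
      reduced (C := TV K V ⊗[K] TV K V) (comulBeta σ) (1 ⊗ₜ[K] 1) := by
  exact piMap_iter_succ (T := TV K V) _ _ _

theorem comulBeta_eq_reduced_add : comulBeta σ =
    reduced (C := TV K V ⊗[K] TV K V) (comulBeta σ) (1 ⊗ₜ[K] 1) +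
      (TensorProduct.mk K (TV K V ⊗[K] TV K V) (TV K V ⊗[K] TV K V)).flip (1 ⊗ₜ 1) +
      TensorProduct.mk K (TV K V ⊗[K] TV K V) (TV K V ⊗[K] TV K V) (1 ⊗ₜ 1) :=
  eq_reduced_add (T := TV K V) _ _

theorem incl_starPow_zero :
    incl K V (0 + 1) ∘ₗ starPow σ M 0 = incl₁ ∘ₗ ofBidegrees M :=
  LinearMap.ext fun x => congrArg (incl K V 1) (piMap_toPowOne _ x)

theorem incl_starPow_succ (n : ℕ) :
    incl K V (n + 1 + 1) ∘ₗ starPow σ M (n + 1) = LinearMap.mul' K (TV K V) ∘ₗ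
      TensorProduct.map (incl K V (n + 1) ∘ₗ starPow σ M n) (incl₁ ∘ₗ ofBidegrees M) ∘ₗ
        reduced (C := TV K V ⊗[K] TV K V) (comulBeta σ) (1 ⊗ₜ[K] 1) := by
  have h1 : incl K V (n + 1 + 1) ∘ₗ (snoc K V (n + 1)).toLinearMap =
      LinearMap.mul' K (TV K V) ∘ₗ TensorProduct.map (incl K V (n + 1)) incl₁ :=
    TensorProduct.ext' fun x v => incl_snoc (n + 1) x v
  rw [starPow_succ, ← LinearMap.comp_assoc, h1, TensorProduct.map_comp]
  rfl

variable (W) in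
theorem op_comulBeta : op W (comulBeta σ) = comulOp (wh K W (TV K V)) (opD K V W) (opB K W σ) := by
  simp only [comulBeta, op_comp, op_assoc, op_assoc_symm, op_lTensor, op_rTensor, op_map', wh_TV₂,
    wh_TV, one_mul, mul_one]
  rfl

variable (W) in
theorem op_reduced :
    op W (reduced (C := TV K V ⊗[K] TV K V) (comulBeta σ) (1 ⊗ₜ[K] 1)) =
      sh (wh K W (TV K V)) 0 (comulOp (wh K W (TV K V)) (opD K V W) (opB K W σ)) -
        sh (wh K W (TV K V)) 0 (opU K V W) * sh (wh K W (TV K V)) 0 (opU K V W) -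
        sh (wh K W (TV K V)) 2 (opU K V W) * sh (wh K W (TV K V)) 2 (opU K V W) := by
  let e : K →ₗ[K] TV K V ⊗[K] TV K V := (Algebra.linearMap K (TV K V)).lTensor (TV K V) ∘ₗ
    (TensorProduct.rid K _).symm.toLinearMap ∘ₗ Algebra.linearMap K (TV K V)
  have he : op W e = opU K V W * opU K V W := by
    simp only [e, op_comp, op_lTensor, op_rid_symm, one_mul, opU]
  let f := (TensorProduct.mk K (TV K V ⊗[K] TV K V) (TV K V ⊗[K] TV K V)).flip (1 ⊗ₜ 1)
  let g := TensorProduct.mk K (TV K V ⊗[K] TV K V) (TV K V ⊗[K] TV K V) (1 ⊗ₜ 1)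
  have hf : op W f = opU K V W * opU K V W := by
    have h1 : f = e.lTensor _ ∘ₗ (TensorProduct.rid K _).symm.toLinearMap :=
      LinearMap.ext fun x => by simp [e, f]
    rw [h1, op_comp, op_lTensor, op_rid_symm, mul_one, he]
  have hg : op W g = sh (wh K W (TV K V)) 2 (opU K V W) * sh (wh K W (TV K V)) 2 (opU K V W) := by
    have h1 : g = e.rTensor _ ∘ₗ (TensorProduct.lid K _).symm.toLinearMap :=
      LinearMap.ext fun x => by simp [e, g]
    rw [h1, op_comp, op_rTensor, op_lid_symm, mul_one, he, wh_TV₂, map_mul]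
  have h1 := congrArg (op W) (comulBeta_eq_reduced_add σ)
  rw [op_add, op_add, op_comulBeta] at h1
  rw [sh_zero, sh_zero, h1, ← hf, ← hg]
  abel

variable (W) in
theorem op_counit₂ : op W (counit₂ K V) = opE K V W * opE K V W := by
  have h : LinearMap.mul' K K = (TensorProduct.rid K K).toLinearMap :=
    TensorProduct.ext' fun x y => by simp [mul_comm]
  rw [counit₂, h, op_comp, op_rid, one_mul, op_map', wh_unit, opE]

variable {σ M}

theorem star_incl₂ (i j : ℕ) (z : (⨂[K]^i V) ⊗[K] (⨂[K]^j V)) :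
    star σ M (incl₂ K V i j z) = counit₂ K V (incl₂ K V i j z) • (1 : TV K V) +
      ∑ n ∈ Finset.range (i + j), incl K V (n + 1) (starPow σ M n (incl₂ K V i j z)) := by
  rw [star, LinearMap.add_apply, ofBidegrees_incl₂, LinearMap.sum_apply]
  rfl

variable (σ M) in
theorem star_comp_degProj (i j : ℕ) :
    star σ M ∘ₗ TensorProduct.map (degProj K V i) (degProj K V j) =
      (Algebra.linearMap K (TV K V) ∘ₗ counit₂ K V +
        ∑ n ∈ Finset.range (i + j), incl K V (n + 1) ∘ₗ starPow σ M n) ∘ₗ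
        TensorProduct.map (degProj K V i) (degProj K V j) := by
  refine LinearMap.ext fun x => ?_
  rw [LinearMap.comp_apply, LinearMap.comp_apply]
  obtain ⟨z, hz⟩ := range_map_degProj i j x
  rw [hz, star_incl₂, LinearMap.add_apply, LinearMap.sum_apply, LinearMap.comp_apply,
    Algebra.linearMap_apply, Algebra.algebraMap_eq_smul_one]
  rfl

variable (W) in
theorem opN_zero : opN W σ M 0 = opM W M := by
  rw [opN, incl_starPow_zero]; rfl

variable (W) in
theorem opN_rec (n : ℕ) : opN W σ M (n + 1) = sh (wh K W (TV K V)) 0 (opC K V W) *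
    (sh (wh K W (TV K V)) 0 (opM W M) * (sh (wh K W (TV K V)) 2 (opN W σ M n) *
      (sh (wh K W (TV K V)) 0 (comulOp (wh K W (TV K V)) (opD K V W) (opB K W σ)) -
        sh (wh K W (TV K V)) 0 (opU K V W) * sh (wh K W (TV K V)) 0 (opU K V W) -
        sh (wh K W (TV K V)) 2 (opU K V W) * sh (wh K W (TV K V)) 2 (opU K V W)))) := by
  rw [opN, incl_starPow_succ, op_comp, op_comp, op_map, op_reduced, wh_TV₂, mul_assoc]
  rfl

variable (W) in
/-- The iterates satisfy the recursion with the coproduct in place of the reduced coproduct. -/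
theorem opN_succ (h : IsQuantumBInfty σ M) (n : ℕ) :
    opN W σ M (n + 1) = sh (wh K W (TV K V)) 0 (opC K V W) * (sh (wh K W (TV K V)) 0 (opM W M) *
      (sh (wh K W (TV K V)) 2 (opN W σ M n) *
        sh (wh K W (TV K V)) 0 (comulOp (wh K W (TV K V)) (opD K V W) (opB K W σ)))) := by
  have H := tensorRel K V W
  have B := braidRel W h.braiding
  have P := mulRel W h
  have h1 : ∀ n, sh (wh K W (TV K V)) 0 (opN W σ M n) *
      (sh (wh K W (TV K V)) 0 (opU K V W) * sh (wh K W (TV K V)) 0 (opU K V W)) = 0 := by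
    intro n
    induction n with
    | zero => rw [opN_zero]; exact P.m_units H
    | succ n ih => exact (P.iterate_eq H B ih (opN_rec W n)).2
  exact (P.iterate_eq H B (h1 n) (opN_rec W n)).1

variable (W) in
theorem starRel (h : IsQuantumBInfty σ M) :
    StarRel (wh K W (TV K V)) (opU K V W) (opC K V W) (opE K V W) (opD K V W) (opB K W σ)
      (opM W M) (opS W σ M) (opQ K V W) where
  toMulRel := mulRel W h
  s_eq := by
    refine (mulRel W h).s_eq_of_iterate (m := opM W M) (tensorRel K V W) (braidRel W h.braiding) (N := opN W σ M)
      (opN_zero W) (opN_succ W h) fun i j => ?_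
    have h1 := congrArg (op W) (star_comp_degProj σ M i j)
    rw [op_comp, op_comp, op_map', op_add, op_comp, op_counit₂, op_sum, wh_TV] at h1
    exact h1

variable (W) in
/-- The associativity condition of a quantum `B_∞`-algebra, in terms of the product. -/
theorem opM_opS (h : IsQuantumBInfty σ M) :
    sh (wh K W (TV K V)) 0 (opM W M) * sh (wh K W (TV K V)) 1 (opS W σ M) =
      sh (wh K W (TV K V)) 0 (opM W M) * sh (wh K W (TV K V)) 0 (opS W σ M) := by
  refine (starRel W h).m_s_s (tensorRel K V W) (braidRel W h.braiding) fun i j k hi hj hk => ?_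
  have h1 : (incl₁ ∘ₗ ofBidegrees M) ∘ₗ (star σ M).rTensor (TV K V) ∘ₗ
      TensorProduct.map (TensorProduct.map (degProj K V i) (degProj K V j)) (degProj K V k) =
      (incl₁ ∘ₗ ofBidegrees M) ∘ₗ (star σ M).lTensor (TV K V) ∘ₗ
      (TensorProduct.assoc K _ _ _).toLinearMap ∘ₗ
      TensorProduct.map (TensorProduct.map (degProj K V i) (degProj K V j)) (degProj K V k) := by
    refine TensorProduct.ext_threefold fun x y z => ?_
    obtain ⟨x', hx⟩ : ∃ x', degProj K V i x = incl K V i x' := ⟨_, rfl⟩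
    obtain ⟨y', hy⟩ : ∃ y', degProj K V j y = incl K V j y' := ⟨_, rfl⟩
    obtain ⟨z', hz⟩ : ∃ z', degProj K V k z = incl K V k z' := ⟨_, rfl⟩
    have h2 : ∀ {a b : ℕ} (s : ⨂[K]^a V) (t : ⨂[K]^b V), 1 ≤ a →
        star σ M (incl K V a s ⊗ₜ incl K V b t) =
          ∑ n ∈ Finset.range (a + b), incl K V (n + 1) (starPowAt σ M n a b (s ⊗ₜ t)) := by
      intro a b s t ha
      rw [← TensorProduct.map_tmul (incl K V a), star_incl₂, counit₂, LinearMap.comp_apply,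
        TensorProduct.map_tmul, TensorProduct.map_tmul, counit_incl_of_ne (by omega),
        TensorProduct.zero_tmul, map_zero, zero_smul, zero_add]
      rfl
    have h3 := LinearMap.congr_fun (h.associativity i j k hi hj hk) ((x' ⊗ₜ y') ⊗ₜ z')
    simp only [LinearMap.sum_apply, LinearMap.comp_apply, LinearMap.rTensor_tmul,
      LinearMap.lTensor_tmul, LinearEquiv.coe_coe, TensorProduct.assoc_tmul] at h3
    simp only [LinearMap.comp_apply, TensorProduct.map_tmul, LinearMap.rTensor_tmul,
      LinearMap.lTensor_tmul, LinearEquiv.coe_coe, TensorProduct.assoc_tmul, hx, hy, hz]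
    rw [h2 _ _ hi, h2 _ _ hj, TensorProduct.sum_tmul, TensorProduct.tmul_sum]
    simp only [← TensorProduct.map_tmul (incl K V _) (incl K V _), map_sum, ofBidegrees_incl₂]
    simpa only [map_sum] using congrArg incl₁ h3
  have h2 := congrArg (op W) h1
  simp only [op_comp (W := W) (incl₁ ∘ₗ ofBidegrees M), op_comp (W := W) (LinearMap.lTensor _ _),
    op_comp (W := W) (LinearEquiv.toLinearMap _), op_comp (W := W) (LinearMap.rTensor _ _),
    op_assoc, one_mul, op_lTensor, op_rTensor, op_map', wh_TV, map_mul, sh_sh, mul_assoc,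
    Nat.reduceAdd] at h2
  exact h2

end StarIterates

/-! ### The Yang-Baxter algebra -/

section Conclusion

variable {K V : Type*} [Field K] [AddCommGroup V] [Module K V]
  {σ : V ⊗[K] V →ₗ[K] V ⊗[K] V} {M : ∀ p q : ℕ, (⨂[K]^p V) ⊗[K] (⨂[K]^q V) →ₗ[K] V}

instance : Nontrivial (TV K V) := by
  refine ⟨1, 0, fun h => one_ne_zero (α := K) ?_⟩
  rw [← counit_incl_zero (K := K) (V := V) 1, ← one_eq_incl, h, map_zero]

theorem starPow_incl₂_eq_zero (h : IsQuantumBInfty σ M) {n p q : ℕ} (hn : p + q ≤ n)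
    (z : (⨂[K]^p V) ⊗[K] (⨂[K]^q V)) : starPow σ M n (incl₂ K V p q z) = 0 := by
  obtain ⟨I, _, ⟨_⟩⟩ := exists_strand K (TV K V)
  have h1 : (incl K V (n + 1) ∘ₗ starPow σ M n) ∘ₗ
      TensorProduct.map (degProj K V p) (degProj K V q) = 0 := by
    refine op_injective (W := (ℕ → I) →₀ K) ?_
    rw [op_comp, op_map', op_zero, wh_TV]
    exact (mulRel _ h).iterate_mul_grading (tensorRel K V _) (braidRel _ h.braiding)
      (opN_zero _) (opN_succ _ h) n (p, q) hn
  have h2 := LinearMap.congr_fun h1 (incl₂ K V p q z)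
  rw [LinearMap.comp_apply, map_degProj_incl₂, LinearMap.comp_apply] at h2
  rw [← component_incl (n + 1) (starPow σ M n (incl₂ K V p q z)), h2, LinearMap.zero_apply,
    map_zero]

/-- On each element the iterates vanish eventually, and then their sum is the product. -/
theorem exists_star_eq_sum (h : IsQuantumBInfty σ M) (x : TV K V ⊗[K] TV K V) :
    ∃ N, (∀ n, N ≤ n → starPow σ M n x = 0) ∧ star σ M x = counit₂ K V x • (1 : TV K V) +
      ∑ n ∈ Finset.range N, incl K V (n + 1) (starPow σ M n x) := by
  have hsum : ∀ (y : TV K V ⊗[K] TV K V) (N N' : ℕ), N ≤ N' →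
      (∀ n, N ≤ n → starPow σ M n y = 0) →
      ∑ n ∈ Finset.range N', incl K V (n + 1) (starPow σ M n y) =
        ∑ n ∈ Finset.range N, incl K V (n + 1) (starPow σ M n y) := by
    intro y N N' hN hy
    refine (Finset.sum_subset (Finset.range_mono hN) fun n _ hn => ?_).symm
    rw [hy n (by simpa using hn), map_zero]
  have hadd : ∀ y z : TV K V ⊗[K] TV K V,
      (∃ N, (∀ n, N ≤ n → starPow σ M n y = 0) ∧ star σ M y = counit₂ K V y • (1 : TV K V) +
        ∑ n ∈ Finset.range N, incl K V (n + 1) (starPow σ M n y)) →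
      (∃ N, (∀ n, N ≤ n → starPow σ M n z = 0) ∧ star σ M z = counit₂ K V z • (1 : TV K V) +
        ∑ n ∈ Finset.range N, incl K V (n + 1) (starPow σ M n z)) →
      ∃ N, (∀ n, N ≤ n → starPow σ M n (y + z) = 0) ∧ star σ M (y + z) =
        counit₂ K V (y + z) • (1 : TV K V) +
        ∑ n ∈ Finset.range N, incl K V (n + 1) (starPow σ M n (y + z)) := by
    rintro y z ⟨N, hN, hy⟩ ⟨N', hN', hz⟩
    refine ⟨max N N', fun n hn => ?_, ?_⟩
    · rw [map_add, hN n (le_of_max_le_left hn), hN' n (le_of_max_le_right hn), add_zero]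
    · rw [← hsum y N _ (le_max_left N N') hN] at hy
      rw [← hsum z N' _ (le_max_right N N') hN'] at hz
      simp only [map_add, Finset.sum_add_distrib, add_smul, hy, hz]
      abel
  induction x using TensorProduct.induction_on with
  | zero => exact ⟨0, fun n _ => map_zero _, by simp⟩
  | add y z hy hz => exact hadd y z hy hz
  | tmul x y =>
    induction x using DirectSum.induction_on with
    | zero => exact ⟨0, fun n _ => by simp, by simp⟩
    | add x x' hx hx' => rw [TensorProduct.add_tmul]; exact hadd _ _ hx hx'
    | of p x =>
      induction y using DirectSum.induction_on with
      | zero => exact ⟨0, fun n _ => by simp, by simp⟩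
      | add y y' hy hy' => rw [TensorProduct.tmul_add]; exact hadd _ _ hy hy'
      | of q y =>
        exact ⟨p + q, fun n hn => starPow_incl₂_eq_zero h hn (x ⊗ₜ y), star_incl₂ p q (x ⊗ₜ y)⟩

/-- The product is the only coalgebra map with the given corestriction to `V`. -/
theorem eq_star_iff (h : IsQuantumBInfty σ M) (f : TV K V ⊗[K] TV K V →ₗ[K] TV K V) :
    (IsCoalgMap σ f ∧ projV K V ∘ₗ f = ofBidegrees M) ↔ f = star σ M := by
  obtain ⟨I, _, ⟨_⟩⟩ := exists_strand K (TV K V)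
  have H := tensorRel K V ((ℕ → I) →₀ K)
  have B := braidRel ((ℕ → I) →₀ K) h.braiding
  have S := starRel ((ℕ → I) →₀ K) h
  constructor
  · rintro ⟨⟨he, hd⟩, hp⟩
    refine op_injective (W := (ℕ → I) →₀ K) ?_
    refine S.eq_of_coalg H B ?_ ?_ ?_
    · have h1 := congrArg (op ((ℕ → I) →₀ K)) he
      rw [op_comp, op_counit₂] at h1
      exact h1
    · have h1 := congrArg (op ((ℕ → I) →₀ K)) hd
      rw [op_comp, op_comp, op_map, op_comulBeta, wh_TV₂, mul_assoc] at h1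
      exact h1
    · have h1 : degProj K V 1 ∘ₗ f = incl₁ ∘ₗ ofBidegrees M := by
        rw [degProj_one, ← hp]; rfl
      have h2 := congrArg (op ((ℕ → I) →₀ K)) h1
      rw [op_comp] at h2
      exact h2
  · rintro rfl
    refine ⟨⟨?_, ?_⟩, ?_⟩
    · refine op_injective (W := (ℕ → I) →₀ K) ?_
      rw [op_comp, op_counit₂]
      have key := S.e_s H
      exact key
    · refine op_injective (W := (ℕ → I) →₀ K) ?_
      rw [op_comp, op_comp, op_map, op_comulBeta, wh_TV₂, mul_assoc]
      have key := S.d_s H B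
      exact key
    · have h1 : degProj K V 1 ∘ₗ star σ M = incl₁ ∘ₗ ofBidegrees M := by
        refine op_injective (W := (ℕ → I) →₀ K) ?_
        rw [op_comp]
        have key := S.q_s H B
        exact key
      refine LinearMap.ext fun x => ?_
      have h2 := congrArg (projV K V) (LinearMap.congr_fun h1 x)
      simpa only [degProj_one, LinearMap.comp_apply, projV_incl₁] using h2

theorem isBraiding_beta (h : IsBraiding σ) : IsBraiding (beta σ) where
  bijective := beta_bijective h.bijective
  yang_baxter := by
    obtain ⟨I, _, ⟨_⟩⟩ := exists_strand K (TV K V)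
    refine op_injective (W := (ℕ → I) →₀ K) ?_
    simp only [op_comp, op_act₁, op_act₂]
    exact ((braidRel _ h).yang_baxter_eq (tensorRel K V _)).symm

theorem isYBAlgebra_star (h : IsQuantumBInfty σ M) : IsYBAlgebra (star σ M) (1 : TV K V) (beta σ) := by
  obtain ⟨I, _, ⟨_⟩⟩ := exists_strand K (TV K V)
  have H := tensorRel K V ((ℕ → I) →₀ K)
  have B := braidRel ((ℕ → I) →₀ K) h.braiding
  have S := starRel ((ℕ → I) →₀ K) h
  refine ⟨fun a b c => ?_, fun a => ?_, fun a => ?_, isBraiding_beta h.braiding, ?_, ?_,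
    beta_one_tmul σ, beta_tmul_one σ⟩
  · have h1 : star σ M ∘ₗ (star σ M).rTensor (TV K V) = star σ M ∘ₗ (star σ M).lTensor (TV K V) ∘ₗ
        (TensorProduct.assoc K _ _ _).toLinearMap := by
      refine op_injective (W := (ℕ → I) →₀ K) ?_
      rw [op_comp, op_comp, op_comp, op_assoc, op_lTensor, op_rTensor, mul_one, wh_TV]
      have key := S.s_s H B (opM_opS _ h)
      exact key
    exact LinearMap.congr_fun h1 ((a ⊗ₜ b) ⊗ₜ c)
  · have h1 : star σ M ∘ₗ (Algebra.linearMap K (TV K V)).rTensor (TV K V) ∘ₗ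
        (TensorProduct.lid K _).symm.toLinearMap = LinearMap.id := by
      refine op_injective (W := (ℕ → I) →₀ K) ?_
      rw [op_comp, op_comp, op_lid_symm, op_rTensor, mul_one, wh_TV, op_id]
      have key := S.s_wu H B
      exact key
    simpa using LinearMap.congr_fun h1 a
  · have h1 : star σ M ∘ₗ (Algebra.linearMap K (TV K V)).lTensor (TV K V) ∘ₗ
        (TensorProduct.rid K _).symm.toLinearMap = LinearMap.id := by
      refine op_injective (W := (ℕ → I) →₀ K) ?_
      rw [op_comp, op_comp, op_rid_symm, op_lTensor, mul_one, op_id]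
      have key := S.s_u H B
      exact key
    simpa using LinearMap.congr_fun h1 a
  · refine op_injective (W := (ℕ → I) →₀ K) ?_
    rw [op_comp, op_comp, op_comp, op_comp, op_act₁, op_act₂, op_assoc, op_lTensor, op_rTensor,
      one_mul, wh_TV]
    have key := S.b_ws H B
    exact key
  · refine op_injective (W := (ℕ → I) →₀ K) ?_
    rw [op_comp, op_comp, op_comp, op_comp, op_act₁, op_act₂, op_assoc, op_lTensor, op_rTensor,
      mul_one, wh_TV]
    have key := S.b_s H B
    exact key

end Conclusion

end QBInf

end

theorem theorem4p16 {K V : Type*} [Field K] [CharZero K] [AddCommGroup V] [Module K V]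
    (σ : V ⊗[K] V →ₗ[K] V ⊗[K] V)
    (M : ∀ p q : ℕ, (⨂[K]^p V) ⊗[K] (⨂[K]^q V) →ₗ[K] V)
    (h : QBInf.IsQuantumBInfty σ M) :
    (∀ x : QBInf.TV K V ⊗[K] QBInf.TV K V,
      {n : ℕ | QBInf.starPow σ M n x ≠ 0}.Finite ∧
      QBInf.star σ M x = QBInf.counit₂ K V x • (1 : QBInf.TV K V) +
        ∑ᶠ n : ℕ, QBInf.incl K V (n + 1) (QBInf.starPow σ M n x)) ∧
    (∀ f : QBInf.TV K V ⊗[K] QBInf.TV K V →ₗ[K] QBInf.TV K V,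
      (QBInf.IsCoalgMap σ f ∧ QBInf.projV K V ∘ₗ f = QBInf.ofBidegrees M) ↔
        f = QBInf.star σ M) ∧
    QBInf.IsYBAlgebra (QBInf.star σ M) (1 : QBInf.TV K V) (QBInf.beta σ) := by
  refine ⟨fun x => ?_, QBInf.eq_star_iff h, QBInf.isYBAlgebra_star h⟩
  obtain ⟨N, hN, hx⟩ := QBInf.exists_star_eq_sum h x
  refine ⟨(Set.finite_lt_nat N).subset fun n hn => ?_, ?_⟩
  · by_contra hn'
    exact hn (hN n (not_lt.1 hn'))
  · rw [hx, finsum_eq_sum_of_support_subset]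
    intro n hn
    by_contra hn'
    refine hn ?_
    simp only [hN n (by simpa using hn'), map_zero]
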